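/- Let $S$ be a tree on $n$ nodes. A \emph{search tree} on $S$ is a rooted tree $T$ with $V(T)=V(S)$, defined recursively: the root $r$ of $T$ is a node of $S$, and the subtrees of $T$ rooted at the children of $r$ are search trees on the connected components of $S \setminus r$, one for each component. The depth $\mathrm{depth}_T(x)$ of a node $x$ is the number of nodes on the path from the root of $T$ to $x$. The cost of serving a search sequence $X=(x_1,\dots,x_m)\in V(S)^m$ in $T$ is $\mathrm{cost}_T(X)=\sum_{i=1}^m \mathrm{depth}_T(x_i)$, and $\mathrm{OPT}(X)$ is the minimum of $\mathrm{cost}_T(X)$ over all search trees $T$ on $S$. Theorem. For every integer $t\ge 1$ there is an algorithm that, given a tree $S$ on $n$ nodes and, for a search sequence $X$ over the nodes of $S$, the number of occurrences of each node in $X$, computes in time $O(n^{2t+1})$ a search tree on $S$ that serves $X$ with cost at most $\left(1+\frac1t\right)\cdot \mathrm{OPT}(X)$. Here the constant in the $O$-notation depends only on $t$, the tree $S$ is given by its adjacency matrix, the search tree is returned by its parent pointers, and time is the number of steps on a word RAM with words of $O(\log(n+m))$ bits (constant depending only on $t$), where $m$ is the length of $X$. -/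

import Mathlib

/-! ### Search trees on trees -/

namespace STT

/-- `C` is the node set of a connected component of the induced subgraph `S[B]`. -/
def IsComponent {V : Type*} (S : SimpleGraph V) (B C : Set V) : Prop :=
  ∃ K : (S.induce B).ConnectedComponent, C = Subtype.val '' K.supp

/-- A rooted tree is given by its parent function, with `none` at the root.
`IsSearchTreeOn S parent A r` says that, on the node set `A`, `parent` describes a search tree
with root `r` on `S[A]`: the children of `r` are one node `child C` from every connected
component `C` of `S[A] ∖ r`, and the subtree rooted at `child C` is a search tree on `C`. -/
inductive IsSearchTreeOn {V : Type*} (S : SimpleGraph V) (parent : V → Option V) :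
    Set V → V → Prop
  | node (A : Set V) (r : V) (hr : r ∈ A) (child : Set V → V)
      (hparent : ∀ C, IsComponent S (A \ {r}) C → parent (child C) = some r)
      (hsub : ∀ C, IsComponent S (A \ {r}) C → IsSearchTreeOn S parent C (child C)) :
      IsSearchTreeOn S parent A r

/-- `parent` is the parent function of a search tree on `S`. -/
def IsSearchTree {V : Type*} (S : SimpleGraph V) (parent : V → Option V) : Prop :=
  ∃ r, parent r = none ∧ IsSearchTreeOn S parent Set.univ r

/-- The search path of `x`: `x` and all its ancestors. -/
def searchPath {V : Type*} (parent : V → Option V) (x : V) : Set V :=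
  {y | Relation.ReflTransGen (fun a b => parent a = some b) x y}

/-- The depth of `x` is the number of nodes on its search path (so the root has depth `1`). -/
noncomputable def depth {V : Type*} (parent : V → Option V) (x : V) : ℕ :=
  (searchPath parent x).ncard

/-- The cost of serving the search sequence `X` in a fixed tree. -/
noncomputable def cost {V : Type*} (parent : V → Option V) (X : List V) : ℕ :=
  (X.map (depth parent)).sum

/-- The minimum cost of serving `X` in a fixed search tree on `S`. -/
noncomputable def opt {V : Type*} (S : SimpleGraph V) (X : List V) : ℕ :=
  sInf {c | ∃ parent : V → Option V, IsSearchTree S parent ∧ cost parent X = c}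

/-! ### A word RAM

Programs are structured `while` programs over integer variables and integer arrays. Each program
mentions finitely many of them. All numbers that are computed have to be smaller than the word
bound `B`, and every elementary operation costs one step. -/

/-- The arithmetic operations and comparisons of the machine. -/
inductive BinOp
  | add | sub | mul | div | mod | lt | eq

/-- Subtraction is truncated, division rounds down, comparisons return `1` or `0`. -/
def BinOp.eval : BinOp → ℕ → ℕ → ℕ
  | .add, a, b => a + b
  | .sub, a, b => a - b
  | .mul, a, b => a * b
  | .div, a, b => a / b
  | .mod, a, b => a % b
  | .lt, a, b => if a < b then 1 else 0
  | .eq, a, b => if a = b then 1 else 0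

/-- The memory: variables `var x` and array cells `arr a i`. -/
@[ext] structure State where
  var : ℕ → ℕ
  arr : ℕ → ℕ → ℕ

/-- Expressions: constants, variables, array cells `a[e]`, and binary operations. -/
inductive Expr
  | lit (c : ℕ)
  | var (x : ℕ)
  | get (a : ℕ) (e : Expr)
  | bin (o : BinOp) (e f : Expr)

def Expr.eval (s : State) : Expr → ℕ
  | .lit c => c
  | .var x => s.var x
  | .get a e => s.arr a (e.eval s)
  | .bin o e f => o.eval (e.eval s) (f.eval s)

/-- The number of steps needed to evaluate an expression: one for each node of its syntax tree. -/
def Expr.time : Expr → ℕ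
  | .lit _ => 1
  | .var _ => 1
  | .get _ e => e.time + 1
  | .bin _ e f => e.time + f.time + 1

/-- All values that occur in the evaluation of an expression are smaller than `B`. -/
def Expr.Fits (B : ℕ) (s : State) : Expr → Prop
  | .lit c => c < B
  | .var x => s.var x < B
  | .get a e => e.Fits B s ∧ s.arr a (e.eval s) < B
  | .bin o e f => e.Fits B s ∧ f.Fits B s ∧ o.eval (e.eval s) (f.eval s) < B

/-- Programs; `put a e f` is the assignment `a[e] := f`, and `loop e p` is `while e do p`. Conditions are true if nonzero. -/
inductive Cmd
  | skip
  | set (x : ℕ) (e : Expr)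
  | put (a : ℕ) (e f : Expr)
  | seq (p q : Cmd)
  | ite (e : Expr) (p q : Cmd)
  | loop (e : Expr) (p : Cmd)

/-- `Exec B p s k s'`: started in memory `s`, the program `p` halts after exactly `k` steps with
memory `s'`, and all values computed on the way are smaller than `B`. -/
inductive Exec (B : ℕ) : Cmd → State → ℕ → State → Prop
  | skip (s : State) : Exec B .skip s 1 s
  | set (s : State) (x : ℕ) (e : Expr) (he : e.Fits B s) :
      Exec B (.set x e) s (e.time + 1) { s with var := Function.update s.var x (e.eval s) }
  | put (s : State) (a : ℕ) (e f : Expr) (he : e.Fits B s) (hf : f.Fits B s) :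
      Exec B (.put a e f) s (e.time + f.time + 1)
        { s with arr := Function.update s.arr a
                  (Function.update (s.arr a) (e.eval s) (f.eval s)) }
  | seq (p q : Cmd) (s₀ s₁ s₂ : State) (k l : ℕ) (hp : Exec B p s₀ k s₁)
      (hq : Exec B q s₁ l s₂) : Exec B (.seq p q) s₀ (k + l) s₂
  | ite_true (e : Expr) (p q : Cmd) (s s' : State) (k : ℕ) (he : e.Fits B s)
      (hc : e.eval s ≠ 0) (hp : Exec B p s k s') : Exec B (.ite e p q) s (e.time + 1 + k) s'
  | ite_false (e : Expr) (p q : Cmd) (s s' : State) (k : ℕ) (he : e.Fits B s)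
      (hc : e.eval s = 0) (hq : Exec B q s k s') : Exec B (.ite e p q) s (e.time + 1 + k) s'
  | loop_false (e : Expr) (p : Cmd) (s : State) (he : e.Fits B s) (hc : e.eval s = 0) :
      Exec B (.loop e p) s (e.time + 1) s
  | loop_true (e : Expr) (p : Cmd) (s₀ s₁ s₂ : State) (k l : ℕ) (he : e.Fits B s₀)
      (hc : e.eval s₀ ≠ 0) (hp : Exec B p s₀ k s₁) (hw : Exec B (.loop e p) s₁ l s₂) :
      Exec B (.loop e p) s₀ (e.time + 1 + k + l) s₂

open Classical in
/-- The initial memory for a graph `S` on `0, …, n - 1` and a search sequence `X`: variable `0`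
holds `n`, array `0` holds the adjacency matrix of `S` row by row, array `1` holds the number of
occurrences of each node in `X`, and everything else is zero. -/
noncomputable def input {n : ℕ} (S : SimpleGraph (Fin n)) (X : List (Fin n)) : State where
  var x := if x = 0 then n else 0
  arr a i :=
    if a = 0 then (if ∃ u v : Fin n, i = u * n + v ∧ S.Adj u v then 1 else 0)
    else if a = 1 then (if h : i < n then X.count ⟨i, h⟩ else 0)
    else 0

/-- The final memory holds the tree with the given parent function in array `2`: cell `v` is `0`
if `v` is the root, and `u + 1` if the parent of `v` is `u`. -/
def IsOutput {n : ℕ} (s : State) (parent : Fin n → Option (Fin n)) : Prop :=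
  ∀ v : Fin n, s.arr 2 v = (parent v).elim 0 (fun u => (u : ℕ) + 1)

end STT

/-! The algorithm is a dynamic program over connected node sets that are intersections of at most `k
= 2t` half-spaces, a half-space being the set of nodes behind an oriented edge. A tree has `2(n -
1)` oriented edges, so there are `O(n ^ (2t))` such sets. All roots of one set can be compared in
time `O(n)`, because a single scan of the edges adds the value of each part to the root it hangs
from. It remains to see that admitting only such sets loses a factor of at most `1 + 1/t`.

Let `d` be the depth in an optimal search tree. The only property needed is that every nonempty
convex set has a unique node of least depth (`IsSearchTree.exists_depth_lt`). In a subproblem, take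
this node `r` as root: every part inherits the boundary edges lying on its side and gets one new
edge, the one to `r`. This is forbidden only if all `2t` outer endpoints lie on the same side of
`r`. In that case the root is a centroid `v` of the `2t` outer endpoints together with `r`
(`exists_centroid`), so that no part contains more than `t` of these `2t + 1` points, and `r`
becomes the root of its part, one level below `v`.

The additional levels are amortized in `IsSubsolution.approx`. Scale costs by `t`, and let each
level of the optimal tree pay `t + 1` per unit of weight. An ordinary level costs `t` and stores the
remaining `1` for the new boundary edge; the potential is the excess of the number of boundary edges
over `t + 1`. At a centroid the potential is `t - 1` and drops to `0`, and `(t + 1) + (t - 1) = 2t`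
pays for the two levels of `v` and `r`.

This bound holds for every function satisfying the inequalities of the recurrence (`IsSubsolution`).
Conversely, where the recurrence is attained below the infinite value, following the chosen roots
gives a search tree of no larger cost (`isSearchTree_of_descend`). `EdgeTable.approx_of_tables`
combines both for tables indexed by numbers: a subproblem is a `k`-digit number in base `E + 1`,
whose digits name the bounding edges and whose digit `0` is an empty slot. The programs are then
shown to fill these tables; `Run` records correctness, a time bound and the unchanged part of the
memory. -/

namespace STT

/-! ### Reasoning about programs -/

/-- All numbers stored in the memory are smaller than the word bound. -/
structure Bounded (B : ℕ) (s : State) : Prop where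
  one_lt : 1 < B
  var : ∀ x, s.var x < B
  arr : ∀ a i, s.arr a i < B

/-- The part of `Expr.Fits` that does not follow from `Bounded`. -/
def Expr.Ok (B : ℕ) (s : State) : Expr → Prop
  | .lit c => c < B
  | .var _ => True
  | .get _ e => e.Ok B s
  | .bin .add e f => e.Ok B s ∧ f.Ok B s ∧ e.eval s + f.eval s < B
  | .bin .mul e f => e.Ok B s ∧ f.Ok B s ∧ e.eval s * f.eval s < B
  | .bin _ e f => e.Ok B s ∧ f.Ok B s

theorem Expr.Fits.eval_lt {B : ℕ} {s : State} {e : Expr} (h : e.Fits B s) : e.eval s < B := by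
  cases e with
  | lit c => exact h
  | var x => exact h
  | get a e => exact h.2
  | bin o e f => exact h.2.2

/-- Truncated subtraction, division and remainder do not exceed the left operand, and comparisons
are at most `1`. In a bounded memory only literals, sums and products can overflow. -/
theorem Expr.Ok.fits {B : ℕ} {s : State} (hs : Bounded B s) {e : Expr} (h : e.Ok B s) :
    e.Fits B s := by
  induction e with
  | lit c => exact h
  | var x => exact hs.var x
  | get a e ih => exact ⟨ih h, hs.arr _ _⟩
  | bin o e f ihe ihf =>
    have h1 := hs.one_lt
    cases o
    case add => exact ⟨ihe h.1, ihf h.2.1, h.2.2⟩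
    case mul => exact ⟨ihe h.1, ihf h.2.1, h.2.2⟩
    case sub => exact ⟨ihe h.1, ihf h.2, (Nat.sub_le _ _).trans_lt (ihe h.1).eval_lt⟩
    case div => exact ⟨ihe h.1, ihf h.2, (Nat.div_le_self _ _).trans_lt (ihe h.1).eval_lt⟩
    case mod => exact ⟨ihe h.1, ihf h.2, (Nat.mod_le _ _).trans_lt (ihe h.1).eval_lt⟩
    case lt => refine ⟨ihe h.1, ihf h.2, ?_⟩; simp only [BinOp.eval]; split <;> omega
    case eq => refine ⟨ihe h.1, ihf h.2, ?_⟩; simp only [BinOp.eval]; split <;> omega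

/-- Assignment to a variable. -/
def State.setVar (s : State) (x v : ℕ) : State :=
  { s with var := Function.update s.var x v }

/-- Assignment to an array cell. -/
def State.setArr (s : State) (a i v : ℕ) : State :=
  { s with arr := Function.update s.arr a (Function.update (s.arr a) i v) }

@[simp] theorem State.setVar_var (s : State) (x v y : ℕ) :
    (s.setVar x v).var y = if y = x then v else s.var y := by
  simp [State.setVar, Function.update_apply]

@[simp] theorem State.setVar_arr (s : State) (x v : ℕ) : (s.setVar x v).arr = s.arr := rfl

@[simp] theorem State.setArr_var (s : State) (a i v : ℕ) : (s.setArr a i v).var = s.var := rfl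

@[simp] theorem State.setArr_arr (s : State) (a i v b : ℕ) :
    (s.setArr a i v).arr b = if b = a then Function.update (s.arr a) i v else s.arr b := by
  simp [State.setArr, Function.update_apply]

/-- The variables a program may change. -/
def Cmd.wv : Cmd → List ℕ
  | .skip => []
  | .set x _ => [x]
  | .put _ _ _ => []
  | .seq p q => p.wv ++ q.wv
  | .ite _ p q => p.wv ++ q.wv
  | .loop _ p => p.wv

/-- The arrays a program may change. -/
def Cmd.wa : Cmd → List ℕ
  | .skip => []
  | .set _ _ => []
  | .put a _ _ => [a]
  | .seq p q => p.wa ++ q.wa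
  | .ite _ p q => p.wa ++ q.wa
  | .loop _ p => p.wa

/-- `s` and `s'` agree outside the variables `vs` and the arrays `as`. -/
structure Frame (vs as : List ℕ) (s s' : State) : Prop where
  var : ∀ x, x ∉ vs → s'.var x = s.var x
  arr : ∀ a, a ∉ as → s'.arr a = s.arr a

theorem Frame.refl (vs as : List ℕ) (s : State) : Frame vs as s s := ⟨fun _ _ => rfl, fun _ _ => rfl⟩

theorem Frame.trans {vs as : List ℕ} {s₀ s₁ s₂ : State} (h : Frame vs as s₀ s₁)
    (h' : Frame vs as s₁ s₂) : Frame vs as s₀ s₂ :=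
  ⟨fun x hx => (h'.var x hx).trans (h.var x hx), fun a ha => (h'.arr a ha).trans (h.arr a ha)⟩

theorem Frame.mono {vs as vs' as' : List ℕ} {s s' : State} (h : Frame vs as s s')
    (hv : vs ⊆ vs') (ha : as ⊆ as') : Frame vs' as' s s' :=
  ⟨fun x hx => h.var x fun h' => hx (hv h'), fun x hx => h.arr x fun h' => hx (ha h')⟩

theorem Frame.setVar {vs as : List ℕ} (s : State) (x v : ℕ) (h : x ∈ vs) :
    Frame vs as s (s.setVar x v) :=
  ⟨fun y hy => by simp only [State.setVar_var]; rw [if_neg]; rintro rfl; exact hy h, fun _ _ => rfl⟩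

theorem Frame.setArr {vs as : List ℕ} (s : State) (a i v : ℕ) (h : a ∈ as) :
    Frame vs as s (s.setArr a i v) :=
  ⟨fun _ _ => rfl, fun y hy => by
    simp only [State.setArr_arr]; rw [if_neg]; rintro rfl; exact hy h⟩

theorem Bounded.setVar {B : ℕ} {s : State} (h : Bounded B s) {x v : ℕ} (hv : v < B) :
    Bounded B (s.setVar x v) :=
  ⟨h.one_lt, fun y => by simp only [State.setVar_var]; split; exacts [hv, h.var y], h.arr⟩

theorem Bounded.setArr {B : ℕ} {s : State} (h : Bounded B s) {a i v : ℕ} (hv : v < B) :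
    Bounded B (s.setArr a i v) :=
  ⟨h.one_lt, h.var, fun b j => by
    simp only [State.setArr_arr]
    split
    · rw [Function.update_apply]; split; exacts [hv, h.arr _ _]
    · exact h.arr b j⟩

/-- Started in `s`, the program `p` halts after at most `T` steps with a memory that satisfies
`Q`. -/
def Run (B : ℕ) (p : Cmd) (s : State) (T : ℕ) (Q : State → Prop) : Prop :=
  Bounded B s → ∃ k s', Exec B p s k s' ∧ k ≤ T ∧ Bounded B s' ∧ Frame p.wv p.wa s s' ∧ Q s'

section rules

variable {B : ℕ} {s : State} {Q : State → Prop}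

theorem Run.of_le {p : Cmd} {T T' : ℕ} (h : Run B p s T Q) (hT : T ≤ T') : Run B p s T' Q :=
  fun hs => let ⟨k, s', h1, h2, h3⟩ := h hs; ⟨k, s', h1, h2.trans hT, h3⟩

theorem Run.mono {p : Cmd} {T : ℕ} {Q' : State → Prop} (h : Run B p s T Q)
    (hQ : ∀ s', Bounded B s' → Frame p.wv p.wa s s' → Q s' → Q' s') : Run B p s T Q' :=
  fun hs => let ⟨k, s', h1, h2, h3, h4, h5⟩ := h hs; ⟨k, s', h1, h2, h3, h4, hQ s' h3 h4 h5⟩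

theorem Run.bounded {p : Cmd} {T : ℕ} (h : Bounded B s → Run B p s T Q) : Run B p s T Q :=
  fun hs => h hs hs

theorem run_skip (h : Q s) : Run B .skip s 1 Q :=
  fun hs => ⟨1, s, .skip s, le_rfl, hs, .refl _ _ _, h⟩

theorem run_set {x : ℕ} {e : Expr} (he : e.Ok B s) (h : Q (s.setVar x (e.eval s))) :
    Run B (.set x e) s (e.time + 1) Q :=
  fun hs => ⟨_, _, .set s x e (he.fits hs), le_rfl, hs.setVar (he.fits hs).eval_lt,
    .setVar _ _ _ (by simp [Cmd.wv]), h⟩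

theorem run_put {a : ℕ} {e f : Expr} (he : e.Ok B s) (hf : f.Ok B s)
    (h : Q (s.setArr a (e.eval s) (f.eval s))) :
    Run B (.put a e f) s (e.time + f.time + 1) Q :=
  fun hs => ⟨_, _, .put s a e f (he.fits hs) (hf.fits hs), le_rfl,
    hs.setArr (hf.fits hs).eval_lt, .setArr _ _ _ _ (by simp [Cmd.wa]), h⟩

/-- The postcondition of `p` is itself a `Run` statement about `q`, so a program is processed from
front to back without naming intermediate assertions. -/
theorem run_seq {p q : Cmd} {T T' : ℕ} (h : Run B p s T fun s' => Run B q s' T' Q) :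
    Run B (.seq p q) s (T + T') Q := by
  intro hs
  obtain ⟨k, s₁, h1, h2, h3, h4, h5⟩ := h hs
  obtain ⟨l, s₂, g1, g2, g3, g4, g5⟩ := h5 h3
  exact ⟨_, s₂, .seq _ _ _ _ _ _ _ h1 g1, by omega, g3,
    (h4.mono (by simp [Cmd.wv]) (by simp [Cmd.wa])).trans
      (g4.mono (by simp [Cmd.wv]) (by simp [Cmd.wa])), g5⟩

theorem run_ite_true {e : Expr} {p q : Cmd} {T : ℕ} (he : e.Ok B s) (hc : e.eval s ≠ 0)
    (h : Run B p s T Q) : Run B (.ite e p q) s (e.time + 1 + T) Q := by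
  intro hs
  obtain ⟨k, s₁, h1, h2, h3, h4, h5⟩ := h hs
  exact ⟨_, s₁, .ite_true _ _ _ _ _ _ (he.fits hs) hc h1, by omega, h3,
    h4.mono (by simp [Cmd.wv]) (by simp [Cmd.wa]), h5⟩

theorem run_ite_false {e : Expr} {p q : Cmd} {T : ℕ} (he : e.Ok B s) (hc : e.eval s = 0)
    (h : Run B q s T Q) : Run B (.ite e p q) s (e.time + 1 + T) Q := by
  intro hs
  obtain ⟨k, s₁, h1, h2, h3, h4, h5⟩ := h hs
  exact ⟨_, s₁, .ite_false _ _ _ _ _ _ (he.fits hs) hc h1, by omega, h3,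
    h4.mono (by simp [Cmd.wv]) (by simp [Cmd.wa]), h5⟩

theorem run_ite {e : Expr} {p q : Cmd} {T T' : ℕ} (he : e.Ok B s)
    (h : e.eval s ≠ 0 → Run B p s T Q) (h' : e.eval s = 0 → Run B q s T' Q) :
    Run B (.ite e p q) s (e.time + 1 + (T + T')) Q := by
  by_cases hc : e.eval s = 0
  · exact (run_ite_false he hc (h' hc)).of_le (by omega)
  · exact (run_ite_true he hc (h hc)).of_le (by omega)

end rules

/-- `for x in 0, …, lim - 1 do body`. -/
def forLoop (x : ℕ) (lim : Expr) (body : Cmd) : Cmd :=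
  .seq (.set x (.lit 0))
    (.loop (.bin .lt (.var x) lim) (.seq body (.set x (.bin .add (.var x) (.lit 1)))))

/-- The time of the body may depend on the index, which `run_dpProg` needs for its amortized count.
Each round adds `lim.time + 3` for the test and `4` for the increment; initialization and the final
test take `2 + (lim.time + 3)`. -/
theorem run_for {B : ℕ} {s₀ : State} {Q : State → Prop} {x : ℕ} {lim : Expr} {body : Cmd}
    (N : ℕ) (T : ℕ → ℕ) (Inv : ℕ → State → Prop)
    (hx : x ∉ body.wv)
    (hlim : ∀ s, Frame (x :: body.wv) body.wa s₀ s → lim.eval s = N ∧ lim.Ok B s)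
    (hinv : ∀ i s v, Inv i s → Inv i (s.setVar x v))
    (h0 : Inv 0 s₀)
    (hstep : ∀ i < N, ∀ s, Bounded B s → Frame (x :: body.wv) body.wa s₀ s → s.var x = i →
      Inv i s → Run B body s (T i) (Inv (i + 1)))
    (hQ : ∀ s, Bounded B s → Frame (x :: body.wv) body.wa s₀ s → Inv N s → Q s) :
    Run B (forLoop x lim body) s₀
      ((∑ i ∈ Finset.range N, (T i + (lim.time + 7))) + (lim.time + 5)) Q := by
  -- Induction on the number `j` of remaining rounds.
  have key : ∀ j i, i + j = N → ∀ s, Bounded B s → Frame (x :: body.wv) body.wa s₀ s →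
      s.var x = i → Inv i s → Run B
        (.loop (.bin .lt (.var x) lim) (.seq body (.set x (.bin .add (.var x) (.lit 1))))) s
        ((∑ i ∈ Finset.Ico i N, (T i + (lim.time + 7))) + (lim.time + 3)) Q := by
    intro j
    induction j with
    | zero =>
      intro i hi s hs hf hxi hI _
      obtain rfl : i = N := by omega
      obtain ⟨hl, hok⟩ := hlim s hf
      refine ⟨_, s, .loop_false _ _ _ ?_ ?_, ?_, hs, .refl _ _ _, hQ s hs hf hI⟩
      · exact Expr.Ok.fits hs ⟨trivial, hok⟩
      · simp [Expr.eval, BinOp.eval, hl, hxi]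
      · simp [Expr.time]; omega
    | succ j ih =>
      intro i hi s hs hf hxi hI _
      obtain ⟨hl, hok⟩ := hlim s hf
      obtain ⟨k, s₁, h1, h2, h3, h4, h5⟩ := hstep i (by omega) s hs hf hxi hI hs
      have hxi₁ : s₁.var x = i := by rw [h4.var x hx, hxi]
      have hN : N < B := hl ▸ (hok.fits hs).eval_lt
      have hf₁ : Frame (x :: body.wv) body.wa s (s₁.setVar x (i + 1)) :=
        (h4.mono (by simp) (by simp)).trans (.setVar _ _ _ (by simp))
      obtain ⟨l, s₂, g1, g2, g3, g4, g5⟩ := ih (i + 1) (by omega) (s₁.setVar x (i + 1))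
        (h3.setVar (by omega)) (hf.trans hf₁) (by simp) (hinv _ _ _ h5) (h3.setVar (by omega))
      have h1B := hs.one_lt
      have hset : Exec B (.set x (.bin .add (.var x) (.lit 1))) s₁ 4 (s₁.setVar x (i + 1)) := by
        have := Exec.set (B := B) s₁ x (.bin .add (.var x) (.lit 1))
          (Expr.Ok.fits h3 ⟨trivial, h1B, by simp only [Expr.eval, hxi₁]; omega⟩)
        simpa [Expr.eval, BinOp.eval, hxi₁, Expr.time, State.setVar] using this
      refine ⟨_, s₂, .loop_true _ _ _ _ _ _ _ ?_ ?_ (.seq _ _ _ _ _ _ _ h1 hset) g1, ?_, g3,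
        ?_, g5⟩
      · exact Expr.Ok.fits hs ⟨trivial, hok⟩
      · simp [Expr.eval, BinOp.eval, hl, hxi]; omega
      · rw [Finset.sum_eq_sum_Ico_succ_bot (by omega)]
        simp only [Expr.time]; omega
      · refine Frame.trans (hf₁.mono ?_ ?_) g4 <;> simp [Cmd.wv, Cmd.wa]
  refine (run_seq (T' := (∑ i ∈ Finset.range N, (T i + (lim.time + 7))) + (lim.time + 3))
    (Run.bounded fun hs => run_set (by have := hs.one_lt; simp only [Expr.Ok]; omega) ?_)).of_le ?_
  · refine Run.bounded fun hs => ?_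
    rw [Finset.range_eq_Ico]
    exact key N 0 (by omega) _ hs (.setVar _ _ _ (by simp)) (by simp [Expr.eval])
      (hinv _ _ _ h0)
  · simp only [Expr.time]; omega

theorem run_for_const {B : ℕ} {s₀ : State} {Q : State → Prop} {x : ℕ} {lim : Expr} {body : Cmd}
    (N T : ℕ) (Inv : ℕ → State → Prop)
    (hx : x ∉ body.wv)
    (hlim : ∀ s, Frame (x :: body.wv) body.wa s₀ s → lim.eval s = N ∧ lim.Ok B s)
    (hinv : ∀ i s v, Inv i s → Inv i (s.setVar x v))
    (h0 : Inv 0 s₀)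
    (hstep : ∀ i < N, ∀ s, Bounded B s → Frame (x :: body.wv) body.wa s₀ s → s.var x = i →
      Inv i s → Run B body s T (Inv (i + 1)))
    (hQ : ∀ s, Bounded B s → Frame (x :: body.wv) body.wa s₀ s → Inv N s → Q s) :
    Run B (forLoop x lim body) s₀ (N * (T + (lim.time + 7)) + (lim.time + 5)) Q :=
  (run_for N (fun _ => T) Inv hx hlim hinv h0 hstep hQ).of_le (by simp)

/-! ### Half-spaces of a tree -/

section tree

variable {V : Type*} {S : SimpleGraph V}

/-- The nodes that can be reached from the head of `d` without visiting its tail. -/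
def side (d : S.Dart) : Set V := {x | ∃ p : S.Walk d.snd x, d.fst ∉ p.support}

theorem snd_mem_side (d : S.Dart) : d.snd ∈ side d :=
  ⟨.nil, by simp [d.adj.ne]⟩

theorem fst_notMem_side (d : S.Dart) : d.fst ∉ side d := fun ⟨p, hp⟩ => hp p.end_mem_support

theorem side_of_adj {d : S.Dart} {x y : V} (hx : x ∈ side d) (h : S.Adj x y) (hy : y ≠ d.fst) :
    y ∈ side d := by
  obtain ⟨p, hp⟩ := hx
  exact ⟨p.concat h, by simp [SimpleGraph.Walk.support_concat, hp, hy.symm]⟩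

/-- `A` contains every path between two of its nodes. -/
def PathConvex (S : SimpleGraph V) (A : Set V) : Prop :=
  ∀ x ∈ A, ∀ y ∈ A, ∀ p : S.Walk x y, p.IsPath → ∀ z ∈ p.support, z ∈ A

open Classical in
-- In an acyclic graph the path `p` is the only one between its ends, so it equals the bypass of
-- `q`.
theorem support_subset_of_isPath (hS : S.IsAcyclic) {x y : V} (p q : S.Walk x y) (hp : p.IsPath) :
    p.support ⊆ q.support := by
  have h : p = q.bypass := congrArg Subtype.val
    ((hS.subsingleton_path x y).elim ⟨p, hp⟩ ⟨q.bypass, q.bypass_isPath⟩)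
  exact h ▸ q.support_bypass_subset_support

open Classical in
theorem mem_side_of_walk {d : S.Dart} {x z : V} (p : S.Walk d.snd x) (hp : d.fst ∉ p.support)
    (hz : z ∈ p.support) : z ∈ side d :=
  ⟨p.takeUntil z hz, fun h => hp (p.support_takeUntil_subset_support hz h)⟩

open Classical in
theorem pathConvex_side (hS : S.IsAcyclic) (d : S.Dart) : PathConvex S (side d) := by
  rintro x ⟨p, hp⟩ y ⟨q, hq⟩ r hr z hz
  have h := support_subset_of_isPath hS r (p.reverse.append q) hr
  have h' : d.fst ∉ r.support := fun h' => by simpa [hp, hq] using h h'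
  refine mem_side_of_walk (p.append r) (by simp [hp, h']) (by simp [hz])

/-- If the heads differed, the path from one head to the other would run through the common tail,
while the two walks to `x` join the heads without visiting it. -/
theorem dart_eq_of_mem_side (hS : S.IsAcyclic) {d d' : S.Dart} (h : d.fst = d'.fst) {x : V}
    (hx : x ∈ side d) (hx' : x ∈ side d') : d = d' := by
  obtain ⟨p, hp⟩ := hx
  obtain ⟨q, hq⟩ := hx'
  have hs : d.snd = d'.snd := by
    by_contra hne
    have h1 : S.Adj d.fst d'.snd := h ▸ d'.adj
    have := support_subset_of_isPath hS (.cons d.adj.symm (.cons h1 .nil)) (p.append q.reverse)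
      (by simp [SimpleGraph.Walk.cons_isPath_iff, d.adj.ne.symm, hne, h1.ne])
    have := this (show d.fst ∈ _ by simp)
    rw [← h] at hq
    simp [hp, hq] at this
  exact SimpleGraph.Dart.ext _ _ (Prod.ext h hs)

theorem exists_mem_side (hS : S.Preconnected) {A : Set V} (hA : PathConvex S A) {r x : V}
    (hr : r ∈ A) (hx : x ∈ A) (hne : x ≠ r) : ∃ d : S.Dart, d.fst = r ∧ d.snd ∈ A ∧ x ∈ side d := by
  obtain ⟨p, hp⟩ := (hS r x).exists_isPath
  have hA' := hA r hr x hx p hp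
  cases p with
  | nil => exact absurd rfl hne
  | cons h q =>
    rw [SimpleGraph.Walk.cons_isPath_iff] at hp
    exact ⟨⟨(_, _), h⟩, rfl, hA' _ (by simp), q, hp.2⟩

open Classical in
-- A path from `d.fst` through `d.snd` is contained in every walk with the same ends, so the two
-- sides are disjoint. If the path from `d.snd` to `x` meets `d.fst`, its remainder never returns to
-- `d.snd`, so the two sides cover everything.
theorem mem_side_symm (hS : S.IsTree) (d : S.Dart) (x : V) : x ∈ side d.symm ↔ x ∉ side d := by
  constructor
  · rintro ⟨q, hq⟩ ⟨p, hp⟩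
    have := support_subset_of_isPath hS.isAcyclic (.cons d.adj p.bypass) q
      ((SimpleGraph.Walk.cons_isPath_iff _ _).2
        ⟨p.bypass_isPath, fun h => hp (p.support_bypass_subset_support h)⟩)
    exact hq (this (show d.snd ∈ _ by simp))
  · intro hx
    obtain ⟨p, hp⟩ := (hS.connected.preconnected d.snd x).exists_isPath
    have ha : d.fst ∈ p.support := by
      by_contra h
      exact hx ⟨p, h⟩
    cases p with
    | nil =>
      simp only [SimpleGraph.Walk.support_nil, List.mem_singleton] at ha
      exact absurd ha d.adj.ne
    | cons h q =>
      rw [SimpleGraph.Walk.cons_isPath_iff] at hp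
      have ha' : d.fst ∈ q.support := by simpa [d.adj.ne] using ha
      exact ⟨q.dropUntil _ ha', fun h => hp.2 (q.support_dropUntil_subset_support ha' h)⟩

/-- A walk behind `d'` that met `d.fst` would put `d.fst` behind both `d'` and `d.symm`, which have
the same tail. -/
theorem side_subset_of_ne_symm (hS : S.IsAcyclic) {d d' : S.Dart} (h : d'.fst = d.snd)
    (hne : d' ≠ d.symm) : side d' ⊆ side d := by
  rintro x ⟨p, hp⟩
  have ha : d.fst ∉ p.support := fun ha =>
    hne (dart_eq_of_mem_side hS (by simpa using h) (mem_side_of_walk p hp ha)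
      (by simpa using snd_mem_side d.symm))
  have hadj : S.Adj d.snd d'.snd := h ▸ d'.adj
  exact ⟨.cons hadj p, by simp [ha, d.adj.ne]⟩

/-- This is why a boundary edge `d` whose outer endpoint is not behind the new edge `e` may be
forgotten: its constraint is implied by that of `e`. -/
theorem side_subset_of_fst_notMem {d e : S.Dart} (he : d.fst ∉ side e) (hr : e.fst ∈ side d) :
    side e ⊆ side d := by
  rintro x ⟨p, hp⟩
  have hu : e.snd ∈ side d :=
    side_of_adj hr e.adj fun h => he (h ▸ snd_mem_side e)
  obtain ⟨q, hq⟩ := hu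
  refine ⟨q.append p, ?_⟩
  simp only [SimpleGraph.Walk.mem_support_append_iff, not_or]
  exact ⟨hq, fun h => he (mem_side_of_walk p hp h)⟩

theorem reachable_induce {A : Set V} {x y : V} (p : S.Walk x y) (hp : ∀ z ∈ p.support, z ∈ A) :
    (S.induce A).Reachable ⟨x, hp x p.start_mem_support⟩ ⟨y, hp y p.end_mem_support⟩ :=
  ⟨p.induce A hp⟩

theorem isComponent_inter_side (hS : S.IsTree) {A : Set V} (hA : PathConvex S A) (d : S.Dart)
    (hd : d.snd ∈ A) :
    A ∩ side d = Subtype.val '' ((S.induce (A \ {d.fst})).connectedComponentMk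
      ⟨d.snd, hd, d.adj.ne.symm⟩).supp := by
  ext x
  constructor
  · rintro ⟨hxA, hx⟩
    obtain ⟨p, hp⟩ := (hS.connected.preconnected d.snd x).exists_isPath
    have h : ∀ z ∈ p.support, z ∈ A \ {d.fst} := fun z hz =>
      ⟨hA _ hd _ hxA p hp z hz, fun h => fst_notMem_side d
        (h ▸ pathConvex_side hS.isAcyclic d _ (snd_mem_side d) _ hx p hp z hz)⟩
    exact ⟨⟨x, h x p.end_mem_support⟩,
      SimpleGraph.ConnectedComponent.eq.2 (reachable_induce p h).symm, rfl⟩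
  · rintro ⟨y, hy, rfl⟩
    obtain ⟨p⟩ := (SimpleGraph.ConnectedComponent.eq.1 hy).symm
    refine ⟨y.2.1, p.map (SimpleGraph.Embedding.induce _).toHom, fun h => ?_⟩
    obtain ⟨z, -, hz⟩ := List.mem_map.1 (Eq.mp (congrArg (d.fst ∈ ·)
      (SimpleGraph.Walk.support_map (SimpleGraph.Embedding.induce (A \ {d.fst})).toHom p)) h)
    exact z.2.2 hz

/-- Replaces the components in the definition of a search tree by half-spaces, over which the
dynamic program recurses. -/
theorem isComponent_iff (hS : S.IsTree) {A : Set V} (hA : PathConvex S A) {r : V} (hr : r ∈ A)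
    (C : Set V) : IsComponent S (A \ {r}) C ↔
      ∃ d : S.Dart, d.fst = r ∧ d.snd ∈ A ∧ C = A ∩ side d := by
  constructor
  · rintro ⟨K, rfl⟩
    induction K using SimpleGraph.ConnectedComponent.ind with
    | _ x =>
      obtain ⟨x, hxA, hxr⟩ := x
      obtain ⟨d, rfl, hd, hx⟩ := exists_mem_side hS.connected.preconnected hA hr hxA hxr
      refine ⟨d, rfl, hd, ?_⟩
      have h := isComponent_inter_side hS hA d hd
      have hx' : x ∈ A ∩ side d := ⟨hxA, hx⟩
      rw [h] at hx' ⊢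
      obtain ⟨y, hy, rfl⟩ := hx'
      rw [← show _ = _ from hy]
  · rintro ⟨d, rfl, hd, rfl⟩
    exact ⟨_, isComponent_inter_side hS hA d hd⟩

/-! ### Depths in search trees -/

theorem IsSearchTreeOn.root_mem {parent : V → Option V} {A : Set V} {r : V}
    (h : IsSearchTreeOn S parent A r) : r ∈ A := by
  cases h; assumption

theorem searchPath_of_parent {parent : V → Option V} {c r : V} (h : parent c = some r) :
    searchPath parent c = insert c (searchPath parent r) := by
  ext y
  simp only [searchPath, Set.mem_ofPred_eq, Set.mem_insert_iff]
  rw [Relation.ReflTransGen.cases_head_iff]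
  constructor
  · rintro (h' | ⟨z, hz, h'⟩)
    · exact .inl h'.symm
    · rw [h, Option.some_inj] at hz
      exact .inr (hz ▸ h')
  · rintro (h' | h')
    · exact .inl h'.symm
    · exact .inr ⟨r, h, h'⟩

theorem searchPath_of_root {parent : V → Option V} {r : V} (h : parent r = none) :
    searchPath parent r = {r} := by
  ext y
  simp only [searchPath, Set.mem_ofPred_eq, Set.mem_singleton_iff]
  rw [Relation.ReflTransGen.cases_head_iff]
  simp [h, eq_comm]

/-- Depth is the cardinality of a search path, so it grows at a child only if the child is not
already an ancestor of `r`; `hr` carries this through the induction. For the second claim, a convex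
set containing the root has its minimum there; otherwise it is connected and lies in one component,
to which induction applies. -/
theorem IsSearchTreeOn.depth_spec [Finite V] {parent : V → Option V} {A : Set V} {r : V}
    (h : IsSearchTreeOn S parent A r) (hr : searchPath parent r ∩ A ⊆ {r}) :
    (∀ x ∈ A, x ≠ r → depth parent r < depth parent x) ∧
    (S.Preconnected → ∀ C ⊆ A, PathConvex S C → C.Nonempty →
      ∃ r ∈ C, ∀ x ∈ C, x ≠ r → depth parent r < depth parent x) := by
  induction h with
  | node A r hrA child hparent hsub ih =>
    have hcomp : ∀ x ∈ A, x ≠ r → ∃ C, IsComponent S (A \ {r}) C ∧ x ∈ C := fun x hx hxr =>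
      ⟨_, ⟨(S.induce (A \ {r})).connectedComponentMk ⟨x, hx, hxr⟩, rfl⟩, ⟨x, hx, hxr⟩, rfl, rfl⟩
    have hsubA : ∀ C, IsComponent S (A \ {r}) C → C ⊆ A \ {r} := by
      rintro _ ⟨K, rfl⟩ _ ⟨y, -, rfl⟩
      exact y.2
    have hpath : ∀ C, IsComponent S (A \ {r}) C →
        searchPath parent (child C) ∩ C ⊆ {child C} ∧
          depth parent r < depth parent (child C) := by
      intro C hC
      have hp := searchPath_of_parent (hparent C hC)
      have hdisj : ∀ x ∈ C, x ∉ searchPath parent r := fun x hx hx' =>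
        (hsubA C hC hx).2 (hr ⟨hx', (hsubA C hC hx).1⟩)
      constructor
      · rintro x ⟨hx, hxC⟩
        rw [hp] at hx
        exact hx.resolve_right (hdisj x hxC)
      · rw [depth, depth, hp, Set.ncard_insert_of_notMem (hdisj _ (hsub C hC).root_mem)]
        exact Nat.lt_succ_self _
    have h1 : ∀ x ∈ A, x ≠ r → depth parent r < depth parent x := by
      intro x hx hxr
      obtain ⟨C, hC, hxC⟩ := hcomp x hx hxr
      obtain ⟨hc1, hc2⟩ := hpath C hC
      by_cases hxc : x = child C
      · exact hxc ▸ hc2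
      · exact hc2.trans ((ih C hC hc1).1 x hxC hxc)
    refine ⟨h1, fun hS C hCA hC ⟨x, hx⟩ => ?_⟩
    by_cases hrC : r ∈ C
    · exact ⟨r, hrC, fun x hx => h1 x (hCA hx)⟩
    · have hC' : C ⊆ A \ {r} := fun y hy => ⟨hCA hy, fun h => hrC (h ▸ hy)⟩
      let K := (S.induce (A \ {r})).connectedComponentMk ⟨x, hC' hx⟩
      have hK : IsComponent S (A \ {r}) (Subtype.val '' K.supp) := ⟨K, rfl⟩
      refine (ih _ hK (hpath _ hK).1).2 hS C (fun y hy => ?_) hC ⟨x, hx⟩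
      obtain ⟨p, hp⟩ := (hS x y).exists_isPath
      exact ⟨⟨y, hC' hy⟩, SimpleGraph.ConnectedComponent.eq.2
        (reachable_induce p fun z hz => hC' (hC x hx y hy p hp z hz)).symm, rfl⟩

/-- The only fact about an optimal search tree that enters the approximation bound. -/
theorem IsSearchTree.exists_depth_lt [Finite V] {parent : V → Option V} (h : IsSearchTree S parent)
    (hS : S.Preconnected) (C : Set V) (hC : PathConvex S C) (hne : C.Nonempty) :
    ∃ r ∈ C, ∀ x ∈ C, x ≠ r → depth parent r < depth parent x := by
  obtain ⟨r, hr, h⟩ := h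
  exact (h.depth_spec (by simp [searchPath_of_root hr])).2 hS C (Set.subset_univ _) hC hne

theorem one_le_depth [Finite V] (parent : V → Option V) (x : V) : 1 ≤ depth parent x :=
  (Set.ncard_pos (Set.toFinite _)).2 ⟨x, Relation.ReflTransGen.refl⟩

end tree

/-! ### Subproblems of the dynamic program -/

section subproblems

variable {V : Type*} [Fintype V] {S : SimpleGraph V} {k : ℕ}

open Classical in
/-- The number of slots whose tail is in `A`. -/
noncomputable def slots (τ : Fin k → Option V) (A : Set V) : ℕ :=
  (Finset.univ.filter fun j => ∃ a ∈ A, τ j = some a).card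

theorem slots_mono (τ : Fin k → Option V) {A A' : Set V} (h : A ⊆ A') : slots τ A ≤ slots τ A' := by
  classical
  refine Finset.card_le_card fun j hj => ?_
  simp only [Finset.mem_filter, Finset.mem_univ, true_and] at hj ⊢
  obtain ⟨a, ha, hj⟩ := hj
  exact ⟨a, h ha, hj⟩

theorem slots_eq_of_forall (τ : Fin k → Option V) {A : Set V}
    (h : ∀ j, ∃ a ∈ A, τ j = some a) : slots τ A = k := by
  classical
  rw [slots, Finset.filter_true_of_mem fun j _ => h j, Finset.card_univ, Fintype.card_fin]

theorem slots_eq_zero {τ : Fin k → Option V} {A : Set V} (h : ∀ j, τ j = none) :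
    slots τ A = 0 := by
  classical
  rw [slots, Finset.card_eq_zero, Finset.filter_eq_empty_iff]
  rintro j - ⟨a, -, ha⟩
  rw [h] at ha
  cases ha

theorem slots_le_succ {τ τ' : Fin k → Option V} {A A' : Set V} (i : Fin k)
    (h : ∀ j, (∃ a ∈ A', τ' j = some a) → j = i ∨ ∃ a ∈ A, τ j = some a) :
    slots τ' A' ≤ slots τ A + 1 := by
  classical
  refine (Finset.card_le_card fun j hj => ?_).trans (Finset.card_insert_le i _)
  simpa using h j (by simpa using hj)

theorem slots_add_slots_le (τ : Fin k → Option V) {A A' : Set V} (h : Disjoint A A') :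
    slots τ A + slots τ A' ≤ k := by
  classical
  rw [slots, slots, ← Finset.card_union_of_disjoint]
  · exact (Finset.card_le_univ _).trans (by simp)
  · rw [Finset.disjoint_left]
    intro j hj hj'
    simp only [Finset.mem_filter, Finset.mem_univ, true_and] at hj hj'
    obtain ⟨a, ha, hj⟩ := hj
    obtain ⟨a', ha', hj'⟩ := hj'
    rw [hj, Option.some_inj] at hj'
    exact Set.disjoint_left.1 h ha (hj' ▸ ha')

open Classical in
/-- The edges from `r` to its neighbors in `A`. -/
noncomputable def dartsAt (S : SimpleGraph V) (A : Finset V) (r : V) : Finset S.Dart :=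
  Finset.univ.filter fun e => e.fst = r ∧ e.snd ∈ A

theorem mem_dartsAt {A : Finset V} {r : V} {e : S.Dart} :
    e ∈ dartsAt S A r ↔ e.fst = r ∧ e.snd ∈ A := by
  simp [dartsAt]

open Classical in
-- The sides of the edges from `r` into `A` partition `A ∖ r`: they cover it by `exists_mem_side`
-- and are disjoint by `dart_eq_of_mem_side`.
theorem sum_eq_add_sum_dartsAt (hS : S.IsTree) {A : Finset V} (hA : PathConvex S (A : Set V)) {r : V}
    (hr : r ∈ A) (φ : V → ℕ) :
    ∑ x ∈ A, φ x = φ r + ∑ e ∈ dartsAt S A r, ∑ x ∈ A.filter (· ∈ side e), φ x := by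
  rw [← Finset.add_sum_erase A φ hr]
  congr 1
  rw [← Finset.sum_biUnion]
  · refine Finset.sum_congr ?_ fun _ _ => rfl
    ext x
    simp only [Finset.mem_erase, Finset.mem_biUnion, mem_dartsAt, Finset.mem_filter]
    constructor
    · rintro ⟨hxr, hx⟩
      obtain ⟨e, h1, h2, h3⟩ := exists_mem_side hS.connected.preconnected hA hr hx hxr
      exact ⟨e, ⟨h1, h2⟩, hx, h3⟩
    · rintro ⟨e, ⟨rfl, -⟩, hx, h⟩
      exact ⟨fun h' => fst_notMem_side e (h' ▸ h), hx⟩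
  · intro e he e' he' hne
    simp only [Finset.mem_coe, mem_dartsAt] at he he'
    refine Finset.disjoint_left.2 fun x hx hx' => hne ?_
    simp only [Finset.mem_filter] at hx hx'
    exact dart_eq_of_mem_side hS.isAcyclic (he.1.trans he'.1.symm) hx.2 hx'.2

/-- Among the edges inside `side e₀` with more than `t` of the `2t + 1` points behind them, take one
with the smallest side; its head is the centroid. Backwards lies the complement, with at most `t`
points, and every other edge at the head has a strictly smaller side, hence at most `t` points by
minimality. -/
theorem exists_centroid (hS : S.IsTree) {t : ℕ} (ht : 1 ≤ t) (τ : Fin (2 * t) → Option V)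
    {A : Set V} {e₀ : S.Dart} (he₀ : e₀.snd ∈ A) (hτ : 2 * t ≤ slots τ (side e₀)) :
    ∃ v ∈ A, v ∈ side e₀ ∧ ∀ e : S.Dart, e.fst = v → e.snd ∈ A →
      slots τ (side e) ≤ t ∧ (e₀.fst ∈ side e → slots τ (side e) + 1 ≤ t) := by
  classical
  -- The root candidate `e₀.fst` counts as one more point, which gives the sharper bound for the
  -- part containing it.
  let μ : Set V → ℕ := fun X => slots τ X + if e₀.fst ∈ X then 1 else 0
  have hμ : ∀ X, t + 1 ≤ μ X → μ Xᶜ ≤ t := by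
    intro X hX
    have := slots_add_slots_le τ (disjoint_compl_right (a := X))
    simp only [μ, Set.mem_compl_iff] at hX ⊢
    split_ifs at hX ⊢ <;> omega
  let D : Finset S.Dart := Finset.univ.filter fun e =>
    e.snd ∈ A ∧ side e ⊆ side e₀ ∧ t + 1 ≤ μ (side e)
  -- The edge `e₀` qualifies since `2 * t ≥ t + 1`.
  have hD : D.Nonempty := ⟨e₀, by
    simp only [D, Finset.mem_filter, Finset.mem_univ, true_and, he₀, subset_rfl, μ]; omega⟩
  obtain ⟨e, he, hmin⟩ := D.exists_min_image (fun e => (side e).ncard) hD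
  simp only [D, Finset.mem_filter, Finset.mem_univ, true_and] at he hmin
  obtain ⟨heA, hsub, hcard⟩ := he
  refine ⟨e.snd, heA, hsub (snd_mem_side e), fun e' hfst hA => ?_⟩
  have h : μ (side e') ≤ t := by
    by_cases hsymm : e' = e.symm
    · have : side e' = (side e)ᶜ := by
        ext x
        rw [hsymm, mem_side_symm hS, Set.mem_compl_iff]
      rw [this]
      exact hμ _ hcard
    · have h := side_subset_of_ne_symm hS.isAcyclic hfst hsymm
      by_contra! hlt
      have hlt' : (side e').ncard < (side e).ncard :=
        Set.ncard_lt_ncard ⟨h, fun h' => fst_notMem_side e' (hfst ▸ h' (snd_mem_side e))⟩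
          (Set.toFinite _)
      exact absurd (hmin e' ⟨hA, h.trans hsub, hlt⟩) (by omega)
  simp only [μ] at h
  split_ifs at h with h'
  · exact ⟨by omega, fun _ => h⟩
  · exact ⟨h, fun h'' => absurd h'' h'⟩

/-- A family of subproblems of the search tree problem. Every subproblem `g` is given by its node
set, which is cut out by at most `k` edges whose outer endpoints are `tails g`. The subproblem
`child g e` is the part of `g` behind the edge `e`, provided that it is cut out by at most `k`
edges. -/
structure Subproblems (S : SimpleGraph V) (k : ℕ) (α : Type*) where
  Valid : α → Prop
  nodes : α → Finset V
  tails : α → Fin k → Option V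
  child : α → S.Dart → α
  convex : ∀ g, Valid g → PathConvex S (nodes g : Set V)
  valid_child : ∀ g e, Valid g → e.fst ∈ nodes g → e.snd ∈ nodes g →
    slots (tails g) (side e) < k → Valid (child g e)
  mem_nodes_child : ∀ g e, Valid g → e.fst ∈ nodes g → e.snd ∈ nodes g → Valid (child g e) →
    ∀ x, x ∈ nodes (child g e) ↔ x ∈ nodes g ∧ x ∈ side e
  slots_child : ∀ g e, Valid g → e.fst ∈ nodes g → e.snd ∈ nodes g → Valid (child g e) →
    slots (tails (child g e)) Set.univ ≤ slots (tails g) (side e) + 1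

namespace Subproblems

variable {α : Type*} (M : Subproblems S k α)

open Classical in
theorem nodes_child {g : α} (hg : M.Valid g) {r : V} {e : S.Dart}
    (he : e ∈ dartsAt S (M.nodes g) r) (hr : r ∈ M.nodes g) (hc : M.Valid (M.child g e)) :
    M.nodes (M.child g e) = (M.nodes g).filter (· ∈ side e) := by
  obtain ⟨rfl, he'⟩ := mem_dartsAt.1 he
  ext x
  rw [M.mem_nodes_child g e hg hr he' hc, Finset.mem_filter]

theorem card_nodes_child_lt {g : α} (hg : M.Valid g) {r : V} {e : S.Dart}
    (he : e ∈ dartsAt S (M.nodes g) r) (hr : r ∈ M.nodes g) (hc : M.Valid (M.child g e)) :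
    (M.nodes (M.child g e)).card < (M.nodes g).card := by
  classical
  rw [M.nodes_child hg he hr hc]
  refine Finset.card_lt_card (Finset.filter_ssubset.2 ⟨r, hr, ?_⟩)
  exact (mem_dartsAt.1 he).1 ▸ fst_notMem_side e

/-- `f` is at most the cost of every root, given the values of `f` at its children. -/
def IsSubsolution (w : V → ℕ) (f : α → ℕ) : Prop :=
  ∀ g, M.Valid g → ∀ r ∈ M.nodes g,
    f g ≤ ∑ x ∈ M.nodes g, w x + ∑ e ∈ dartsAt S (M.nodes g) r, f (M.child g e)

open Classical in
-- Costs are scaled by `t`, so a level costs `t` per unit of weight. Here `ψ` is the budget of a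
-- node and `c` the amount already charged: the root must afford `t + c`, and each part continues
-- with `t + c` already charged.
theorem IsSubsolution.step {M : Subproblems S k α} {w : V → ℕ} {f : α → ℕ}
    (hf : M.IsSubsolution w f) (hS : S.IsTree) {g : α} (hg : M.Valid g) {r : V} (hr : r ∈ M.nodes g)
    (t c : ℕ) (ψ : V → ℕ) (hψ : t + c ≤ ψ r)
    (h : ∀ e ∈ dartsAt S (M.nodes g) r, t * f (M.child g e) +
      (t + c) * ∑ x ∈ (M.nodes g).filter (· ∈ side e), w x ≤
        ∑ x ∈ (M.nodes g).filter (· ∈ side e), w x * ψ x) :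
    t * f g + c * ∑ x ∈ M.nodes g, w x ≤ ∑ x ∈ M.nodes g, w x * ψ x := by
  have h1 := Nat.mul_le_mul_left t (hf g hg r hr)
  have h2 := Finset.sum_le_sum h
  rw [Finset.sum_add_distrib, ← Finset.mul_sum, ← Finset.mul_sum] at h2
  rw [sum_eq_add_sum_dartsAt hS (M.convex g hg) hr (fun x => w x * ψ x)]
  have h3 := sum_eq_add_sum_dartsAt hS (M.convex g hg) hr w
  have h4 := Nat.mul_le_mul_left (w r) hψ
  set W := ∑ x ∈ M.nodes g, w x
  set F := ∑ e ∈ dartsAt S (M.nodes g) r, f (M.child g e)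
  set W' := ∑ e ∈ dartsAt S (M.nodes g) r, ∑ x ∈ (M.nodes g).filter (· ∈ side e), w x
  calc t * f g + c * W ≤ t * (W + F) + c * W := by omega
    _ = w r * (t + c) + (t * F + (t + c) * W') := by rw [h3]; ring
    _ ≤ _ := by omega

/-- Here `q` counts levels of the given depth function that have been used up before `g`, and the
truncated difference `slots - (t + 1)` is the potential. Induction on the number of nodes, with `q`
raised by one for each part that avoids the node `r` of least depth. -/
theorem IsSubsolution.approx {t : ℕ} {M : Subproblems S (2 * t) α} (ht : 1 ≤ t) {w : V → ℕ}
    {f : α → ℕ} (hf : M.IsSubsolution w f) (hS : S.IsTree) {d : V → ℕ}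
    (hd : ∀ C : Set V, PathConvex S C → C.Nonempty → ∃ r ∈ C, ∀ x ∈ C, x ≠ r → d r < d x)
    {g : α} (hg : M.Valid g) (hne : (M.nodes g).Nonempty) {q : ℕ}
    (hq : ∀ x ∈ M.nodes g, q < d x) :
    t * f g + (t + 1) * q * ∑ x ∈ M.nodes g, w x ≤
      ∑ x ∈ M.nodes g, w x * ((t + 1) * d x + (slots (M.tails g) Set.univ - (t + 1))) := by
  classical
  induction hN : (M.nodes g).card using Nat.strong_induction_on generalizing g q with
  | _ N ih =>
  subst hN
  obtain ⟨r, hr, hmin⟩ := hd _ (M.convex g hg) hne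
  -- the induction hypothesis for a part of the subproblem that does not contain `r`
  have hrec : ∀ g', M.Valid g' → (M.nodes g').card < (M.nodes g).card → (M.nodes g').Nonempty →
      M.nodes g' ⊆ M.nodes g → r ∉ M.nodes g' →
      t * f g' + (t + 1) * (q + 1) * ∑ x ∈ M.nodes g', w x ≤
        ∑ x ∈ M.nodes g', w x * ((t + 1) * d x + (slots (M.tails g') Set.univ - (t + 1))) := by
    intro g' hg' hlt hne' hsub hr'
    refine ih _ hlt hg' hne' (fun x hx => ?_) rfl
    have := hmin x (hsub hx) (fun h => hr' (h ▸ hx))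
    have := hq r hr
    omega
  have hchild : ∀ g', M.Valid g' → ∀ v ∈ M.nodes g', ∀ e ∈ dartsAt S (M.nodes g') v,
      M.Valid (M.child g' e) → M.nodes (M.child g' e) = (M.nodes g').filter (· ∈ side e) ∧
        (M.nodes (M.child g' e)).card < (M.nodes g').card ∧ (M.nodes (M.child g' e)).Nonempty ∧
        M.nodes (M.child g' e) ⊆ M.nodes g' := by
    intro g' hg' v hv e he hc
    have h1 := M.nodes_child hg' he hv hc
    refine ⟨h1, M.card_nodes_child_lt hg' he hv hc, ⟨e.snd, ?_⟩, ?_⟩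
    · rw [h1, Finset.mem_filter]
      exact ⟨(mem_dartsAt.1 he).2, snd_mem_side e⟩
    · rw [h1]; exact Finset.filter_subset _ _
  have hqr : (t + 1) * (q + 1) ≤ (t + 1) * d r := Nat.mul_le_mul_left _ (hq r hr)
  have hrw : (t + 1) * (q + 1) = (t + 1) * q + t + 1 := by ring
  have hslots : ∀ τ : Fin (2 * t) → Option V, slots τ Set.univ ≤ 2 * t := fun τ => by
    simpa using (slots_add_slots_le τ (Set.disjoint_empty Set.univ)).trans' (Nat.le_add_right _ _)
  by_cases hval : ∀ e ∈ dartsAt S (M.nodes g) r, M.Valid (M.child g e)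
  · refine hf.step hS hg hr t _ _ (by omega) fun e he => ?_
    obtain ⟨h1, h2, h3, h4⟩ := hchild g hg r hr e he (hval e he)
    have he' := mem_dartsAt.1 he
    have h5 := hrec _ (hval e he) h2 h3 h4 (by
      rw [h1, Finset.mem_filter]; exact fun h => fst_notMem_side e (he'.1 ▸ h.2))
    have h6 : slots (M.tails (M.child g e)) Set.univ ≤ slots (M.tails g) Set.univ + 1 :=
      (M.slots_child g e hg (he'.1 ▸ hr) he'.2 (hval e he)).trans
        (Nat.add_le_add_right (slots_mono _ (Set.subset_univ _)) 1)
    rw [h1] at h5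
    generalize hA : (M.nodes g).filter (· ∈ side e) = A at h5 ⊢
    -- The new boundary edge raises the potential by at most `1`, the surplus of `t + 1` over the
    -- cost `t` of the level.
    have h7 : ∑ x ∈ A, w x * ((t + 1) * d x + (slots (M.tails (M.child g e)) Set.univ - (t + 1))) ≤
        ∑ x ∈ A, (w x * ((t + 1) * d x + (slots (M.tails g) Set.univ - (t + 1))) + w x) :=
      Finset.sum_le_sum fun x _ => by
        rw [← Nat.mul_succ]
        exact Nat.mul_le_mul_left _ (by omega)
    rw [Finset.sum_add_distrib] at h7
    have h8 : (t + 1) * (q + 1) * ∑ x ∈ A, w x =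
      (t + (t + 1) * q) * ∑ x ∈ A, w x + ∑ x ∈ A, w x := by ring
    omega
  -- Some part at `r` is inadmissible, so all `2t` outer endpoints lie behind `e₀` and the potential
  -- of `g` is `t - 1`.
  · push Not at hval
    obtain ⟨e₀, he₀, hinv⟩ := hval
    obtain ⟨he₀r, he₀s⟩ := mem_dartsAt.1 he₀
    have hfull : 2 * t ≤ slots (M.tails g) (side e₀) := by
      by_contra! hlt
      exact hinv (M.valid_child g e₀ hg (he₀r ▸ hr) he₀s hlt)
    have hb : slots (M.tails g) Set.univ = 2 * t :=
      le_antisymm (hslots _) (hfull.trans (slots_mono _ (Set.subset_univ _)))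
    obtain ⟨v, hv, hve, hcen⟩ := exists_centroid (A := (M.nodes g : Set V)) hS ht (M.tails g)
      he₀s hfull
    have hvr : v ≠ r := fun h => fst_notMem_side e₀ (he₀r ▸ h ▸ hve)
    have hdv : (t + 1) * (q + 2) ≤ (t + 1) * d v := by
      refine Nat.mul_le_mul_left _ ?_
      have := hmin v hv hvr
      have := hq r hr
      omega
    rw [hb]
    refine hf.step hS hg hv t _ _ ?_ fun e he => ?_
    · have : (t + 1) * (q + 2) = (t + 1) * q + t + t + 2 := by ring
      omega
    obtain ⟨he1, he2⟩ := mem_dartsAt.1 he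
    obtain ⟨hs1, hs2⟩ := hcen e he1 he2
    have hc : M.Valid (M.child g e) := M.valid_child g e hg (he1 ▸ hv) he2 (by omega)
    obtain ⟨h1, h2, h3, h4⟩ := hchild g hg v hv e he hc
    have hsc := M.slots_child g e hg (he1 ▸ hv) he2 hc
    rw [← h1]
    -- The part containing `r` takes `r` as its root. This is affordable since `(t + 1) * (q + 1) +
    -- (t - 1) = 2 * t + (t + 1) * q`.
    by_cases hre : r ∈ M.nodes (M.child g e)
    · have hs3 := hs2 (by rw [h1, Finset.mem_filter] at hre; exact he₀r ▸ hre.2)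
      refine hf.step hS hc hre t _ _ ?_ fun e' he' => ?_
      · omega
      obtain ⟨he1', he2'⟩ := mem_dartsAt.1 he'
      have hs' := slots_mono (M.tails (M.child g e)) (Set.subset_univ (side e'))
      have hc' : M.Valid (M.child (M.child g e) e') :=
        M.valid_child _ e' hc (he1' ▸ hre) he2' (by omega)
      obtain ⟨h1', h2', h3', h4'⟩ := hchild _ hc r hre e' he' hc'
      have hsc' := M.slots_child _ e' hc (he1' ▸ hre) he2' hc'
      have h5 := hrec _ hc' (h2'.trans h2) h3' (h4'.trans h4) (by
        rw [h1', Finset.mem_filter]; exact fun h => fst_notMem_side e' (he1' ▸ h.2))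
      rw [← h1']
      -- At most `t - 1` old slots and the two edges to `v` and `r` remain, so the potential is `0`.
      rw [Nat.sub_eq_zero_of_le (by omega)] at h5
      generalize M.nodes (M.child (M.child g e) e') = A at h5 ⊢
      have h7 : ∑ x ∈ A, w x * ((t + 1) * d x + (2 * t - (t + 1))) =
          ∑ x ∈ A, w x * ((t + 1) * d x + 0) + (t - 1) * ∑ x ∈ A, w x := by
        rw [Finset.mul_sum, ← Finset.sum_add_distrib]
        refine Finset.sum_congr rfl fun x _ => ?_
        rw [show 2 * t - (t + 1) = t - 1 by omega]; ring
      have h8 : (t + (t + (t + 1) * q)) * ∑ x ∈ A, w x =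
          (t + 1) * (q + 1) * ∑ x ∈ A, w x + (t - 1) * ∑ x ∈ A, w x := by
        rw [← add_mul]; congr 1; omega
      omega
    -- Without `r`, the part has at most `t + 1` slots and lies strictly deeper than `r`, so a level
    -- worth `t + 1` pays for `v`.
    · have h5 := hrec _ hc h2 h3 h4 hre
      rw [Nat.sub_eq_zero_of_le (by omega)] at h5
      generalize M.nodes (M.child g e) = A at h5 ⊢
      have h7 : ∑ x ∈ A, w x * ((t + 1) * d x + 0) ≤
          ∑ x ∈ A, w x * ((t + 1) * d x + (2 * t - (t + 1))) :=
        Finset.sum_le_sum fun x _ => Nat.mul_le_mul_left _ (by omega)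
      have h8 : (t + (t + 1) * q) * ∑ x ∈ A, w x ≤ (t + 1) * (q + 1) * ∑ x ∈ A, w x :=
        Nat.mul_le_mul_right _ (by omega)
      omega

/-! ### Reconstruction of the search tree -/

open Classical in
/-- One step on the search path of `x`: the current subproblem and the parent of its root. -/
noncomputable def descend (c : α → V) (next : α → V → α) (x : V) (s : α × Option V) :
    α × Option V :=
  if c s.1 = x then s else (next s.1 x, some (c s.1))

/-- After `i` steps every node of `g` has reached `g`, and `hi` leaves enough steps to reach its own
root, since each further step shrinks the node set. `l` bounds the number of levels above the root:
charging the weight of each subproblem once per level telescopes to the sum of weighted depths. -/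
theorem isSearchTreeOn_of_descend {M : Subproblems S k α} (hS : S.IsTree) {w : V → ℕ} {f : α → ℕ}
    {top : ℕ} {c : α → V} {next : α → V → α} {g₀ : α}
    (hinv : ∀ g, ¬ M.Valid g → top ≤ f g)
    (hc : ∀ g, M.Valid g → f g < top → c g ∈ M.nodes g ∧
      ∑ x ∈ M.nodes g, w x + ∑ e ∈ dartsAt S (M.nodes g) (c g), f (M.child g e) ≤ f g)
    (hnext : ∀ g e x, M.Valid g → e.fst = c g → x ∈ side e → next g x = M.child g e)
    {n : ℕ} {parent : V → Option V}
    (hparent : ∀ x, parent x = ((descend c next x)^[n] (g₀, none)).2)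
    {g : α} {p : Option V} {i : ℕ} (hg : M.Valid g) (hfg : f g < top)
    (hx : ∀ x ∈ M.nodes g, (descend c next x)^[i] (g₀, none) = (g, p))
    (hi : i + (M.nodes g).card ≤ n) :
    IsSearchTreeOn S parent (M.nodes g : Set V) (c g) ∧ parent (c g) = p ∧
      ∀ l, depth parent (c g) ≤ l + 1 →
        ∑ x ∈ M.nodes g, w x * depth parent x ≤ f g + l * ∑ x ∈ M.nodes g, w x := by
  classical
  induction hN : (M.nodes g).card using Nat.strong_induction_on generalizing g p i with
  | _ N ih =>
  subst hN
  obtain ⟨hr, hf⟩ := hc g hg hfg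
  have hpr : parent (c g) = p := by
    -- Once a node is the root of the current subproblem, the iteration is stationary, so surplus
    -- steps do no harm.
    have hstay : ∀ j, (descend c next (c g))^[j] (g, p) = (g, p) := fun j => by
      induction j with
      | zero => rfl
      | succ j ih => rw [Function.iterate_succ_apply, descend, if_pos rfl, ih]
    rw [hparent, show n = (n - i) + i by omega, Function.iterate_add_apply, hx _ hr, hstay]
  have hchild : ∀ e ∈ dartsAt S (M.nodes g) (c g),
      M.nodes (M.child g e) = (M.nodes g).filter (· ∈ side e) ∧
      IsSearchTreeOn S parent (M.nodes (M.child g e) : Set V) (c (M.child g e)) ∧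
      parent (c (M.child g e)) = some (c g) ∧
      ∀ l, depth parent (c (M.child g e)) ≤ l + 1 →
        ∑ x ∈ M.nodes (M.child g e), w x * depth parent x ≤
          f (M.child g e) + l * ∑ x ∈ M.nodes (M.child g e), w x := by
    intro e he
    -- The value of a child is one summand of a sum below `top`; by `hinv` the child is then valid.
    have hle : f (M.child g e) < top := by
      have := Finset.single_le_sum (f := fun e => f (M.child g e)) (fun _ _ => Nat.zero_le _) he
      omega
    have hv : M.Valid (M.child g e) := by
      by_contra h
      exact absurd (hinv _ h) (by omega)
    have h1 := M.nodes_child hg he hr hv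
    have h2 := M.card_nodes_child_lt hg he hr hv
    refine ⟨h1, ih _ h2 (i := i + 1) hv hle (fun x hxc => ?_) (by omega) rfl⟩
    rw [h1, Finset.mem_filter] at hxc
    have he1 := (mem_dartsAt.1 he).1
    rw [Function.iterate_succ_apply', hx x hxc.1, descend, if_neg, hnext g e x hg he1 hxc.2]
    exact fun h => fst_notMem_side e (he1 ▸ h ▸ hxc.2)
  refine ⟨?_, hpr, fun l hl => ?_⟩
  · have hcomp : ∀ C, IsComponent S ((M.nodes g : Set V) \ {c g}) C →
        ∃ a, parent a = some (c g) ∧ IsSearchTreeOn S parent C a := by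
      intro C hC
      obtain ⟨e, he1, he2, rfl⟩ := (isComponent_iff hS (M.convex g hg) hr C).1 hC
      obtain ⟨h1, h2, h3, -⟩ := hchild e (mem_dartsAt.2 ⟨he1, he2⟩)
      refine ⟨_, h3, ?_⟩
      convert h2 using 1
      rw [h1]
      ext x
      simp
    have : Nonempty V := ⟨c g⟩
    choose! child hchild using hcomp
    exact .node _ _ hr child (fun C hC => (hchild C hC).1) (fun C hC => (hchild C hC).2)
  · rw [sum_eq_add_sum_dartsAt hS (M.convex g hg) hr]
    have h1 : ∀ e ∈ dartsAt S (M.nodes g) (c g),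
        ∑ x ∈ (M.nodes g).filter (· ∈ side e), w x * depth parent x ≤
          f (M.child g e) + (l + 1) * ∑ x ∈ (M.nodes g).filter (· ∈ side e), w x := by
      intro e he
      obtain ⟨h1, -, h3, h4⟩ := hchild e he
      rw [← h1]
      refine h4 _ ?_
      rw [depth, searchPath_of_parent h3]
      exact (Set.ncard_insert_le _ _).trans (Nat.add_le_add_right hl 1)
    have h2 := Finset.sum_le_sum h1
    rw [Finset.sum_add_distrib, ← Finset.mul_sum] at h2
    have h3 := sum_eq_add_sum_dartsAt hS (M.convex g hg) hr w
    have h4 := Nat.mul_le_mul_left (w (c g)) hl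
    set W := ∑ x ∈ M.nodes g, w x
    set W' := ∑ e ∈ dartsAt S (M.nodes g) (c g), ∑ x ∈ (M.nodes g).filter (· ∈ side e), w x
    have h5 : l * W + W = w (c g) * (l + 1) + (l + 1) * W' := by rw [h3]; ring
    omega

theorem isSearchTree_of_descend {M : Subproblems S k α} (hS : S.IsTree) {w : V → ℕ} {f : α → ℕ}
    {top : ℕ} {c : α → V} {next : α → V → α} {g₀ : α}
    (hinv : ∀ g, ¬ M.Valid g → top ≤ f g)
    (hc : ∀ g, M.Valid g → f g < top → c g ∈ M.nodes g ∧
      ∑ x ∈ M.nodes g, w x + ∑ e ∈ dartsAt S (M.nodes g) (c g), f (M.child g e) ≤ f g)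
    (hnext : ∀ g e x, M.Valid g → e.fst = c g → x ∈ side e → next g x = M.child g e)
    {parent : V → Option V}
    (hparent : ∀ x, parent x = ((descend c next x)^[Fintype.card V] (g₀, none)).2)
    (hg : M.Valid g₀) (huniv : M.nodes g₀ = Finset.univ) (hfg : f g₀ < top) :
    IsSearchTree S parent ∧ ∑ x, w x * depth parent x ≤ f g₀ := by
  obtain ⟨h1, h2, h3⟩ := isSearchTreeOn_of_descend hS hinv hc hnext hparent (i := 0) (p := none)
    hg hfg (fun _ _ => rfl) (by simp [huniv])
  rw [huniv] at h1 h3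
  have h4 := h3 0 (by simp [depth, searchPath_of_root h2])
  exact ⟨⟨_, h2, by simpa using h1⟩, by simpa using h4⟩

end Subproblems

end subproblems

/-! ### Costs -/

theorem cost_eq_sum {V : Type*} [Fintype V] [DecidableEq V] (parent : V → Option V) (X : List V) :
    cost parent X = ∑ x, X.count x * depth parent x := by
  rw [cost, Finset.sum_list_map_count]
  refine (Finset.sum_subset (Finset.subset_univ _) fun x _ hx => ?_).trans (by simp)
  rw [List.count_eq_zero_of_not_mem (by simpa using hx)]; simp

/-! ### Subproblems as numbers -/

theorem sum_mul_pow_lt {K k : ℕ} {a : ℕ → ℕ} (ha : ∀ j < k, a j < K) :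
    ∑ j ∈ Finset.range k, a j * K ^ j < K ^ k := by
  induction k with
  | zero => simp
  | succ k ih =>
    rw [Finset.sum_range_succ, pow_succ]
    have h1 := ih fun j hj => ha j (by omega)
    have h2 := Nat.mul_le_mul_right (K ^ k) (Nat.succ_le_of_lt (ha k (by omega)))
    rw [Nat.succ_mul, mul_comm K] at h2
    omega

theorem sum_mul_pow_div_mod {K k : ℕ} {a : ℕ → ℕ} (ha : ∀ j < k, a j < K) {i : ℕ} (hi : i < k) :
    (∑ j ∈ Finset.range k, a j * K ^ j) / K ^ i % K = a i := by
  induction k with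
  | zero => omega
  | succ k ih =>
    have hK : 0 < K := (Nat.zero_le _).trans_lt (ha i hi)
    rw [Finset.sum_range_succ]
    rcases Nat.lt_succ_iff_lt_or_eq.1 hi with h | rfl
    · obtain ⟨l, rfl⟩ : ∃ l, k = i + 1 + l := ⟨k - (i + 1), by omega⟩
      rw [show a (i + 1 + l) * K ^ (i + 1 + l) = K ^ i * (K * (a (i + 1 + l) * K ^ l)) by ring,
        Nat.add_mul_div_left _ _ (pow_pos hK _), Nat.add_mul_mod_self_left,
        ih (fun j hj => ha j (by omega)) h]
    · rw [Nat.add_mul_div_right _ _ (pow_pos hK _),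
        Nat.div_eq_of_lt (sum_mul_pow_lt fun j hj => ha j (by omega)), zero_add,
        Nat.mod_eq_of_lt (ha i (by omega))]

/-- The `j`-th digit of `I` in base `K`. -/
def digit (K I j : ℕ) : ℕ := I / K ^ j % K

theorem digit_lt {K : ℕ} (hK : 0 < K) (I j : ℕ) : digit K I j < K := Nat.mod_lt _ hK

/-- Keep the digits of `I` that satisfy `keep`, replace the first other digit by `e` and the
remaining ones by `0`. -/
def newDigit (K : ℕ) (keep : ℕ → Prop) [DecidablePred keep] (I e j : ℕ) : ℕ :=
  if keep (digit K I j) then digit K I j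
  else if ∃ i < j, ¬ keep (digit K I i) then 0 else e

/-- The number with the digits `newDigit`, and `K ^ k` if all digits of `I` are kept. -/
def replaceDigits (K k : ℕ) (keep : ℕ → Prop) [DecidablePred keep] (I e : ℕ) : ℕ :=
  if ∃ i < k, ¬ keep (digit K I i) then ∑ j ∈ Finset.range k, newDigit K keep I e j * K ^ j
  else K ^ k

section

variable {K k : ℕ} {keep : ℕ → Prop} [DecidablePred keep] {I e : ℕ}

theorem newDigit_lt (hK : 0 < K) (he : e < K) (j : ℕ) : newDigit K keep I e j < K := by
  unfold newDigit
  split_ifs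
  exacts [digit_lt hK _ _, hK, he]

theorem replaceDigits_lt_iff (hK : 0 < K) (he : e < K) :
    replaceDigits K k keep I e < K ^ k ↔ ∃ i < k, ¬ keep (digit K I i) := by
  unfold replaceDigits
  split_ifs with h
  · simp only [h, iff_true]
    exact sum_mul_pow_lt fun j _ => newDigit_lt hK he j
  · simp [h]

theorem replaceDigits_le (hK : 0 < K) (he : e < K) : replaceDigits K k keep I e ≤ K ^ k := by
  unfold replaceDigits
  split_ifs with h
  · exact (sum_mul_pow_lt fun j _ => newDigit_lt hK he j).le
  · exact le_rfl

theorem digit_replaceDigits (hK : 0 < K) (he : e < K) (h : ∃ i < k, ¬ keep (digit K I i)) {j : ℕ}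
    (hj : j < k) : digit K (replaceDigits K k keep I e) j = newDigit K keep I e j := by
  rw [replaceDigits, if_pos h]
  exact sum_mul_pow_div_mod (fun j _ => newDigit_lt hK he j) hj

end

/-! ### The tables of the algorithm -/

section tables

variable {n : ℕ}

/-- The node `v` can be reached from `b` without visiting `a`. -/
def Reach (S : SimpleGraph (Fin n)) (a b v : ℕ) : Prop :=
  ∃ (hb : b < n) (hv : v < n) (p : S.Walk ⟨b, hb⟩ ⟨v, hv⟩), ∀ z ∈ p.support, (z : ℕ) ≠ a

theorem Reach.lt {S : SimpleGraph (Fin n)} {a b v : ℕ} (h : Reach S a b v) : v < n := h.2.1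

/-- The arrays `tl` and `hd` list the tails and heads of all edges, starting from position `1`.
Position `0` stands for an imaginary edge from outside to the node `0`. -/
structure EdgeTable (S : SimpleGraph (Fin n)) (E : ℕ) (tl hd : ℕ → ℕ) where
  equiv : S.Dart ≃ Fin E
  tl_zero : tl 0 = n
  hd_zero : hd 0 = 0
  tl_succ : ∀ d, tl (equiv d + 1) = d.fst
  hd_succ : ∀ d, hd (equiv d + 1) = d.snd

variable {S : SimpleGraph (Fin n)} {E : ℕ} {tl hd : ℕ → ℕ}

/-- The node `v` lies behind the edge number `e`. -/
def Behind (S : SimpleGraph (Fin n)) (tl hd : ℕ → ℕ) (e v : ℕ) : Prop := Reach S (tl e) (hd e) v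

namespace EdgeTable

variable (T : EdgeTable S E tl hd)

include T in
theorem cases {e : ℕ} (he : e < E + 1) : e = 0 ∨ ∃ d, e = T.equiv d + 1 := by
  rcases e with _ | e
  · exact .inl rfl
  · exact .inr ⟨T.equiv.symm ⟨e, by omega⟩, by simp⟩

include T in
theorem tl_le {e : ℕ} (he : e < E + 1) : tl e ≤ n := by
  obtain rfl | ⟨d, rfl⟩ := T.cases he
  · exact T.tl_zero.le
  · rw [T.tl_succ]; exact d.fst.2.le

include T in
theorem hd_lt (hn : 0 < n) {e : ℕ} (he : e < E + 1) : hd e < n := by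
  obtain rfl | ⟨d, rfl⟩ := T.cases he
  · rwa [T.hd_zero]
  · rw [T.hd_succ]; exact d.snd.2

include T in
-- The tail `n` of the imaginary edge is no node, so avoiding it is no restriction and digit `0`
-- acts as an empty slot.
theorem behind_zero (hS : S.IsTree) (x : Fin n) : Behind S tl hd 0 x := by
  have hn : 0 < n := (Nat.zero_le _).trans_lt x.2
  rw [Behind, T.tl_zero, T.hd_zero]
  obtain ⟨p⟩ := hS.connected.preconnected ⟨0, hn⟩ x
  exact ⟨hn, x.2, p, fun z _ => z.2.ne⟩

theorem behind_succ (d : S.Dart) (x : Fin n) : Behind S tl hd (T.equiv d + 1) x ↔ x ∈ side d := by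
  have h : (⟨hd (T.equiv d + 1), by rw [T.hd_succ]; exact d.snd.2⟩ : Fin n) = d.snd :=
    Fin.ext (T.hd_succ d)
  rw [Behind, T.tl_succ]
  constructor
  · rintro ⟨hb, hv, p, hp⟩
    exact ⟨p.copy h rfl, fun h' => hp _ (by simpa using h') rfl⟩
  · rintro ⟨p, hp⟩
    refine ⟨by rw [T.hd_succ]; exact d.snd.2, x.2, p.copy h.symm rfl, fun z hz h' => hp ?_⟩
    rw [← Fin.ext h']
    simpa using hz

open Classical in
/-- The nodes of the subproblem `I`. -/
noncomputable def _root_.STT.nodesOf (S : SimpleGraph (Fin n)) (K k : ℕ) (tl hd : ℕ → ℕ) (I : ℕ) :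
    Finset (Fin n) :=
  Finset.univ.filter fun x => ∀ j < k, Behind S tl hd (digit K I j) x

open Classical in
/-- The part of the subproblem `I` behind the edge number `e`. -/
noncomputable def _root_.STT.childOf (S : SimpleGraph (Fin n)) (K k : ℕ) (tl hd : ℕ → ℕ) (I e : ℕ) :
    ℕ :=
  replaceDigits K k (fun d => Behind S tl hd e (tl d)) I e

/-- The outer endpoint of the `j`-th slot of the subproblem `I`. -/
def _root_.STT.tailsOf (n K k : ℕ) (tl : ℕ → ℕ) (I : ℕ) (j : Fin k) : Option (Fin n) :=
  if h : tl (digit K I j) < n then some ⟨_, h⟩ else none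

theorem mem_nodesOf {K k I : ℕ} {x : Fin n} :
    x ∈ nodesOf S K k tl hd I ↔ ∀ j < k, Behind S tl hd (digit K I j) x := by
  simp [nodesOf]

/-- Matches the digits kept by `childOf` with the slots counted on the side of `d`. The imaginary
edge is never counted, since only numbers below `n` are behind an edge. -/
theorem exists_tailsOf_iff {K k I : ℕ} (d : S.Dart) (j : Fin k) :
    (∃ a ∈ side d, tailsOf n K k tl I j = some a) ↔
      Behind S tl hd (T.equiv d + 1) (tl (digit K I j)) := by
  unfold tailsOf
  constructor
  · rintro ⟨a, ha, h⟩
    split_ifs at h with h'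
    rw [Option.some_inj] at h
    have := (T.behind_succ d a).2 ha
    rwa [← h] at this
  · intro h
    exact ⟨⟨_, h.lt⟩, (T.behind_succ d ⟨_, h.lt⟩).1 h, dif_pos h.lt⟩

include T in
theorem pathConvex_nodesOf (hS : S.IsTree) (k I : ℕ) :
    PathConvex S (nodesOf S (E + 1) k tl hd I : Set (Fin n)) := by
  intro x hx y hy p hp z hz
  rw [Finset.mem_coe, mem_nodesOf] at hx hy ⊢
  intro j hj
  obtain h | ⟨d, h⟩ := T.cases (digit_lt (Nat.succ_pos E) I j)
  · rw [h]; exact T.behind_zero hS z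
  · have hx := hx j hj
    have hy := hy j hj
    rw [h, T.behind_succ] at hx hy ⊢
    exact pathConvex_side hS.isAcyclic d x hx y hy p hp z hz

theorem childOf_lt_iff {k I : ℕ} (d : S.Dart) :
    childOf S (E + 1) k tl hd I (T.equiv d + 1) < (E + 1) ^ k ↔
      ∃ i < k, ¬ Behind S tl hd (T.equiv d + 1) (tl (digit (E + 1) I i)) := by
  classical
  exact replaceDigits_lt_iff (Nat.succ_pos E) (Nat.succ_lt_succ (T.equiv d).2)

theorem childOf_le {k I e : ℕ} (he : e < E + 1) : childOf S (E + 1) k tl hd I e ≤ (E + 1) ^ k := by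
  classical
  exact replaceDigits_le (Nat.succ_pos E) he

/-- Dropping a digit loses nothing: its tail is not behind `d` while `d.fst` satisfies its
constraint, so its half-space contains `side d` by `side_subset_of_fst_notMem`. -/
theorem mem_nodesOf_childOf (hS : S.IsTree) {k I : ℕ} {d : S.Dart}
    (h1 : d.fst ∈ nodesOf S (E + 1) k tl hd I)
    (hc : childOf S (E + 1) k tl hd I (T.equiv d + 1) < (E + 1) ^ k) (x : Fin n) :
    x ∈ nodesOf S (E + 1) k tl hd (childOf S (E + 1) k tl hd I (T.equiv d + 1)) ↔
      x ∈ nodesOf S (E + 1) k tl hd I ∧ x ∈ side d := by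
  classical
  have hex := (T.childOf_lt_iff d).1 hc
  have hdig : ∀ j < k, digit (E + 1) (childOf S (E + 1) k tl hd I (T.equiv d + 1)) j = _ :=
    fun j hj => digit_replaceDigits (Nat.succ_pos E) (Nat.succ_lt_succ (T.equiv d).2) hex hj
  rw [mem_nodesOf, mem_nodesOf]
  rw [mem_nodesOf] at h1
  constructor
  · intro h
    have hx : x ∈ side d := by
      -- The first dropped digit is the one that was replaced by `d`.
      have hj := Nat.find_spec hex
      have := h _ hj.1
      rw [hdig _ hj.1, newDigit, if_neg hj.2, if_neg, T.behind_succ] at this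
      · exact this
      · rintro ⟨i, hi, hi'⟩
        exact Nat.find_min hex hi ⟨hi.trans hj.1, hi'⟩
    refine ⟨fun j hj => ?_, hx⟩
    by_cases hk : Behind S tl hd (T.equiv d + 1) (tl (digit (E + 1) I j))
    · have := h j hj
      rwa [hdig j hj, newDigit, if_pos hk] at this
    · obtain h0 | ⟨d', h0⟩ := T.cases (digit_lt (Nat.succ_pos E) I j)
      · rw [h0]; exact T.behind_zero hS x
      · have h1 := h1 j hj
        rw [h0, T.behind_succ] at h1 ⊢
        rw [h0, T.tl_succ, T.behind_succ] at hk
        exact side_subset_of_fst_notMem hk h1 hx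
  · rintro ⟨h, hx⟩ j hj
    rw [hdig j hj, newDigit]
    split_ifs
    · exact h j hj
    · exact T.behind_zero hS x
    · exact (T.behind_succ d x).2 hx

/-- The subproblems that are encoded by the numbers below `(E + 1) ^ k`. -/
noncomputable def subproblems (hS : S.IsTree) (k : ℕ) : Subproblems S k ℕ where
  Valid I := I < (E + 1) ^ k
  nodes := nodesOf S (E + 1) k tl hd
  tails := tailsOf n (E + 1) k tl
  child I d := childOf S (E + 1) k tl hd I (T.equiv d + 1)
  convex I _ := T.pathConvex_nodesOf hS k I
  valid_child I d _ _ _ h := by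
    classical
    rw [T.childOf_lt_iff]
    -- There is no room for the new edge only if all `k` digits are kept, and then all `k` tails lie
    -- behind it.
    by_contra! hall
    exact h.ne (slots_eq_of_forall _ fun j => (T.exists_tailsOf_iff d j).2 (hall j j.2))
  mem_nodes_child I d _ h _ hc := T.mem_nodesOf_childOf hS h hc
  slots_child I d _ _ _ hc := by
    classical
    have hex := (T.childOf_lt_iff d).1 hc
    have hj := Nat.find_spec hex
    refine slots_le_succ ⟨Nat.find hex, hj.1⟩ fun j h => ?_
    rw [T.exists_tailsOf_iff]
    by_contra! hne
    obtain ⟨a, -, ha⟩ := h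
    -- A dropped slot after the first one now holds the imaginary edge and has no tail.
    have hlt : Nat.find hex < j := lt_of_le_of_ne (Nat.find_min' hex ⟨j.2, hne.2⟩)
      fun h => hne.1 (Fin.ext h.symm)
    rw [tailsOf, childOf, digit_replaceDigits (Nat.succ_pos E) (Nat.succ_lt_succ (T.equiv d).2) hex
      j.2, newDigit, if_neg hne.2, if_pos ⟨_, hlt, hj.2⟩] at ha
    rw [dif_neg (by rw [T.tl_zero]; exact lt_irrefl n)] at ha
    cases ha

end EdgeTable

end tables

/-! ### From numeric tables to an approximately optimal search tree -/

section tables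

variable {n : ℕ} {S : SimpleGraph (Fin n)} {E : ℕ} {tl hd : ℕ → ℕ}

/-- The node with number `v` belongs to the subproblem `I`. -/
def InNodes (S : SimpleGraph (Fin n)) (K k : ℕ) (tl hd : ℕ → ℕ) (I v : ℕ) : Prop :=
  ∃ h : v < n, ⟨v, h⟩ ∈ nodesOf S K k tl hd I

theorem inNodes_iff {K k I : ℕ} {x : Fin n} :
    InNodes S K k tl hd I x ↔ x ∈ nodesOf S K k tl hd I := ⟨fun ⟨_, h⟩ => h, fun h => ⟨x.2, h⟩⟩

open Classical in
/-- The sum of the values of `F` at the children of the root `r` in the subproblem `I`. -/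
noncomputable def childSum (S : SimpleGraph (Fin n)) (K k : ℕ) (tl hd : ℕ → ℕ) (ch : ℕ → ℕ → ℕ)
    (F : ℕ → ℕ) (I r m : ℕ) : ℕ :=
  ∑ e ∈ Finset.range m, if tl e = r ∧ InNodes S K k tl hd I (hd e) then F (ch I e) else 0

open Classical in
/-- The child of the root `r` in the subproblem `I` that contains the node `x`, found by a search
among the first `m` edges. -/
noncomputable def nextOf (S : SimpleGraph (Fin n)) (tl hd : ℕ → ℕ) (ch : ℕ → ℕ → ℕ) (r I x : ℕ) :
    ℕ → ℕ
  | 0 => I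
  | e + 1 => if tl e = r ∧ Behind S tl hd e x then ch I e else nextOf S tl hd ch r I x e

/-- One step on the search path of the node `x`. -/
noncomputable def stepOf (S : SimpleGraph (Fin n)) (K : ℕ) (tl hd : ℕ → ℕ) (ch : ℕ → ℕ → ℕ)
    (c : ℕ → ℕ) (x : ℕ) (s : ℕ × ℕ) : ℕ × ℕ :=
  if c s.1 = x then s else (nextOf S tl hd ch (c s.1) s.1 x K, c s.1 + 1)

namespace EdgeTable

variable (T : EdgeTable S E tl hd)

open Classical in
include T in
theorem childSum_eq {k : ℕ} {ch : ℕ → ℕ → ℕ} {F : ℕ → ℕ} {I : ℕ} (r : Fin n) :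
    childSum S (E + 1) k tl hd ch F I r (E + 1) =
      ∑ d ∈ dartsAt S (nodesOf S (E + 1) k tl hd I) r, F (ch I (T.equiv d + 1)) := by
  rw [childSum, Finset.sum_range_succ', if_neg (fun h => by
    have := h.1; rw [T.tl_zero] at this; exact r.2.ne' this), add_zero, Finset.sum_range,
    ← T.equiv.sum_comp, dartsAt, Finset.sum_filter]
  refine Finset.sum_congr rfl fun d _ => ?_
  simp only [T.tl_succ, T.hd_succ, inNodes_iff, Fin.val_inj]
  congr

/-- Only one edge leaving `d.fst` has `x` behind it, so the order of the search does not matter. -/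
theorem nextOf_eq (hS : S.IsTree) {ch : ℕ → ℕ → ℕ} {I : ℕ} {d : S.Dart} {x : Fin n}
    (hx : x ∈ side d) : nextOf S tl hd ch d.fst I x (E + 1) = ch I (T.equiv d + 1) := by
  have key : ∀ m : ℕ, (T.equiv d : ℕ) + 1 < m → m ≤ E + 1 →
      nextOf S tl hd ch d.fst I x m = ch I (T.equiv d + 1) := by
    intro m
    induction m with
    | zero => intro h; omega
    | succ m ih =>
      intro h hm
      rw [nextOf]
      by_cases hme : m = T.equiv d + 1
      · rw [if_pos ⟨by rw [hme, T.tl_succ], by rw [hme]; exact (T.behind_succ d x).2 hx⟩, hme]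
      · rw [if_neg, ih (by omega) (by omega)]
        rintro ⟨h1, h2⟩
        obtain h0 | ⟨d', h0⟩ := T.cases (show m < E + 1 by omega)
        · omega
        · rw [h0] at h1 h2
          rw [T.tl_succ, Fin.val_inj] at h1
          have := dart_eq_of_mem_side hS.isAcyclic h1 ((T.behind_succ d' x).1 h2) hx
          exact hme (this ▸ h0)
  exact key _ (Nat.succ_lt_succ (T.equiv d).2) le_rfl

include T in
-- `F` is both a subsolution, hence at most `(1 + 1/t) * OPT`, and attained by the roots `c`, hence
-- at least the cost of the tree they describe. The value `2 * n * X.length + 1` plays the role of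
-- infinity.
theorem approx_of_tables (hS : S.IsTree) {t : ℕ} (ht : 1 ≤ t) (X : List (Fin n))
    {ch : ℕ → ℕ → ℕ} {F c : ℕ → ℕ}
    (hch : ∀ I < (E + 1) ^ (2 * t), ∀ e < E + 1, ch I e = childOf S (E + 1) (2 * t) tl hd I e)
    (hF : ∀ I < (E + 1) ^ (2 * t), ∀ r, InNodes S (E + 1) (2 * t) tl hd I r →
      F I ≤ ∑ x ∈ nodesOf S (E + 1) (2 * t) tl hd I, X.count x +
        childSum S (E + 1) (2 * t) tl hd ch F I r (E + 1))
    (hc : ∀ I < (E + 1) ^ (2 * t), F I < 2 * n * X.length + 1 →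
      InNodes S (E + 1) (2 * t) tl hd I (c I) ∧
      ∑ x ∈ nodesOf S (E + 1) (2 * t) tl hd I, X.count x +
        childSum S (E + 1) (2 * t) tl hd ch F I (c I) (E + 1) ≤ F I)
    (htop : F ((E + 1) ^ (2 * t)) = 2 * n * X.length + 1)
    (hcn : ∀ I, c I < n) :
    ∃ parent : Fin n → Option (Fin n),
      (∀ x : Fin n, ((stepOf S (E + 1) tl hd ch c x)^[n] (0, 0)).2 =
        (parent x).elim 0 (fun u => (u : ℕ) + 1)) ∧
      IsSearchTree S parent ∧
      (cost parent X : ℝ) ≤ (1 + 1 / (t : ℝ)) * (opt S X : ℝ) := by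
  classical
  have hn : 0 < n := (Nat.zero_le _).trans_lt (hcn 0)
  set K := E + 1
  set P := K ^ (2 * t) with hP
  let M := T.subproblems hS (2 * t)
  have hP0 : 0 < P := pow_pos (Nat.succ_pos E) _
  have h0 : M.Valid 0 := hP0
  have hlen : ∑ x, X.count x = X.length := by
    simpa using Multiset.sum_count_eq_card (s := Finset.univ) (m := (X : Multiset (Fin n))) (by simp)
  have hdig0 : ∀ j, digit K 0 j = 0 := fun j => by simp [digit]
  have hnodes0 : M.nodes 0 = Finset.univ := by
    ext x
    simp only [Finset.mem_univ, iff_true]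
    refine mem_nodesOf.2 fun j _ => ?_
    rw [hdig0]
    exact T.behind_zero hS x
  have hslots0 : slots (M.tails 0) Set.univ = 0 := by
    refine slots_eq_zero fun j => ?_
    change tailsOf n K (2 * t) tl 0 j = none
    rw [tailsOf, dif_neg]
    rw [hdig0, T.tl_zero]; exact lt_irrefl n
  -- Every number outside the table becomes infinite, as the reconstruction requires of invalid
  -- subproblems.
  let f : ℕ → ℕ := fun I => if I < P then F I else 2 * n * X.length + 1
  have hf0 : f 0 = F 0 := if_pos hP0
  have hfeq : ∀ I < P, ∀ d : S.Dart, f (M.child I d) = F (ch I (T.equiv d + 1)) := by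
    intro I hI d
    rw [show ch I (T.equiv d + 1) = M.child I d from hch I hI _ (Nat.succ_lt_succ (T.equiv d).2)]
    by_cases h2 : M.child I d < P
    · simp [f, h2]
    · have h3 : M.child I d = P := le_antisymm
        (childOf_le (Nat.succ_lt_succ (T.equiv d).2)) (not_lt.1 h2)
      simp only [f, h3, lt_irrefl, if_false]
      exact htop.symm
  have hsum : ∀ I < P, ∀ r : Fin n, childSum S K (2 * t) tl hd ch F I r K =
      ∑ e ∈ dartsAt S (M.nodes I) r, f (M.child I e) := fun I hI r => by
    rw [T.childSum_eq]
    exact Finset.sum_congr rfl fun d _ => (hfeq I hI d).symm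
  have hsub : M.IsSubsolution (fun x => X.count x) f := by
    intro I hI r hr
    rw [← hsum I hI, show f I = F I from if_pos hI]
    exact hF I hI r (inNodes_iff.2 hr)
  -- Stated for any `d` with unique minima: it is used for an arbitrary numbering of the nodes as
  -- well as for optimal depths.
  have happrox : ∀ d : Fin n → ℕ, (∀ x, 0 < d x) →
      (∀ C : Set (Fin n), PathConvex S C → C.Nonempty → ∃ r ∈ C, ∀ x ∈ C, x ≠ r → d r < d x) →
      t * F 0 ≤ (t + 1) * ∑ x, X.count x * d x := by
    intro d hd0 hd
    have := hsub.approx ht hS hd h0 (q := 0) (by rw [hnodes0]; exact ⟨⟨0, hn⟩, Finset.mem_univ _⟩)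
      (fun x _ => hd0 x)
    rw [hnodes0, hslots0, hf0] at this
    simp only [Nat.zero_sub, add_zero, mul_zero, zero_mul] at this
    rw [Finset.mul_sum]
    exact this.trans_eq (Finset.sum_congr rfl fun x _ => by ring)
  -- Numbering the nodes by `1, …, n` gives distinct values, so minima are unique; the resulting
  -- bound `(1 + 1/t) * n * X.length` is below infinity.
  have hlt : F 0 < 2 * n * X.length + 1 := by
    have h1 := happrox (fun x => x + 1) (fun x => Nat.succ_pos _) (fun C _ hC => by
      obtain ⟨r, hr, h⟩ := C.toFinite.exists_minimalFor id C hC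
      refine ⟨r, hr, fun x hx hne => Nat.succ_lt_succ ?_⟩
      have := h hx
      simp only [id] at this
      rcases lt_or_ge r x with h | h
      · exact h
      · exact absurd (le_antisymm h (this h)) hne)
    have h2 : ∑ x : Fin n, X.count x * ((x : ℕ) + 1) ≤ X.length * n := by
      rw [← hlen, Finset.sum_mul]
      exact Finset.sum_le_sum fun x _ => Nat.mul_le_mul_left _ x.2
    have h3 : t * F 0 ≤ t * (2 * n * X.length) := by
      calc t * F 0 ≤ (t + 1) * (X.length * n) := h1.trans (Nat.mul_le_mul_left _ h2)
        _ ≤ (2 * t) * (X.length * n) := Nat.mul_le_mul_right _ (by omega)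
        _ = _ := by ring
    exact Nat.lt_succ_of_le (Nat.le_of_mul_le_mul_left h3 ht)
  let c' : ℕ → Fin n := fun I => ⟨c I, hcn I⟩
  let next : ℕ → Fin n → ℕ := fun I x => nextOf S tl hd ch (c I) I x K
  let parent : Fin n → Option (Fin n) := fun x =>
    ((Subproblems.descend c' next x)^[n] (0, none)).2
  have hparent : ∀ x : Fin n, ∀ i, (stepOf S K tl hd ch c x)^[i] (0, 0) =
      (((Subproblems.descend c' next x)^[i] (0, none)).1,
        ((Subproblems.descend c' next x)^[i] (0, none)).2.elim 0 (fun u => (u : ℕ) + 1)) := by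
    intro x i
    induction i with
    | zero => rfl
    | succ i ih =>
      rw [Function.iterate_succ_apply', Function.iterate_succ_apply', ih, Subproblems.descend,
        stepOf]
      by_cases h : c' ((Subproblems.descend c' next x)^[i] (0, none)).1 = x
      · rw [if_pos h, if_pos (congrArg Fin.val h)]
      · rw [if_neg h, if_neg fun h' => h (Fin.ext h')]
        rfl
  obtain ⟨htree, hcost⟩ := Subproblems.isSearchTree_of_descend (M := M) hS
    (w := fun x => X.count x) (f := f) (top := 2 * n * X.length + 1) (c := c') (next := next)
    (g₀ := 0) (fun I hI => by simp only [f]; rw [if_neg (show ¬ I < P from hI)])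
    (fun I hI hlt => by
      rw [show f I = F I from if_pos hI] at hlt ⊢
      obtain ⟨h1, h2⟩ := hc I hI hlt
      rw [← hsum I hI]
      exact ⟨inNodes_iff.1 h1, h2⟩)
    (fun I d x hI hd hx => by
      have h := T.nextOf_eq hS (ch := ch) (I := I) hx
      rw [hd] at h
      exact h.trans (hch I hI _ (Nat.succ_lt_succ (T.equiv d).2)))
    (parent := parent) (fun x => by simp [parent]) h0 hnodes0 (by rw [hf0]; exact hlt)
  refine ⟨parent, fun x => by rw [hparent], htree, ?_⟩
  rw [← cost_eq_sum] at hcost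
  -- The infimum is attained because the tree just built shows that the set of costs is nonempty.
  obtain ⟨p, hp, hpc⟩ : opt S X ∈ {c | ∃ parent : Fin n → Option (Fin n),
    IsSearchTree S parent ∧ cost parent X = c} := Nat.sInf_mem ⟨_, parent, htree, rfl⟩
  have h1 := happrox (depth p) (one_le_depth p)
    (hp.exists_depth_lt hS.connected.preconnected)
  rw [← cost_eq_sum, hpc] at h1
  have h2 : t * cost parent X ≤ (t + 1) * opt S X := (Nat.mul_le_mul_left t (hf0 ▸ hcost)).trans h1
  have h3 : (t : ℝ) * cost parent X ≤ (t + 1) * opt S X := by exact_mod_cast h2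
  have ht' : (0 : ℝ) < t := by exact_mod_cast ht
  rw [show (1 + 1 / (t : ℝ)) * (opt S X : ℝ) = ((t + 1) * opt S X) / t by field_simp,
    le_div_iff₀ ht', mul_comm]
  exact h3

end EdgeTable

end tables

-- Notation for programs

local infixl:65 " +ₑ " => Expr.bin BinOp.add
local infixl:65 " -ₑ " => Expr.bin BinOp.sub
local infixl:70 " *ₑ " => Expr.bin BinOp.mul
local infixl:70 " /ₑ " => Expr.bin BinOp.div
local infixl:70 " %ₑ " => Expr.bin BinOp.mod
local infixl:50 " <ₑ " => Expr.bin BinOp.lt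
local infixl:50 " =ₑ " => Expr.bin BinOp.eq
local infixr:30 " ;; " => Cmd.seq
local infix:40 " ::= " => Cmd.set
local notation "#" x:max => Expr.var x

/-! ### Enumeration of the edges -/

/-- List the edges of the graph. -/
def edgesProg : Cmd :=
  20 ::= #0 *ₑ #0 ;;
  forLoop 6 (#20) (
    Cmd.ite (.get 0 (#6))
      (1 ::= #1 +ₑ .lit 1 ;; Cmd.put 3 (#1) (#6 /ₑ #0) ;; Cmd.put 4 (#1) (#6 %ₑ #0))
      .skip) ;;
  Cmd.put 3 (.lit 0) (#0) ;;
  2 ::= #1 +ₑ .lit 1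

/-- The memory after the enumeration of the edges. -/
structure HasEdges (n E : ℕ) (cnt tl hd : ℕ → ℕ) (s : State) : Prop where
  var_n : s.var 0 = n
  var_K : s.var 2 = E + 1
  cnt_eq : s.arr 1 = cnt
  tl_eq : s.arr 3 = tl
  hd_eq : s.arr 4 = hd

theorem HasEdges.frame {n E : ℕ} {cnt tl hd : ℕ → ℕ} {s s' : State} {vs as : List ℕ}
    (h : HasEdges n E cnt tl hd s) (hf : Frame vs as s s')
    (hv : ∀ x ∈ [0, 2], x ∉ vs) (ha : ∀ a ∈ [1, 3, 4], a ∉ as) : HasEdges n E cnt tl hd s' := by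
  simp only [List.mem_cons, List.not_mem_nil, or_false, forall_eq_or_imp, forall_eq] at hv ha
  exact ⟨(hf.var 0 hv.1).trans h.1, (hf.var 2 hv.2).trans h.2, (hf.arr 1 ha.1).trans h.3,
    (hf.arr 3 ha.2.1).trans h.4, (hf.arr 4 ha.2.2).trans h.5⟩

theorem HasEdges.setVar {n E : ℕ} {cnt tl hd : ℕ → ℕ} {s : State} {x v : ℕ}
    (h : HasEdges n E cnt tl hd s) (hx : x ≠ 0 ∧ x ≠ 2) : HasEdges n E cnt tl hd (s.setVar x v) :=
  ⟨by simp [hx.1.symm, h.1], by simp [hx.2.symm, h.2], h.3, h.4, h.5⟩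

theorem HasEdges.setArr {n E : ℕ} {cnt tl hd : ℕ → ℕ} {s : State} {a i v : ℕ}
    (h : HasEdges n E cnt tl hd s) (ha : a ≠ 1 ∧ a ≠ 3 ∧ a ≠ 4) :
    HasEdges n E cnt tl hd (s.setArr a i v) :=
  ⟨h.1, h.2, by simp [ha.1.symm, h.3], by simp [ha.2.1.symm, h.4], by simp [ha.2.2.symm, h.5]⟩

/-- The code of a pair of adjacent nodes. -/
def IsEdgeCode {n : ℕ} (S : SimpleGraph (Fin n)) (i : ℕ) : Prop :=
  ∃ u v : Fin n, i = u * n + v ∧ S.Adj u v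

/-- Position `e + 1` holds the edge code number `e` in increasing order. `Nat.count` and `Nat.nth`
are inverse to each other on codes, and division by `n` recovers the endpoints. -/
theorem nonempty_edgeTable {n : ℕ} (S : SimpleGraph (Fin n)) {tl hd : ℕ → ℕ}
    [DecidablePred (IsEdgeCode S)] (h0 : tl 0 = n) (h0' : hd 0 = 0)
    (h : ∀ e < Nat.count (IsEdgeCode S) (n * n),
      tl (e + 1) = Nat.nth (IsEdgeCode S) e / n ∧ hd (e + 1) = Nat.nth (IsEdgeCode S) e % n) :
    Nonempty (EdgeTable S (Nat.count (IsEdgeCode S) (n * n)) tl hd) := by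
  have hcode : ∀ d : S.Dart, IsEdgeCode S (d.fst * n + d.snd) := fun d => ⟨_, _, rfl, d.adj⟩
  have hlt : ∀ d : S.Dart, (d.fst * n + d.snd : ℕ) < n * n := fun d => by
    have := Nat.mul_le_mul_right n (Nat.succ_le_of_lt d.fst.2)
    have := d.snd.2
    rw [Nat.succ_mul] at *
    omega
  have hdiv : ∀ u v : Fin n, (u * n + v : ℕ) / n = u ∧ (u * n + v : ℕ) % n = v := fun u v => by
    have hn : 0 < n := (Nat.zero_le _).trans_lt v.2
    rw [mul_comm, Nat.mul_add_div hn, Nat.mul_add_mod, Nat.div_eq_of_lt v.2, Nat.mod_eq_of_lt v.2]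
    simp
  let φ : S.Dart → Fin (Nat.count (IsEdgeCode S) (n * n)) := fun d =>
    ⟨Nat.count (IsEdgeCode S) (d.fst * n + d.snd), Nat.count_strict_mono (hcode d) (hlt d)⟩
  have hφ : Function.Bijective φ := by
    constructor
    · intro d d' hdd
      have h1 := Nat.count_injective (hcode d) (hcode d') (congrArg Fin.val hdd)
      have h2 := hdiv d.fst d.snd
      rw [h1] at h2
      have h3 := hdiv d'.fst d'.snd
      exact SimpleGraph.Dart.ext _ _
        (Prod.ext (Fin.ext (h2.1.symm.trans h3.1)) (Fin.ext (h2.2.symm.trans h3.2)))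
    · rintro ⟨e, he⟩
      have hfin : ∀ hf : (Set.ofPred (IsEdgeCode S)).Finite, e < hf.toFinset.card := fun hf =>
        he.trans_le (by
          rw [Nat.count_eq_card_filter_range]
          exact Finset.card_le_card fun i hi => by simpa using (Finset.mem_filter.1 hi).2)
      obtain ⟨u, v, huv, hadj⟩ : IsEdgeCode S (Nat.nth (IsEdgeCode S) e) := Nat.nth_mem e hfin
      refine ⟨⟨(u, v), hadj⟩, Fin.ext ?_⟩
      change Nat.count (IsEdgeCode S) (u * n + v) = e
      rw [← huv, Nat.count_nth hfin]
  refine ⟨⟨Equiv.ofBijective φ hφ, h0, h0', fun d => ?_, fun d => ?_⟩⟩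
  · change tl (φ d + 1) = _
    rw [(h _ (φ d).2).1, Nat.nth_count (hcode d), (hdiv _ _).1]
  · change hd (φ d + 1) = _
    rw [(h _ (φ d).2).2, Nat.nth_count (hcode d), (hdiv _ _).2]

/-- A tree has `n - 1` edges, hence `E = 2 * (n - 1)` darts. -/
theorem EdgeTable.succ_le {n : ℕ} {S : SimpleGraph (Fin n)} {E : ℕ} {tl hd : ℕ → ℕ}
    (T : EdgeTable S E tl hd) (hS : S.IsTree) : E + 1 ≤ 2 * n := by
  classical
  have h1 := Fintype.card_congr T.equiv
  rw [S.dart_card_eq_twice_card_edges, Fintype.card_fin] at h1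
  have h2 := hS.card_edgeFinset
  rw [Fintype.card_fin] at h2
  omega

theorem run_edgesProg {B n : ℕ} {S : SimpleGraph (Fin n)} {s : State}
    [DecidablePred (IsEdgeCode S)]
    (h0 : s.var 0 = n) (h1 : s.var 1 = 0)
    (hadj : ∀ i, s.arr 0 i = if IsEdgeCode S i then 1 else 0)
    (hhd : s.arr 4 0 = 0) (hB : n * n + 1 < B) :
    Run B edgesProg s (40 * (n * n) + 40) fun s' =>
      ∃ E tl hd, Nonempty (EdgeTable S E tl hd) ∧ HasEdges n E (s.arr 1) tl hd s' := by
  unfold edgesProg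
  apply Run.of_le
  · apply run_seq
    apply run_set
    · simp [Expr.Ok, Expr.eval, h0]; omega
    apply run_seq
    -- Edges are written from position `1` on; cell `0` of array `4` keeps its initial `0`, the head
    -- of the imaginary edge.
    apply run_for_const (n * n) 30 (fun i s' =>
      s'.var 1 = Nat.count (IsEdgeCode S) i ∧ s'.arr 4 0 = 0 ∧
      ∀ e < Nat.count (IsEdgeCode S) i, s'.arr 3 (e + 1) = Nat.nth (IsEdgeCode S) e / n ∧
        s'.arr 4 (e + 1) = Nat.nth (IsEdgeCode S) e % n)
    · decide
    · intro s' hf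
      simp [Expr.eval, hf.var 20 (by decide), Expr.Ok, BinOp.eval, h0]
    · intro i s' v h
      simpa using h
    · simp [h1, hhd]
    · intro i hi s' hs' hf hi' ⟨g1, g2, g3⟩
      have e0 : s'.var 0 = n := by simp [hf.var 0 (by decide), h0]
      have e1 : s'.arr 0 i = if IsEdgeCode S i then 1 else 0 := by
        simp [hf.arr 0 (by decide), hadj]
      have hle := Nat.count_le (p := IsEdgeCode S) (n := i)
      apply Run.of_le
      · apply run_ite
        · simp [Expr.Ok]
        · intro hc
          have hc : IsEdgeCode S i := by simpa [Expr.eval, hi', e1] using hc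
          apply run_seq
          apply run_set
          · simp [Expr.Ok, Expr.eval, g1, hs'.one_lt]; omega
          apply run_seq
          apply run_put
          · simp [Expr.Ok]
          · simp [Expr.Ok]
          apply run_put
          · simp [Expr.Ok]
          · simp [Expr.Ok]
          simp [Expr.eval, BinOp.eval, g1, g2, hi', e0, Nat.count_succ, hc]
          intro e he
          rcases he.lt_or_eq with h | rfl
          · simp [h.ne, g3 e h]
          · simp [Nat.nth_count hc]
        · intro hc
          have hc : ¬ IsEdgeCode S i := by simpa [Expr.eval, hi', e1] using hc
          apply run_skip
          simp [Nat.count_succ, hc, g1, g2]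
          exact g3
      · simp [Expr.time]
    · intro s' hs' hf ⟨g1, g2, g3⟩
      have hle := Nat.count_le (p := IsEdgeCode S) (n := n * n)
      have e0 : s'.var 0 = n := by simp [hf.var 0 (by decide), h0]
      apply run_seq
      apply run_put
      · simp [Expr.Ok]; omega
      · simp [Expr.Ok]
      apply run_set
      · simp [Expr.Ok, Expr.eval, g1, hs'.one_lt]; omega
      refine ⟨_, _, _, nonempty_edgeTable S ?_ ?_ ?_, ⟨?_, ?_, ?_, rfl, rfl⟩⟩
      · simp [Expr.eval, e0]
      · simp [g2]
      · intro e he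
        simpa [Expr.eval] using g3 e he
      · simp [e0]
      · simp [Expr.eval, BinOp.eval, g1]
      · simp [hf.arr 1 (by decide)]
  · simp [Expr.time]; omega

/-! ### Half-spaces -/

theorem mul_add_lt {a A b N : ℕ} (ha : a < A) (hb : b < N) : a * N + b < A * N := by
  have := Nat.mul_le_mul_right N (Nat.succ_le_of_lt ha)
  rw [Nat.succ_mul] at this
  omega

theorem mul_add_inj {a a' b b' N : ℕ} (hb : b < N) (hb' : b' < N) :
    a * N + b = a' * N + b' ↔ a = a' ∧ b = b' := by
  refine ⟨fun h => ?_, by rintro ⟨rfl, rfl⟩; rfl⟩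
  have hN : 0 < N := (Nat.zero_le _).trans_lt hb
  have h1 := congrArg (· / N) h
  have h2 := congrArg (· % N) h
  simp only [mul_comm _ N, Nat.mul_add_div hN, Nat.div_eq_of_lt hb, Nat.div_eq_of_lt hb',
    Nat.mul_add_mod, Nat.mod_eq_of_lt hb, Nat.mod_eq_of_lt hb', add_zero] at h1 h2
  exact ⟨h1, h2⟩

/-- The node `v` can be reached from `b` by a walk of length at most `i` that avoids `a`. -/
def ReachIn {n : ℕ} (S : SimpleGraph (Fin n)) (a b i v : ℕ) : Prop :=
  ∃ (hb : b < n) (hv : v < n) (p : S.Walk ⟨b, hb⟩ ⟨v, hv⟩),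
    (∀ z ∈ p.support, (z : ℕ) ≠ a) ∧ p.length ≤ i

/-- Shortening a walk to a path leaves fewer than `n` edges, so `n` rounds of relaxation suffice. -/
theorem Reach.reachIn {n : ℕ} {S : SimpleGraph (Fin n)} {a b v : ℕ} (h : Reach S a b v) :
    ReachIn S a b n v := by
  obtain ⟨hb, hv, p, hp⟩ := h
  refine ⟨hb, hv, p.bypass, fun z hz => hp z (p.support_bypass_subset_support hz), ?_⟩
  simpa using p.bypass_isPath.length_lt.le

theorem Reach.step {n : ℕ} {S : SimpleGraph (Fin n)} {a b : ℕ} {u v : Fin n} (h : Reach S a b u)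
    (huv : S.Adj u v) (hv : (v : ℕ) ≠ a) : Reach S a b v := by
  obtain ⟨hb, _, p, hp⟩ := h
  refine ⟨hb, v.2, p.concat huv, fun z hz => ?_⟩
  rw [SimpleGraph.Walk.support_concat, List.mem_append,
    List.mem_singleton] at hz
  rcases hz with hz | rfl
  exacts [hp z hz, hv]

theorem ReachIn.cases {n : ℕ} {S : SimpleGraph (Fin n)} {a b i v : ℕ}
    (h : ReachIn S a b (i + 1) v) : v = b ∨ ∃ u v' : Fin n, v = v' ∧ ReachIn S a b i u ∧
      S.Adj u v' ∧ v ≠ a := by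
  obtain ⟨hb, hv, p, hp, hlen⟩ := h
  by_cases hnil : p.Nil
  · exact .inl (congrArg Fin.val hnil.eq.symm)
  · refine .inr ⟨p.penultimate, ⟨v, hv⟩, rfl, ⟨hb, p.penultimate.2, p.dropLast, fun z hz => ?_, ?_⟩,
      p.adj_penultimate hnil, hp _ p.end_mem_support⟩
    · exact hp z (List.mem_of_mem_dropLast (p.support_dropLast hnil ▸ hz))
    · simp; omega

/-- Compute for every edge which nodes lie behind it. -/
def sidesProg : Cmd :=
  forLoop 5 (#2) (
    9 ::= #5 *ₑ (#0 +ₑ .lit 1) ;;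
    .put 5 (#9 +ₑ .get 4 (#5)) (.lit 1) ;;
    forLoop 6 (#0) (
      forLoop 7 (#2) (
        .ite (.get 5 (#9 +ₑ .get 3 (#7)))
          (.ite (.get 4 (#7) =ₑ .get 3 (#5)) .skip (.put 5 (#9 +ₑ .get 4 (#7)) (.lit 1)))
          .skip)))

open Classical in
/-- The indicator of a proposition. -/
noncomputable def ind (p : Prop) : ℕ := if p then 1 else 0

@[simp] theorem ind_eq_zero {p : Prop} : ind p = 0 ↔ ¬ p := by simp [ind]

theorem ind_of {p : Prop} (h : p) : ind p = 1 := if_pos h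

theorem ind_of_not {p : Prop} (h : ¬ p) : ind p = 0 := if_neg h

theorem ind_le_one (p : Prop) : ind p ≤ 1 := by unfold ind; split <;> simp

/-- Array `5` tells which nodes lie behind which edges. -/
def HasSides {n : ℕ} (S : SimpleGraph (Fin n)) (E : ℕ) (tl hd : ℕ → ℕ) (s : State) : Prop :=
  ∀ e < E + 1, ∀ v < n + 1, s.arr 5 (e * (n + 1) + v) = ind (Behind S tl hd e v)

/-- For each edge, `n` rounds relax all edges in place. A round may mark nodes early, so the
invariant only says that marked nodes are reachable and that nodes within `i` steps are marked after
`i` rounds. Rows have length `n + 1`: column `n` belongs to the tail of the imaginary edge and is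
never marked. -/
theorem run_sidesProg {B n E : ℕ} {S : SimpleGraph (Fin n)} (hn : 0 < n) {cnt tl hd : ℕ → ℕ}
    {s : State} (T : EdgeTable S E tl hd) (h : HasEdges n E cnt tl hd s)
    (h5 : ∀ i, s.arr 5 i = 0) (hB : (E + 1) * (n + 1) < B) :
    Run B sidesProg s ((E + 1) * (n * ((E + 1) * 40 + 20) + 40) + 10) fun s' =>
      HasSides S E tl hd s' := by
  -- Other rows are final or still zero; in row `e` every mark is justified.
  let Sound : ℕ → State → Prop := fun e s' =>
    (∀ e' < E + 1, e' ≠ e → ∀ v < n + 1,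
      s'.arr 5 (e' * (n + 1) + v) = ind (e' < e ∧ Behind S tl hd e' v)) ∧
    ∀ v < n + 1, s'.arr 5 (e * (n + 1) + v) ≠ 0 →
      Behind S tl hd e v ∧ s'.arr 5 (e * (n + 1) + v) = 1
  have hmark : ∀ e s' v, v < n + 1 → Sound e s' → Behind S tl hd e v →
      Sound e (s'.setArr 5 (e * (n + 1) + v) 1) := by
    rintro e s' v hv ⟨h1, h2⟩ hev
    refine ⟨fun e' he' hne v' hv' => ?_, fun v' hv' => ?_⟩
    · simp [mul_add_inj hv' hv, hne, h1 e' he' hne v' hv']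
    · by_cases hvv : v' = v
      · subst hvv; simp [hev]
      · simpa [Function.update_apply, hvv] using h2 v' hv'
  have hkeep : ∀ (s' : State) i j, s'.arr 5 i ≠ 0 → (s'.setArr 5 j 1).arr 5 i ≠ 0 := by
    intro s' i j hi
    by_cases hij : i = j
    · simp [hij]
    · simpa [Function.update_apply, hij] using hi
  unfold sidesProg
  apply Run.of_le
  · apply run_for_const (E + 1) (n * ((E + 1) * 40 + 20) + 30) (fun e s' =>
      ∀ e' < E + 1, ∀ v < n + 1, s'.arr 5 (e' * (n + 1) + v) = ind (e' < e ∧ Behind S tl hd e' v))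
    · decide
    · intro s' hf
      simp [Expr.eval, hf.var 2 (by decide), Expr.Ok, h.var_K]
    · intro i s' v h
      simpa using h
    · intro e' _ v _
      simp [h5, ind]
    · intro e he s₁ hs₁ hf₁ hi₁ hInv
      have g := h.frame hf₁ (by decide) (by decide)
      have hhd := T.hd_lt hn he
      have hrow := mul_add_lt he (show hd e < n + 1 by omega)
      have hrow0 := mul_add_lt he (show 0 < n + 1 by omega)
      have hN : n + 1 < B := by
        have := Nat.le_mul_of_pos_left (n + 1) (show 0 < E + 1 by omega); omega
      have hbeh : Behind S tl hd e (hd e) := ⟨hhd, hhd, .nil, fun z hz h' => by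
        obtain rfl := List.mem_singleton.1 hz
        obtain rfl | ⟨d, rfl⟩ := T.cases he
        · rw [T.tl_zero] at h'; exact hhd.ne h'
        · rw [T.tl_succ] at h'
          simp only [T.hd_succ] at h'
          exact d.adj.ne (Fin.ext h'.symm)⟩
      apply Run.of_le
      · apply run_seq
        apply run_set
        · simp [Expr.Ok, Expr.eval, BinOp.eval, g.var_n, hi₁, hs₁.one_lt, hN]; omega
        apply run_seq
        apply run_put
        · simp [Expr.Ok, Expr.eval, BinOp.eval, hi₁, g.var_n, g.hd_eq]; omega
        · simpa [Expr.Ok] using hs₁.one_lt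
        apply run_for_const n ((E + 1) * 40 + 10) (fun i s' => Sound e s' ∧
          ∀ v, ReachIn S (tl e) (hd e) i v → s'.arr 5 (e * (n + 1) + v) ≠ 0)
        · decide
        · intro s' hf
          simp [Expr.eval, hf.var 0 (by decide), Expr.Ok, g.var_n]
        · intro i s' v h
          simpa [Sound] using h
        · simp only [Expr.eval, BinOp.eval, State.setVar_var, g.var_n, hi₁, State.setVar_arr,
            g.hd_eq, ↓reduceIte, Nat.reduceEqDiff]
          refine ⟨hmark e _ _ (by omega) ⟨fun e' he' _ v hv => hInv e' he' v hv, ?_⟩ hbeh, ?_⟩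
          · intro v hv h'
            exact absurd (hInv e he v hv) (by simpa [ind] using h')
          · rintro v ⟨hb, hv, p, hp, hlen⟩
            have := SimpleGraph.Walk.eq_of_length_eq_zero (Nat.le_zero.1 hlen)
            simp [← Fin.mk.inj_iff.1 this]
        · intro i hi s₂ hs₂ hf₂ hi₂ ⟨hS₂, hR₂⟩
          have g₂ := ((g.setVar (by decide)).setArr (by decide)).frame hf₂ (by decide) (by decide)
          have e5 : s₂.var 5 = e := by simp [hf₂.var 5 (by decide), hi₁]
          have e9 : s₂.var 9 = e * (n + 1) := by
            simp [hf₂.var 9 (by decide), Expr.eval, BinOp.eval, hi₁, g.var_n]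
          apply Run.of_le
          · apply run_for_const (E + 1) 30 (fun e₂ s' => Sound e s' ∧
              (∀ v, ReachIn S (tl e) (hd e) i v → s'.arr 5 (e * (n + 1) + v) ≠ 0) ∧
              ∀ e' < e₂, ReachIn S (tl e) (hd e) i (tl e') → hd e' ≠ tl e →
                s'.arr 5 (e * (n + 1) + hd e') ≠ 0)
            · decide
            · intro s' hf
              simp [Expr.eval, hf.var 2 (by decide), Expr.Ok, g₂.var_K]
            · intro i s' v h
              simpa [Sound] using h
            · exact ⟨hS₂, hR₂, fun e' he' => absurd he' (Nat.not_lt_zero _)⟩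
            · intro e₂ he₂ s₃ hs₃ hf₃ hi₃ ⟨hS₃, hR₃, hE₃⟩
              have g₃ := g₂.frame hf₃ (by decide) (by decide)
              have e5' : s₃.var 5 = e := by simp [hf₃.var 5 (by decide), e5]
              have e9' : s₃.var 9 = e * (n + 1) := by simp [hf₃.var 9 (by decide), e9]
              have htl₂ := T.tl_le he₂
              have hhd₂ := T.hd_lt hn he₂
              have hrow₂ := mul_add_lt he (show tl e₂ < n + 1 by omega)
              have hrow₂' := mul_add_lt he (show hd e₂ < n + 1 by omega)
              have hlast : ∀ s' : State, (∀ e' < e₂, ReachIn S (tl e) (hd e) i (tl e') →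
                  hd e' ≠ tl e → s'.arr 5 (e * (n + 1) + hd e') ≠ 0) →
                  (ReachIn S (tl e) (hd e) i (tl e₂) → hd e₂ ≠ tl e →
                    s'.arr 5 (e * (n + 1) + hd e₂) ≠ 0) →
                  ∀ e' < e₂ + 1, ReachIn S (tl e) (hd e) i (tl e') →
                    hd e' ≠ tl e → s'.arr 5 (e * (n + 1) + hd e') ≠ 0 := by
                intro s' h1 h2 e' he'
                rcases Nat.lt_succ_iff_lt_or_eq.1 he' with h | rfl
                exacts [h1 e' h, h2]
              apply Run.of_le
              · apply run_ite
                · simp [Expr.Ok, Expr.eval, e9', hi₃, g₃.tl_eq]; omega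
                · intro hc
                  simp only [Expr.eval, BinOp.eval, e9', hi₃, g₃.tl_eq] at hc
                  have hb := (hS₃.2 _ (by omega) hc).1
                  apply run_ite
                  · simp [Expr.Ok]
                  · intro hc'
                    have hc' : hd e₂ = tl e := by
                      simpa [Expr.eval, BinOp.eval, hi₃, g₃.tl_eq, g₃.hd_eq, e5'] using hc'
                    apply run_skip
                    exact ⟨hS₃, hR₃, hlast _ hE₃ fun _ h => absurd hc' h⟩
                  · intro hc'
                    have hc' : hd e₂ ≠ tl e := by
                      simpa [Expr.eval, BinOp.eval, hi₃, g₃.tl_eq, g₃.hd_eq, e5'] using hc'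
                    apply run_put
                    · simp [Expr.Ok, Expr.eval, e9', hi₃, g₃.hd_eq]; omega
                    · simpa [Expr.Ok] using hs₃.one_lt
                    simp only [Expr.eval, BinOp.eval, e9', hi₃, g₃.hd_eq]
                    refine ⟨hmark e _ _ (by omega) hS₃ ?_, fun v hv => hkeep _ _ _ (hR₃ v hv),
                      hlast _ (fun e' he' h1 h2 => hkeep _ _ _ (hE₃ e' he' h1 h2)) fun _ _ => ?_⟩
                    · obtain rfl | ⟨d, rfl⟩ := T.cases he₂
                      · rw [T.tl_zero] at hb; exact absurd hb.lt (lt_irrefl n)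
                      · rw [T.tl_succ] at hb
                        rw [T.hd_succ] at hc' ⊢
                        exact Reach.step hb d.adj hc'
                    · simp
                · intro hc
                  simp only [Expr.eval, BinOp.eval, e9', hi₃, g₃.tl_eq] at hc
                  apply run_skip
                  exact ⟨hS₃, hR₃, hlast _ hE₃ fun h => absurd hc (hR₃ _ h)⟩
              · simp [Expr.time]
            · intro s₃ hs₃ hf₃ ⟨hS₃, hR₃, hE₃⟩
              refine ⟨hS₃, fun v hv => ?_⟩
              -- The last step of a walk of length at most `i + 1` is an edge of the table, and this
              -- round relaxed it after its tail had been marked.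
              rcases hv.cases with rfl | ⟨u, v', rfl, hu, hadj, hne⟩
              · exact hR₃ _ ⟨hhd, hhd, .nil, fun z hz => by
                  obtain ⟨_, _, p, hp, _⟩ := hv
                  exact hp z (List.mem_singleton.1 hz ▸ p.start_mem_support), Nat.zero_le _⟩
              · have h1 := T.tl_succ ⟨(u, v'), hadj⟩
                have h2 := T.hd_succ ⟨(u, v'), hadj⟩
                have := hE₃ _ (Nat.succ_lt_succ (T.equiv ⟨(u, v'), hadj⟩).2) (h1 ▸ hu) (h2 ▸ hne)
                exact h2 ▸ this
          · simp [Expr.time]; omega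
        · intro s₂ hs₂ hf₂ ⟨⟨h1, h2⟩, h3⟩ e' he' v hv
          by_cases hee : e' = e
          · subst hee
            by_cases hb : Behind S tl hd e' v
            · rw [(h2 v hv (h3 v (Reach.reachIn hb))).2, ind_of ⟨Nat.lt_succ_self _, hb⟩]
            · rw [ind_of_not fun h => hb h.2]
              by_contra h'
              exact hb (h2 v hv h').1
          · rw [h1 e' he' hee v hv]
            congr 2
            simp only [eq_iff_iff]; omega
      · simp [Expr.time]; ring_nf; omega
    · intro s₁ _ _ hInv e he v hv
      rw [hInv e he v hv]
      simp [he]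
  · simp [Expr.time]; ring_nf; omega

/-! ### The tables of the dynamic program -/

theorem digit_def (K I j : ℕ) : I / K ^ j % K = digit K I j := rfl

theorem ind_forall_lt_succ {p : ℕ → Prop} {j : ℕ} (h : p j) :
    ind (∀ i < j + 1, p i) = ind (∀ i < j, p i) := by
  rw [Nat.forall_lt_succ_right, and_iff_left h]

theorem ind_forall_lt_succ_of_not {p : ℕ → Prop} {j : ℕ} (h : ¬ p j) :
    ind (∀ i < j + 1, p i) = 0 :=
  ind_of_not fun h' => h (h' j (Nat.lt_succ_self j))

/-- All numbers that are computed fit into a word. -/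
structure Big (B n E k m : ℕ) : Prop where
  nodes : ((E + 1) ^ k + 1) * (n + 1) < B
  darts : ((E + 1) ^ k + 1) * (E + 1) < B
  sides : (E + 1) * (n + 1) < B
  value : (E + 2) * (2 * n * m + 1) + m < B
  slots : k < B

/-- Compute an upper bound for all costs and the number of subproblems. -/
def initProg (k : ℕ) : Cmd :=
  10 ::= .lit 0 ;;
  forLoop 6 (#0) (10 ::= #10 +ₑ .get 1 (#6)) ;;
  3 ::= (.lit 2 *ₑ #0) *ₑ #10 +ₑ .lit 1 ;;
  4 ::= .lit 1 ;;
  forLoop 6 (.lit k) (4 ::= #4 *ₑ #2)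

theorem run_initProg {B n E k m : ℕ} (hn : 0 < n) {cnt tl hd : ℕ → ℕ} {s : State}
    (h : HasEdges n E cnt tl hd s) (hm : ∑ x ∈ Finset.range n, cnt x = m) (hB : Big B n E k m) :
    Run B (initProg k) s (n * 20 + k * 20 + 50) fun s' =>
      s'.var 3 = 2 * n * m + 1 ∧ s'.var 4 = (E + 1) ^ k := by
  have hP : 0 < (E + 1) ^ k := pow_pos (Nat.succ_pos E) k
  have hval := hB.value
  have hnm : (2 * n * m + 1) ≤ (E + 2) * (2 * n * m + 1) := Nat.le_mul_of_pos_left _ (by omega)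
  have h2n : 2 * n < B := by
    have h1 := hB.nodes
    have h2 := Nat.mul_le_mul_right (n + 1) (show 2 ≤ (E + 1) ^ k + 1 by omega)
    omega
  unfold initProg
  apply Run.of_le
  · apply run_seq
    apply run_set
    · simp [Expr.Ok]; omega
    apply run_seq
    apply run_for_const n 10 (fun i s' => s'.var 10 = ∑ x ∈ Finset.range i, cnt x)
    · decide
    · intro s' hf
      simp [Expr.eval, hf.var 0 (by decide), Expr.Ok, h.var_n]
    · intro i s' v h
      simpa using h
    · simp [Expr.eval]
    · intro i hi s' hs' hf hi' hI
      have g := (h.setVar (by decide)).frame hf (by decide) (by decide)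
      have hsum : ∑ x ∈ Finset.range (i + 1), cnt x ≤ m :=
        hm ▸ Finset.sum_le_sum_of_subset (Finset.range_mono hi)
      rw [Finset.sum_range_succ] at hsum
      apply Run.of_le
      · apply run_set
        · simp [Expr.Ok, Expr.eval, hI, hi', g.cnt_eq]; omega
        simp [Expr.eval, BinOp.eval, hI, hi', g.cnt_eq, Finset.sum_range_succ]
      · simp [Expr.time]
    · intro s' hs' hf hI
      have g := (h.setVar (by decide)).frame hf (by decide) (by decide)
      rw [hm] at hI
      apply run_seq
      apply run_set
      · simp [Expr.Ok, Expr.eval, BinOp.eval, hI, g.var_n]; omega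
      apply run_seq
      apply run_set
      · simpa [Expr.Ok] using hs'.one_lt
      apply run_for_const k 10 (fun i s' => s'.var 4 = (E + 1) ^ i)
      · decide
      · intro s₂ hf
        simp [Expr.eval, Expr.Ok, hB.slots]
      · intro i s₂ v h
        simpa using h
      · simp [Expr.eval]
      · intro i hi s₂ hs₂ hf₂ hi₂ hI₂
        have g₂ := ((g.setVar (by decide)).setVar (by decide)).frame hf₂ (by decide) (by decide)
        have hpow : (E + 1) ^ (i + 1) ≤ (E + 1) ^ k := Nat.pow_le_pow_right (Nat.succ_pos E) hi
        have hk := hB.nodes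
        have hk' := Nat.le_mul_of_pos_right ((E + 1) ^ k + 1) (show 0 < n + 1 by omega)
        rw [pow_succ] at hpow
        apply Run.of_le
        · apply run_set
          · simp [Expr.Ok, Expr.eval, hI₂, g₂.var_K]; omega
          simp [Expr.eval, BinOp.eval, hI₂, g₂.var_K, pow_succ]
        · simp [Expr.time]
      · intro s₂ hs₂ hf₂ hI₂
        refine ⟨?_, hI₂⟩
        simp [hf₂.var 3 (by decide), Expr.eval, BinOp.eval, hI, g.var_n]
  · simp [Expr.time]; omega

/-- The memory before the tables of the dynamic program are computed. -/
structure Ready {n : ℕ} (S : SimpleGraph (Fin n)) (E k m : ℕ) (cnt tl hd : ℕ → ℕ) (s : State) : Prop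
    extends HasEdges n E cnt tl hd s where
  sides : HasSides S E tl hd s
  var_top : s.var 3 = 2 * n * m + 1
  var_P : s.var 4 = (E + 1) ^ k

section

variable {n : ℕ} {S : SimpleGraph (Fin n)} {B E k m : ℕ} {cnt tl hd : ℕ → ℕ} {s : State}

theorem Ready.frame {s' : State} {vs as : List ℕ} (h : Ready S E k m cnt tl hd s)
    (hf : Frame vs as s s') (hv : ∀ x ∈ [0, 2, 3, 4], x ∉ vs) (ha : ∀ a ∈ [1, 3, 4, 5], a ∉ as) :
    Ready S E k m cnt tl hd s' := by
  simp only [List.mem_cons, List.not_mem_nil, or_false, forall_eq_or_imp, forall_eq] at hv ha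
  refine ⟨h.toHasEdges.frame hf ?_ ?_, ?_, (hf.var 3 hv.2.2.1).trans h.var_top,
    (hf.var 4 hv.2.2.2).trans h.var_P⟩
  · simp [hv]
  · simp [ha]
  · intro e he v hv
    rw [hf.arr 5 ha.2.2.2, h.sides e he v hv]

theorem Ready.setVar {x v : ℕ} (h : Ready S E k m cnt tl hd s) (hx : 4 < x) :
    Ready S E k m cnt tl hd (s.setVar x v) :=
  h.frame (.setVar (vs := [x]) (as := []) _ _ _ (by simp))
    (by intro y hy; simp at hy ⊢; omega) (by simp)

theorem Ready.setArr {a i v : ℕ} (h : Ready S E k m cnt tl hd s) (ha : 5 < a) :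
    Ready S E k m cnt tl hd (s.setArr a i v) :=
  h.frame (.setArr (vs := []) (as := [a]) _ _ _ _ (by simp))
    (by simp) (by intro y hy; simp at hy ⊢; omega)

/-- Does the node in variable `6` belong to the subproblem in variable `5`? -/
def memberProg (k : ℕ) : Cmd :=
  12 ::= .lit 1 ;;
  13 ::= .lit 1 ;;
  forLoop 7 (.lit k) (
    .ite (.get 5 ((#5 /ₑ #13 %ₑ #2) *ₑ (#0 +ₑ .lit 1) +ₑ #6)) .skip (12 ::= .lit 0) ;;
    13 ::= #13 *ₑ #2)

theorem Big.pow_lt (hB : Big B n E k m) {j : ℕ} (hj : j ≤ k) : (E + 1) ^ j < B := by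
  have hpow : (E + 1) ^ j ≤ (E + 1) ^ k := Nat.pow_le_pow_right (Nat.succ_pos E) hj
  have hk := hB.nodes
  have hk' := Nat.le_mul_of_pos_right ((E + 1) ^ k + 1) (show 0 < n + 1 by omega)
  omega

theorem Big.succ_lt (hB : Big B n E k m) : n + 1 < B := by
  have h1 := Nat.le_mul_of_pos_left (n + 1) (show 0 < E + 1 by omega)
  have h2 := hB.sides
  omega

theorem inNodes_iff_forall {I x : ℕ} (hx : x < n) : InNodes S (E + 1) k tl hd I x ↔
    ∀ j < k, Behind S tl hd (digit (E + 1) I j) x := by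
  have := inNodes_iff (S := S) (K := E + 1) (k := k) (tl := tl) (hd := hd) (I := I) (x := ⟨x, hx⟩)
  rw [EdgeTable.mem_nodesOf] at this
  exact this

theorem run_memberProg (hB : Big B n E k m) (h : Ready S E k m cnt tl hd s) {I x : ℕ}
    (h5 : s.var 5 = I) (h6 : s.var 6 = x) (hx : x < n) :
    Run B (memberProg k) s (k * 50 + 20) fun s' =>
      s'.var 12 = ind (InNodes S (E + 1) k tl hd I x) := by
  unfold memberProg
  have hn := hB.succ_lt
  apply Run.of_le
  · apply run_seq
    apply run_set
    · simp [Expr.Ok]; omega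
    apply run_seq
    apply run_set
    · simp [Expr.Ok]; omega
    apply run_for_const k 40 (fun j s' => s'.var 13 = (E + 1) ^ j ∧
      s'.var 12 = ind (∀ i < j, Behind S tl hd (digit (E + 1) I i) x))
    · decide
    · intro s₂ hf
      simp [Expr.eval, Expr.Ok, hB.slots]
    · intro i s₂ v h
      simpa using h
    · simp [Expr.eval, ind]
    · intro j hj s₁ hs₁ hf₁ hj₁ ⟨h13, h12⟩
      have g := ((h.setVar (by decide)).setVar (by decide)).frame hf₁ (by decide) (by decide)
      have e5 : s₁.var 5 = I := by simp [hf₁.var 5 (by decide), h5]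
      have e6 : s₁.var 6 = x := by simp [hf₁.var 6 (by decide), h6]
      have hdig := digit_lt (show 0 < E + 1 by omega) I j
      have hrow := mul_add_lt hdig (show x < n + 1 by omega)
      have hside := g.sides _ hdig x (by omega)
      have hbig := hB.sides
      have hpow := hB.pow_lt (show j + 1 ≤ k by omega)
      rw [pow_succ] at hpow
      rw [digit] at hrow
      apply Run.of_le
      · apply run_seq
        apply run_ite
        · simp [Expr.Ok, Expr.eval, BinOp.eval, e5, e6, h13, g.var_n, g.var_K]; omega
        · intro hc
          have hc : Behind S tl hd (digit (E + 1) I j) x := by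
            simpa [Expr.eval, BinOp.eval, e5, e6, h13, g.var_n, g.var_K, digit_def, hside] using hc
          apply run_skip
          apply run_set
          · simp [Expr.Ok, Expr.eval, h13, g.var_K]; omega
          rw [ind_forall_lt_succ (p := fun i => Behind S tl hd (digit (E + 1) I i) x) hc]
          simp [Expr.eval, BinOp.eval, h13, g.var_K, pow_succ, h12]
        · intro hc
          have hc : ¬ Behind S tl hd (digit (E + 1) I j) x := by
            simpa [Expr.eval, BinOp.eval, e5, e6, h13, g.var_n, g.var_K, digit_def, hside] using hc
          apply run_set
          · simp [Expr.Ok]; omega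
          apply run_set
          · simp [Expr.Ok, Expr.eval, h13, g.var_K]; omega
          rw [ind_forall_lt_succ_of_not (p := fun i => Behind S tl hd (digit (E + 1) I i) x) hc]
          simp [Expr.eval, BinOp.eval, h13, g.var_K, pow_succ]
      · simp [Expr.time]
    · intro s₁ hs₁ hf₁ ⟨h13, h12⟩
      rw [h12, inNodes_iff_forall hx]
  · simp [Expr.time]; omega

/-- The child of the subproblem in variable `5` behind the edge in variable `6`. -/
def childProg (k : ℕ) : Cmd :=
  12 ::= .lit 0 ;;
  13 ::= .lit 1 ;;
  14 ::= .lit 0 ;;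
  forLoop 7 (.lit k) (
    15 ::= #5 /ₑ #13 %ₑ #2 ;;
    .ite (.get 5 (#6 *ₑ (#0 +ₑ .lit 1) +ₑ .get 3 (#15)))
      (14 ::= #14 +ₑ #15 *ₑ #13)
      (.ite (#12) .skip (14 ::= #14 +ₑ #6 *ₑ #13 ;; 12 ::= .lit 1)) ;;
    13 ::= #13 *ₑ #2) ;;
  .ite (#12) .skip (14 ::= #4)

open Classical in
theorem run_childProg (hB : Big B n E k m) (h : Ready S E k m cnt tl hd s)
    (T : EdgeTable S E tl hd) {I e : ℕ} (h5 : s.var 5 = I) (h6 : s.var 6 = e) (he : e < E + 1) :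
    Run B (childProg k) s (k * 80 + 40) fun s' =>
      s'.var 14 = childOf S (E + 1) k tl hd I e := by
  unfold childProg
  have hn := hB.succ_lt
  let keep : ℕ → Prop := fun d => Behind S tl hd e (tl d)
  apply Run.of_le
  · apply run_seq
    apply run_set
    · simp [Expr.Ok]; omega
    apply run_seq
    apply run_set
    · simp [Expr.Ok]; omega
    apply run_seq
    apply run_set
    · simp [Expr.Ok]; omega
    apply run_seq
    apply run_for_const k 65 (fun j s' => s'.var 13 = (E + 1) ^ j ∧
      s'.var 12 = ind (∃ i < j, ¬ keep (digit (E + 1) I i)) ∧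
      s'.var 14 = ∑ i ∈ Finset.range j, newDigit (E + 1) keep I e i * (E + 1) ^ i)
    · decide
    · intro s₂ hf
      simp [Expr.eval, Expr.Ok, hB.slots]
    · intro i s₂ v h
      simpa using h
    · simp [Expr.eval, ind]
    · intro j hj s₁ hs₁ hf₁ hj₁ ⟨h13, h12, h14⟩
      have g := (((h.setVar (by decide)).setVar (by decide)).setVar (by decide)).frame hf₁
        (by decide) (by decide)
      have e5 : s₁.var 5 = I := by simp [hf₁.var 5 (by decide), h5]
      have e6 : s₁.var 6 = e := by simp [hf₁.var 6 (by decide), h6]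
      have hdig := digit_lt (show 0 < E + 1 by omega) I j
      have htl := T.tl_le hdig
      have hrow := mul_add_lt he (show tl (digit (E + 1) I j) < n + 1 by omega)
      have hside := g.sides _ he (tl (digit (E + 1) I j)) (by omega)
      have hbig := hB.sides
      have hpow := hB.pow_lt (show j + 1 ≤ k by omega)
      -- A number with `j + 1` digits is below `(E + 1) ^ (j + 1)`, so the partial sums fit into a
      -- word.
      have hsum : ∑ i ∈ Finset.range (j + 1), newDigit (E + 1) keep I e i * (E + 1) ^ i < B :=
        (sum_mul_pow_lt fun i _ => newDigit_lt (Nat.succ_pos E) he i).trans hpow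
      rw [Finset.sum_range_succ] at hsum
      rw [pow_succ] at hpow
      apply Run.of_le
      · apply run_seq
        apply run_set
        · simp [Expr.Ok]
        apply run_seq
        apply run_ite
        · simp [Expr.Ok, Expr.eval, BinOp.eval, e5, e6, h13, g.var_n, g.var_K, digit_def, g.tl_eq]
          omega
        · intro hc
          have hc : keep (digit (E + 1) I j) := by
            simpa [Expr.eval, BinOp.eval, e5, e6, h13, g.var_n, g.var_K, digit_def, g.tl_eq, hside]
              using hc
          have hnew : newDigit (E + 1) keep I e j = digit (E + 1) I j := if_pos hc
          rw [hnew] at hsum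
          apply run_set
          · simp [Expr.Ok, Expr.eval, BinOp.eval, e5, h13, g.var_K, digit_def, h14]; omega
          apply run_set
          · simp [Expr.Ok, Expr.eval, h13, g.var_K]; omega
          have hex : (∃ i < j + 1, ¬ keep (digit (E + 1) I i)) ↔
              ∃ i < j, ¬ keep (digit (E + 1) I i) := by
            rw [Nat.exists_lt_succ_right, or_iff_left (not_not.2 hc)]
          rw [hex, Finset.sum_range_succ, hnew]
          simp [Expr.eval, BinOp.eval, h13, g.var_K, pow_succ, h12, h14, e5, digit_def]
        · intro hc
          have hc : ¬ keep (digit (E + 1) I j) := by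
            simpa [Expr.eval, BinOp.eval, e5, e6, h13, g.var_n, g.var_K, digit_def, g.tl_eq, hside]
              using hc
          have hex : ind (∃ i < j + 1, ¬ keep (digit (E + 1) I i)) = 1 :=
            ind_of ⟨j, Nat.lt_succ_self j, hc⟩
          rw [hex]
          apply run_ite
          · simp [Expr.Ok]
          · intro hc'
            have hc' : ∃ i < j, ¬ keep (digit (E + 1) I i) := by
              by_contra hne
              exact hc' (by simpa [Expr.eval, ind_of_not hne] using h12)
            have hnew : newDigit (E + 1) keep I e j = 0 := by
              rw [newDigit, if_neg hc, if_pos hc']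
            apply run_skip
            apply run_set
            · simp [Expr.Ok, Expr.eval, h13, g.var_K]; omega
            rw [Finset.sum_range_succ, hnew]
            rw [ind_of hc'] at h12
            simp [Expr.eval, BinOp.eval, h13, g.var_K, pow_succ, h12, h14]
          · intro hc'
            have hc' : ¬ ∃ i < j, ¬ keep (digit (E + 1) I i) := by
              intro hne
              rw [ind_of hne] at h12
              simp [Expr.eval, h12] at hc'
            have hnew : newDigit (E + 1) keep I e j = e := by
              rw [newDigit, if_neg hc, if_neg hc']
            rw [hnew] at hsum
            apply run_seq
            apply run_set
            · simp [Expr.Ok, Expr.eval, BinOp.eval, e6, h13, h14]; omega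
            apply run_set
            · simp [Expr.Ok]; omega
            apply run_set
            · simp [Expr.Ok, Expr.eval, h13, g.var_K]; omega
            rw [Finset.sum_range_succ, hnew]
            simp [Expr.eval, BinOp.eval, h13, g.var_K, pow_succ, h14, e6]
      · simp [Expr.time]
    · intro s₁ hs₁ hf₁ ⟨h13, h12, h14⟩
      have g := (((h.setVar (by decide)).setVar (by decide)).setVar (by decide)).frame hf₁
        (by decide) (by decide)
      rw [childOf, replaceDigits]
      by_cases hex : ∃ i < k, ¬ keep (digit (E + 1) I i)
      · rw [ind_of hex] at h12
        rw [if_pos hex]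
        apply run_ite
        · simp [Expr.Ok]
        · intro _
          apply run_skip
          exact h14
        · intro hc
          simp [Expr.eval, h12] at hc
      · rw [ind_of_not hex] at h12
        rw [if_neg hex]
        apply run_ite
        · simp [Expr.Ok]
        · intro hc
          simp [Expr.eval, h12] at hc
        · intro _
          apply run_set
          · simp [Expr.Ok]
          · simp [Expr.eval, g.var_P]
  · simp [Expr.time]; omega

end

/-! ### Nodes, sizes, weights and children of all subproblems -/

section

variable {n : ℕ} {S : SimpleGraph (Fin n)} {B E k m : ℕ} {cnt tl hd : ℕ → ℕ} {s : State}

theorem sum_ind_mul (w : ℕ → ℕ) (I : ℕ) :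
    ∑ x ∈ Finset.range n, ind (InNodes S (E + 1) k tl hd I x) * w x =
      ∑ x ∈ nodesOf S (E + 1) k tl hd I, w x := by
  rw [Finset.sum_range, ← Finset.sum_subset (Finset.subset_univ (nodesOf S (E + 1) k tl hd I))]
  · exact Finset.sum_congr rfl fun x hx => by rw [ind_of (inNodes_iff.2 hx), one_mul]
  · intro x _ hx
    rw [ind_of_not (fun h => hx (inNodes_iff.1 h)), zero_mul]

/-- Compute the nodes of the subproblem in variable `5`, their number and their weight. -/
def nodesProg (k : ℕ) : Cmd :=
  9 ::= #5 *ₑ (#0 +ₑ .lit 1) ;;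
  10 ::= .lit 0 ;;
  11 ::= .lit 0 ;;
  forLoop 6 (#0) (
    memberProg k ;;
    .put 6 (#9 +ₑ #6) (#12) ;;
    10 ::= #10 +ₑ #12 ;;
    11 ::= #11 +ₑ #12 *ₑ .get 1 (#6))

/-- Only the first `n` cells of row `I` change. Column `n` stays zero, which makes it safe to test
membership of the tail `n` of the imaginary edge later. -/
theorem run_nodesProg (hB : Big B n E k m) (h : Ready S E k m cnt tl hd s)
    (hm : ∑ x ∈ Finset.range n, cnt x = m) {I : ℕ} (h5 : s.var 5 = I) (hI : I < (E + 1) ^ k) :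
    Run B (nodesProg k) s (n * (k * 50 + 60) + 30) fun s' =>
      (∀ v < n, s'.arr 6 (I * (n + 1) + v) = ind (InNodes S (E + 1) k tl hd I v)) ∧
      (∀ c, (∀ v < n, c ≠ I * (n + 1) + v) → s'.arr 6 c = s.arr 6 c) ∧
      s'.var 10 = (nodesOf S (E + 1) k tl hd I).card ∧
      s'.var 11 = ∑ x ∈ nodesOf S (E + 1) k tl hd I, cnt x := by
  unfold nodesProg
  have hn := hB.succ_lt
  have hnodes := hB.nodes
  rw [Nat.succ_mul] at hnodes
  have hmB := hB.value
  apply Run.of_le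
  · apply run_seq
    apply run_set
    · have := mul_add_lt hI (show 0 < n + 1 by omega)
      simp [Expr.Ok, Expr.eval, BinOp.eval, h5, h.var_n]; omega
    apply run_seq
    apply run_set
    · simp [Expr.Ok]; omega
    apply run_seq
    apply run_set
    · simp [Expr.Ok]; omega
    apply run_for_const n (k * 50 + 50) (fun x s' =>
      (∀ v < x, s'.arr 6 (I * (n + 1) + v) = ind (InNodes S (E + 1) k tl hd I v)) ∧
      (∀ c, (∀ v < n, c ≠ I * (n + 1) + v) → s'.arr 6 c = s.arr 6 c) ∧
      s'.var 10 = ∑ y ∈ Finset.range x, ind (InNodes S (E + 1) k tl hd I y) * 1 ∧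
      s'.var 11 = ∑ y ∈ Finset.range x, ind (InNodes S (E + 1) k tl hd I y) * cnt y)
    · exact of_decide_eq_true rfl
    · intro s' hf
      simp [Expr.eval, hf.var 0 (of_decide_eq_true rfl), Expr.Ok, h.var_n]
    · intro i s' v h
      simpa using h
    · simp [Expr.eval]
    · intro x hx s₁ hs₁ hf₁ hx₁ ⟨i1, i2, i3, i4⟩
      have g := (((h.setVar (by decide)).setVar (by decide)).setVar (by decide)).frame hf₁
        (of_decide_eq_true rfl) (of_decide_eq_true rfl)
      have e5 : s₁.var 5 = I := by simp [hf₁.var 5 (of_decide_eq_true rfl), h5]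
      have e9 : s₁.var 9 = I * (n + 1) := by
        simp [hf₁.var 9 (of_decide_eq_true rfl), Expr.eval, BinOp.eval, h5, h.var_n]
      have hrow := mul_add_lt hI (show x < n + 1 by omega)
      have hle := ind_le_one (InNodes S (E + 1) k tl hd I x)
      have hc1 : ∑ y ∈ Finset.range (x + 1), ind (InNodes S (E + 1) k tl hd I y) * 1 ≤ x + 1 :=
        (Finset.sum_le_sum fun y _ => Nat.mul_le_mul_right 1 (ind_le_one _)).trans_eq (by simp)
      have hc2 : ∑ y ∈ Finset.range (x + 1), ind (InNodes S (E + 1) k tl hd I y) * cnt y ≤ m :=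
        hm ▸ (Finset.sum_le_sum fun y _ => Nat.mul_le_mul_right _ (ind_le_one _)).trans
          ((Finset.sum_le_sum_of_subset (Finset.range_mono hx)).trans_eq (by simp))
      rw [Finset.sum_range_succ] at hc1 hc2
      simp only [mul_one] at hc1 i3
      apply Run.of_le
      · apply run_seq
        apply (run_memberProg hB g e5 hx₁ hx).mono
        intro s₂ hs₂ hf₂ h12
        have g₂ := g.frame hf₂ (of_decide_eq_true rfl) (of_decide_eq_true rfl)
        have e6' : s₂.var 6 = x := by simp [hf₂.var 6 (of_decide_eq_true rfl), hx₁]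
        have e9' : s₂.var 9 = I * (n + 1) := by simp [hf₂.var 9 (of_decide_eq_true rfl), e9]
        have e10' : s₂.var 10 = s₁.var 10 := by simp [hf₂.var 10 (of_decide_eq_true rfl)]
        have e11' : s₂.var 11 = s₁.var 11 := by simp [hf₂.var 11 (of_decide_eq_true rfl)]
        have a6' : s₂.arr 6 = s₁.arr 6 := by simp [hf₂.arr 6 (of_decide_eq_true rfl)]
        apply run_seq
        apply run_put
        · simp [Expr.Ok, Expr.eval, e9', e6']; omega
        · simp [Expr.Ok]
        apply run_seq
        apply run_set
        · simp [Expr.Ok, Expr.eval, e10', h12, i3]; omega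
        apply run_set
        · simp [Expr.Ok, Expr.eval, BinOp.eval, e11', h12, e6', g₂.cnt_eq, i4]; omega
        refine ⟨fun v hv => ?_, fun c hc => ?_, ?_, ?_⟩
        · rcases Nat.lt_succ_iff_lt_or_eq.1 hv with hv | rfl
          · simp [Expr.eval, BinOp.eval, e9', e6', hv.ne, a6', i1 v hv]
          · simp [Expr.eval, BinOp.eval, e9', e6', h12]
        · simp [Expr.eval, BinOp.eval, e9', e6', hc x hx, a6', i2 c hc]
        · simp [Expr.eval, BinOp.eval, Finset.sum_range_succ, e10', h12, i3]
        · simp [Expr.eval, BinOp.eval, Finset.sum_range_succ, e11', h12, e6', g₂.cnt_eq, i4]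
      · simp [Expr.time]
    · intro s₁ hs₁ hf₁ ⟨i1, i2, i3, i4⟩
      refine ⟨i1, i2, ?_, ?_⟩
      · rw [i3, sum_ind_mul fun _ => 1, Finset.card_eq_sum_ones]
      · rw [i4, sum_ind_mul]
  · simp [Expr.time]; ring_nf; omega

/-- Compute the children of the subproblem in variable `5`. -/
def childrenProg (k : ℕ) : Cmd :=
  9 ::= #5 *ₑ #2 ;;
  forLoop 6 (#2) (
    childProg k ;;
    .put 7 (#9 +ₑ #6) (#14))

theorem run_childrenProg (hB : Big B n E k m) (h : Ready S E k m cnt tl hd s)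
    (T : EdgeTable S E tl hd) {I : ℕ} (h5 : s.var 5 = I) (hI : I < (E + 1) ^ k) :
    Run B (childrenProg k) s ((E + 1) * (k * 80 + 70) + 20) fun s' =>
      (∀ e < E + 1, s'.arr 7 (I * (E + 1) + e) = childOf S (E + 1) k tl hd I e) ∧
      (∀ c, (∀ e < E + 1, c ≠ I * (E + 1) + e) → s'.arr 7 c = s.arr 7 c) := by
  unfold childrenProg
  have hdarts := hB.darts
  rw [Nat.succ_mul] at hdarts
  apply Run.of_le
  · apply run_seq
    apply run_set
    · have := mul_add_lt hI (show 0 < E + 1 by omega)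
      simp [Expr.Ok, Expr.eval, h5, h.var_K]; omega
    apply run_for_const (E + 1) (k * 80 + 60) (fun e s' =>
      (∀ v < e, s'.arr 7 (I * (E + 1) + v) = childOf S (E + 1) k tl hd I v) ∧
      (∀ c, (∀ v < E + 1, c ≠ I * (E + 1) + v) → s'.arr 7 c = s.arr 7 c))
    · exact of_decide_eq_true rfl
    · intro s' hf
      simp [Expr.eval, hf.var 2 (of_decide_eq_true rfl), Expr.Ok, h.var_K]
    · intro i s' v h
      simpa using h
    · simp
    · intro e he s₁ hs₁ hf₁ he₁ ⟨i1, i2⟩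
      have g := (h.setVar (by decide)).frame hf₁ (of_decide_eq_true rfl) (of_decide_eq_true rfl)
      have e5 : s₁.var 5 = I := by simp [hf₁.var 5 (of_decide_eq_true rfl), h5]
      have e9 : s₁.var 9 = I * (E + 1) := by
        simp [hf₁.var 9 (of_decide_eq_true rfl), Expr.eval, BinOp.eval, h5, h.var_K]
      have hrow := mul_add_lt hI he
      apply Run.of_le
      · apply run_seq
        apply (run_childProg hB g T e5 he₁ he).mono
        intro s₂ hs₂ hf₂ h14
        have e6' : s₂.var 6 = e := by simp [hf₂.var 6 (of_decide_eq_true rfl), he₁]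
        have e9' : s₂.var 9 = I * (E + 1) := by simp [hf₂.var 9 (of_decide_eq_true rfl), e9]
        have a7' : s₂.arr 7 = s₁.arr 7 := by simp [hf₂.arr 7 (of_decide_eq_true rfl)]
        apply run_put
        · simp [Expr.Ok, Expr.eval, e9', e6']; omega
        · simp [Expr.Ok]
        refine ⟨fun v hv => ?_, fun c hc => ?_⟩
        · rcases Nat.lt_succ_iff_lt_or_eq.1 hv with hv | rfl
          · simp [Expr.eval, BinOp.eval, e9', e6', hv.ne, a7', i1 v hv]
          · simp [Expr.eval, BinOp.eval, e9', e6', h14]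
        · simp [Expr.eval, BinOp.eval, e9', e6', hc e he, a7', i2 c hc]
      · simp [Expr.time]
    · intro s₁ hs₁ hf₁ h₁
      exact h₁
  · simp [Expr.time]; ring_nf; omega

/-- Compute the nodes and the children of all subproblems. -/
def tablesProg (k : ℕ) : Cmd :=
  forLoop 5 (#4) (
    nodesProg k ;;
    .put 8 (#5) (#10) ;;
    .put 9 (#5) (#11) ;;
    childrenProg k)

/-- The memory after the nodes and the children of all subproblems have been computed. -/
structure HasTables (S : SimpleGraph (Fin n)) (E k m : ℕ) (cnt tl hd : ℕ → ℕ) (s : State) : Prop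
    extends Ready S E k m cnt tl hd s where
  nodes : ∀ I < (E + 1) ^ k, ∀ v < n + 1,
    s.arr 6 (I * (n + 1) + v) = ind (InNodes S (E + 1) k tl hd I v)
  child : ∀ I < (E + 1) ^ k, ∀ e < E + 1,
    s.arr 7 (I * (E + 1) + e) = childOf S (E + 1) k tl hd I e
  child_le : ∀ i, s.arr 7 i ≤ (E + 1) ^ k
  size : ∀ I < (E + 1) ^ k, s.arr 8 I = (nodesOf S (E + 1) k tl hd I).card
  weight : ∀ I < (E + 1) ^ k, s.arr 9 I = ∑ x ∈ nodesOf S (E + 1) k tl hd I, cnt x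

theorem run_tablesProg (hB : Big B n E k m) (h : Ready S E k m cnt tl hd s)
    (T : EdgeTable S E tl hd) (hm : ∑ x ∈ Finset.range n, cnt x = m)
    (h6 : ∀ i, s.arr 6 i = 0) (h7 : ∀ i, s.arr 7 i = 0) :
    Run B (tablesProg k) s
      ((E + 1) ^ k * (n * (k * 50 + 60) + (E + 1) * (k * 80 + 70) + 80) + 10)
      (HasTables S E k m cnt tl hd) := by
  unfold tablesProg
  apply Run.of_le
  · apply run_for_const ((E + 1) ^ k) (n * (k * 50 + 60) + (E + 1) * (k * 80 + 70) + 60)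
      -- The conjunct `I' < I` says that rows not yet processed are zero. The bound on array `7`
      -- covers all cells, including those never written.
      (fun I s' =>
        (∀ I' < (E + 1) ^ k, ∀ v < n + 1, s'.arr 6 (I' * (n + 1) + v) =
          ind (I' < I ∧ InNodes S (E + 1) k tl hd I' v)) ∧
        (∀ I' < I, ∀ e < E + 1,
          s'.arr 7 (I' * (E + 1) + e) = childOf S (E + 1) k tl hd I' e) ∧
        (∀ i, s'.arr 7 i ≤ (E + 1) ^ k) ∧
        (∀ I' < I, s'.arr 8 I' = (nodesOf S (E + 1) k tl hd I').card) ∧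
        ∀ I' < I, s'.arr 9 I' = ∑ x ∈ nodesOf S (E + 1) k tl hd I', cnt x)
    · exact of_decide_eq_true rfl
    · intro s' hf
      simp [Expr.eval, hf.var 4 (of_decide_eq_true rfl), Expr.Ok, h.var_P]
    · intro i s' v h
      simpa using h
    · simp [h6, h7, ind]
    · intro I hI s₁ hs₁ hf₁ hI₁ ⟨i1, i2, i3, i4, i5⟩
      have g := h.frame hf₁ (of_decide_eq_true rfl) (of_decide_eq_true rfl)
      apply Run.of_le
      · apply run_seq
        apply (run_nodesProg hB g hm hI₁ hI).mono
        intro s₂ hs₂ hf₂ ⟨j1, j2, j3, j4⟩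
        have g₂ := g.frame hf₂ (of_decide_eq_true rfl) (of_decide_eq_true rfl)
        have e5 : s₂.var 5 = I := by simp [hf₂.var 5 (of_decide_eq_true rfl), hI₁]
        have a7 : s₂.arr 7 = s₁.arr 7 := by simp [hf₂.arr 7 (of_decide_eq_true rfl)]
        have a8 : s₂.arr 8 = s₁.arr 8 := by simp [hf₂.arr 8 (of_decide_eq_true rfl)]
        have a9 : s₂.arr 9 = s₁.arr 9 := by simp [hf₂.arr 9 (of_decide_eq_true rfl)]
        apply run_seq
        apply run_put
        · simp [Expr.Ok]
        · simp [Expr.Ok]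
        apply run_seq
        apply run_put
        · simp [Expr.Ok]
        · simp [Expr.Ok]
        apply (run_childrenProg hB ((g₂.setArr (by decide)).setArr (by decide)) T
          (by simpa using e5) hI).mono
        intro s₃ hs₃ hf₃ ⟨l1, l2⟩
        have a6 : s₃.arr 6 = s₂.arr 6 := by simp [hf₃.arr 6 (of_decide_eq_true rfl)]
        have a8' : s₃.arr 8 = Function.update (s₁.arr 8) I (s₂.var 10) := by
          simp [hf₃.arr 8 (of_decide_eq_true rfl), Expr.eval, a8, e5]
        have a9' : s₃.arr 9 = Function.update (s₁.arr 9) I (s₂.var 11) := by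
          simp [hf₃.arr 9 (of_decide_eq_true rfl), Expr.eval, a9, e5]
        have hstep : ∀ {q : ℕ → Prop}, (∀ I' < I, q I') → q I → ∀ I' < I + 1, q I' := by
          intro q h1 h2 I' hI'
          rcases Nat.lt_succ_iff_lt_or_eq.1 hI' with h | rfl
          exacts [h1 I' h, h2]
        refine ⟨fun I' hI' v hv => ?_, hstep (fun I' hI' e he => ?_) l1, fun i => ?_,
          hstep (fun I' hI' => ?_) ?_, hstep (fun I' hI' => ?_) ?_⟩
        · rw [a6]
          by_cases hII : I' = I
          · subst hII
            rcases Nat.lt_succ_iff_lt_or_eq.1 hv with hv' | rfl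
            · rw [j1 v hv']
              simp
            · rw [j2 _ fun v' hv' => by rw [Ne, mul_add_inj hv (by omega)]; omega, i1 _ hI' _ hv,
                ind_of_not (fun h => lt_irrefl _ h.1),
                ind_of_not fun h => lt_irrefl _ h.2.1]
          · rw [j2 _ fun v' hv' => by rw [Ne, mul_add_inj hv (by omega)]; tauto, i1 _ hI' _ hv]
            congr 2
            rw [eq_iff_iff]; omega
        · rw [l2 _ fun v' hv' => by rw [Ne, mul_add_inj he hv']; omega]
          simpa [a7] using i2 I' hI' e he
        · by_cases hi : ∀ e < E + 1, i ≠ I * (E + 1) + e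
          · rw [l2 i hi]
            simpa [a7] using i3 i
          · push Not at hi
            obtain ⟨e, he, rfl⟩ := hi
            rw [l1 e he]
            exact EdgeTable.childOf_le he
        · simp [a8', hI'.ne, i4 I' hI']
        · simp [a8', j3]
        · simp [a9', hI'.ne, i5 I' hI']
        · simp [a9', j4]
      · simp [Expr.time]; ring_nf; omega
    · intro s₁ hs₁ hf₁ ⟨i1, i2, i3, i4, i5⟩
      refine ⟨h.frame hf₁ (of_decide_eq_true rfl) (of_decide_eq_true rfl), fun I hI v hv => ?_, i2, i3, i4, i5⟩
      rw [i1 I hI v hv]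
      simp [hI]
  · simp [Expr.time]; ring_nf; omega

end

/-! ### The dynamic program -/

section

variable {n : ℕ} {S : SimpleGraph (Fin n)} {B E k m : ℕ} {cnt tl hd : ℕ → ℕ} {s : State}

theorem HasTables.frame {s' : State} {vs as : List ℕ} (h : HasTables S E k m cnt tl hd s)
    (hf : Frame vs as s s') (hv : ∀ x ∈ [0, 2, 3, 4], x ∉ vs)
    (ha : ∀ a ∈ [1, 3, 4, 5, 6, 7, 8, 9], a ∉ as) : HasTables S E k m cnt tl hd s' := by
  simp only [List.mem_cons, List.not_mem_nil, or_false, forall_eq_or_imp, forall_eq] at ha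
  obtain ⟨a1, a3, a4, a5, a6, a7, a8, a9⟩ := ha
  refine ⟨h.toReady.frame hf hv (by simp [*]), ?_, ?_, ?_, ?_, ?_⟩
  · rw [hf.arr 6 a6]; exact h.nodes
  · rw [hf.arr 7 a7]; exact h.child
  · rw [hf.arr 7 a7]; exact h.child_le
  · rw [hf.arr 8 a8]; exact h.size
  · rw [hf.arr 9 a9]; exact h.weight

theorem HasTables.setVar {x v : ℕ} (h : HasTables S E k m cnt tl hd s) (hx : 4 < x) :
    HasTables S E k m cnt tl hd (s.setVar x v) :=
  h.frame (.setVar (vs := [x]) (as := []) _ _ _ (by simp))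
    (by intro y hy; simp at hy ⊢; omega) (by simp)

theorem HasTables.setArr {a i v : ℕ} (h : HasTables S E k m cnt tl hd s) (ha : 9 < a) :
    HasTables S E k m cnt tl hd (s.setArr a i v) :=
  h.frame (.setArr (vs := []) (as := [a]) _ _ _ _ (by simp))
    (by simp) (by intro y hy; simp at hy ⊢; omega)

/-- Find the best root of the subproblem in variable `5`, given the solutions of its children. -/
def solveProg : Cmd :=
  9 ::= #5 *ₑ (#0 +ₑ .lit 1) ;;
  forLoop 6 (#0) (.put 12 (#6) (.lit 0)) ;;
  11 ::= #5 *ₑ #2 ;;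
  forLoop 6 (#2) (
    14 ::= .get 3 (#6) ;;
    .ite (.get 6 (#9 +ₑ #14))
      (.ite (.get 6 (#9 +ₑ .get 4 (#6)))
        (.put 12 (#14) (.get 12 (#14) +ₑ .get 10 (.get 7 (#11 +ₑ #6)))) .skip)
      .skip) ;;
  10 ::= #3 ;;
  12 ::= .lit 0 ;;
  13 ::= .get 9 (#5) ;;
  forLoop 6 (#0) (
    .ite (.get 6 (#9 +ₑ #6))
      (.ite (#13 +ₑ .get 12 (#6) <ₑ #10) (10 ::= #13 +ₑ .get 12 (#6) ;; 12 ::= #6) .skip)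
      .skip) ;;
  .put 10 (#5) (#10) ;;
  .put 11 (#5) (#12)

/-- The value `v` and the root `r` solve the subproblem `I`, given the values `F` of its children. -/
structure Solves (S : SimpleGraph (Fin n)) (E k m : ℕ) (cnt tl hd ch F : ℕ → ℕ) (I v r : ℕ) :
    Prop where
  le : ∀ x, InNodes S (E + 1) k tl hd I x →
    v ≤ ∑ x ∈ nodesOf S (E + 1) k tl hd I, cnt x +
      childSum S (E + 1) k tl hd (fun I e => ch (I * (E + 1) + e)) F I x (E + 1)
  root : v < 2 * n * m + 1 → InNodes S (E + 1) k tl hd I r ∧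
    ∑ x ∈ nodesOf S (E + 1) k tl hd I, cnt x +
      childSum S (E + 1) k tl hd (fun I e => ch (I * (E + 1) + e)) F I r (E + 1) ≤ v

theorem weight_le (hm : ∑ x ∈ Finset.range n, cnt x = m) (I : ℕ) :
    ∑ x ∈ nodesOf S (E + 1) k tl hd I, cnt x ≤ m := by
  rw [← hm, Finset.sum_range]
  exact Finset.sum_le_sum_of_subset (Finset.subset_univ _)

theorem childSum_le {ch : ℕ → ℕ → ℕ} {F : ℕ → ℕ} {top : ℕ} (hF : ∀ i, F i ≤ top) (I r e : ℕ) :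
    childSum S (E + 1) k tl hd ch F I r e ≤ e * top := by
  refine (Finset.sum_le_sum (g := fun _ => top) fun e _ => ?_).trans (by simp)
  split_ifs
  exacts [hF _, Nat.zero_le _]

/-- One scan of the edges adds the value of the part behind `e` to the accumulator of its tail. All
candidate roots are thus evaluated in time `O(n)` together, instead of one edge scan for each. -/
theorem run_solveProg (hn : 0 < n) (hB : Big B n E k m) (h : HasTables S E k m cnt tl hd s)
    (T : EdgeTable S E tl hd) (hm : ∑ x ∈ Finset.range n, cnt x = m) {I : ℕ} (h5 : s.var 5 = I)
    (hI : I < (E + 1) ^ k) (hF : ∀ i, s.arr 10 i ≤ 2 * n * m + 1) :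
    Run B solveProg s (n * 100 + (E + 1) * 100 + 100) fun s' =>
      ∃ v r, v ≤ 2 * n * m + 1 ∧ r < n ∧ Solves S E k m cnt tl hd (s.arr 7) (s.arr 10) I v r ∧
        s'.arr 10 = Function.update (s.arr 10) I v ∧
        s'.arr 11 = Function.update (s.arr 11) I r := by
  unfold solveProg
  have hn' := hB.succ_lt
  have hnodes := hB.nodes
  rw [Nat.succ_mul] at hnodes
  have hdarts := hB.darts
  rw [Nat.succ_mul] at hdarts
  have hval := hB.value
  rw [show (E + 2) * (2 * n * m + 1) = (E + 1) * (2 * n * m + 1) + (2 * n * m + 1) by ring] at hval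
  have hW := weight_le (S := S) (E := E) (k := k) (tl := tl) (hd := hd) hm I
  -- The accumulator of the root `r` after the first `e` edges; at most `e` values are added, which
  -- rules out overflow.
  let A : ℕ → ℕ → ℕ := fun r e => childSum S (E + 1) k tl hd
    (fun I e => s.arr 7 (I * (E + 1) + e)) (s.arr 10) I r e
  have hA : ∀ r e, A r e ≤ e * (2 * n * m + 1) := fun r e => childSum_le hF I r e
  have hA' : ∀ r e, e ≤ E + 1 → A r e ≤ (E + 1) * (2 * n * m + 1) := fun r e he =>
    (hA r e).trans (Nat.mul_le_mul_right _ he)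
  apply Run.of_le
  · apply run_seq
    apply run_set
    · have := mul_add_lt hI (show 0 < n + 1 by omega)
      simp [Expr.Ok, Expr.eval, BinOp.eval, h5, h.var_n]; omega
    apply run_seq
    apply run_for_const n 10 (fun x s' => ∀ y < x, s'.arr 12 y = 0)
    · decide
    · intro s' hf
      simp [Expr.eval, hf.var 0 (by decide), Expr.Ok, h.var_n]
    · intro i s' v h
      simpa using h
    · simp
    · intro x hx s₁ hs₁ hf₁ hx₁ i1
      apply Run.of_le
      · apply run_put
        · simp [Expr.Ok]
        · simp [Expr.Ok]; omega
        intro y hy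
        simp only [Expr.eval, hx₁, State.setArr_arr, ↓reduceIte, Function.update_apply]
        split_ifs
        · rfl
        · exact i1 y (by omega)
      · simp [Expr.time]
    intro s₁ hs₁ hf₁ i1
    have g₁ := (h.setVar (by decide)).frame hf₁ (by decide) (by decide)
    have e5 : s₁.var 5 = I := by simp [hf₁.var 5 (by decide), h5]
    have e9 : s₁.var 9 = I * (n + 1) := by
      simp [hf₁.var 9 (by decide), Expr.eval, BinOp.eval, h5, h.var_n]
    have a7 : s₁.arr 7 = s.arr 7 := by simp [hf₁.arr 7 (by decide)]
    have a10 : s₁.arr 10 = s.arr 10 := by simp [hf₁.arr 10 (by decide)]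
    have a11 : s₁.arr 11 = s.arr 11 := by simp [hf₁.arr 11 (by decide)]
    apply run_seq
    apply run_set
    · have := mul_add_lt hI (show 0 < E + 1 by omega)
      simp [Expr.Ok, Expr.eval, e5, g₁.var_K]; omega
    apply run_seq
    apply run_for_const (E + 1) 50 (fun e s' =>
      ∀ r, InNodes S (E + 1) k tl hd I r → s'.arr 12 r = A r e)
    · decide
    · intro s' hf
      simp [Expr.eval, hf.var 2 (by decide), Expr.Ok, g₁.var_K]
    · intro i s' v h
      simpa using h
    · intro r hr
      simp [A, childSum, i1 r hr.1]
    · intro e he s₂ hs₂ hf₂ he₂ i2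
      have g₂ := (g₁.setVar (by decide)).frame hf₂ (by decide) (by decide)
      have e9' : s₂.var 9 = I * (n + 1) := by simp [hf₂.var 9 (by decide), e9]
      have e11' : s₂.var 11 = I * (E + 1) := by
        simp [hf₂.var 11 (by decide), Expr.eval, BinOp.eval, e5, g₁.var_K]
      have a7' : s₂.arr 7 = s.arr 7 := by simp [hf₂.arr 7 (by decide), a7]
      have a10' : s₂.arr 10 = s.arr 10 := by simp [hf₂.arr 10 (by decide), a10]
      have htl := T.tl_le he
      have hhd := T.hd_lt hn he
      have hrow := mul_add_lt hI (show tl e < n + 1 by omega)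
      have hrow' := mul_add_lt hI (show hd e < n + 1 by omega)
      have hrow'' := mul_add_lt hI he
      have hn1 := g₂.nodes I hI (tl e) (by omega)
      have hn2 := g₂.nodes I hI (hd e) (by omega)
      classical
      have hsucc : ∀ r, A r (e + 1) = A r e + if tl e = r ∧ InNodes S (E + 1) k tl hd I (hd e) then
          s.arr 10 (s.arr 7 (I * (E + 1) + e)) else 0 := fun r => by
        simp only [A, childSum, Finset.sum_range_succ]
      apply Run.of_le
      · apply run_seq
        apply run_set
        · simp [Expr.Ok]
        apply run_ite
        · simp [Expr.Ok, Expr.eval, e9', he₂, g₂.tl_eq]; omega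
        · intro hc
          have hc : InNodes S (E + 1) k tl hd I (tl e) := by
            simpa [Expr.eval, BinOp.eval, e9', he₂, g₂.tl_eq, hn1] using hc
          apply run_ite
          · simp [Expr.Ok, Expr.eval, e9', he₂, g₂.hd_eq]; omega
          · intro hc'
            have hc' : InNodes S (E + 1) k tl hd I (hd e) := by
              simpa [Expr.eval, BinOp.eval, e9', he₂, g₂.hd_eq, hn2] using hc'
            have hle := hA' (tl e) (e + 1) he
            rw [hsucc, if_pos ⟨rfl, hc'⟩] at hle
            apply run_put
            · simp [Expr.Ok]
            · simp [Expr.Ok, Expr.eval, BinOp.eval, e11', he₂, g₂.tl_eq, i2 _ hc, a7', a10']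
              omega
            intro r hr
            rw [hsucc]
            by_cases hr' : r = tl e
            · subst hr'
              simp [Expr.eval, BinOp.eval, e11', he₂, g₂.tl_eq, i2 _ hc, a7', a10', hc']
            · simp [Expr.eval, BinOp.eval, he₂, g₂.tl_eq, hr', Ne.symm hr', i2 r hr]
          · intro hc'
            have hc' : ¬ InNodes S (E + 1) k tl hd I (hd e) := by
              simpa [Expr.eval, BinOp.eval, e9', he₂, g₂.hd_eq, hn2] using hc'
            apply run_skip
            intro r hr
            rw [hsucc, if_neg fun h => hc' h.2, add_zero]
            exact i2 r hr
        · intro hc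
          have hc : ¬ InNodes S (E + 1) k tl hd I (tl e) := by
            simpa [Expr.eval, BinOp.eval, e9', he₂, g₂.tl_eq, hn1] using hc
          apply run_skip
          intro r hr
          rw [hsucc, if_neg fun h : tl e = r ∧ _ => hc (h.1 ▸ hr), add_zero]
          exact i2 r hr
      · simp [Expr.time]
    intro s₂ hs₂ hf₂ i2
    have g₂ := (g₁.setVar (by decide)).frame hf₂ (by decide) (by decide)
    have e5' : s₂.var 5 = I := by simp [hf₂.var 5 (by decide), e5]
    have e9' : s₂.var 9 = I * (n + 1) := by simp [hf₂.var 9 (by decide), e9]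
    have a10' : s₂.arr 10 = s.arr 10 := by simp [hf₂.arr 10 (by decide), a10]
    have a11' : s₂.arr 11 = s.arr 11 := by simp [hf₂.arr 11 (by decide), a11]
    set W := ∑ x ∈ nodesOf S (E + 1) k tl hd I, cnt x with hWdef
    apply run_seq
    apply run_set
    · simp [Expr.Ok]
    apply run_seq
    apply run_set
    · simp [Expr.Ok]; omega
    apply run_seq
    apply run_set
    · simp [Expr.Ok]
    apply run_seq
    -- The search starts at the infinite value with the dummy root `0`, so the recorded root is
    -- meaningful only when the value is finite.
    apply run_for_const n 50 (fun x s' => s'.var 10 ≤ 2 * n * m + 1 ∧ s'.var 12 < n ∧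
      (∀ r < x, InNodes S (E + 1) k tl hd I r → s'.var 10 ≤ W + A r (E + 1)) ∧
      (s'.var 10 < 2 * n * m + 1 → InNodes S (E + 1) k tl hd I (s'.var 12) ∧
        W + A (s'.var 12) (E + 1) ≤ s'.var 10))
    · decide
    · intro s' hf
      simp [Expr.eval, hf.var 0 (by decide), Expr.Ok, g₂.var_n]
    · intro i s' v h
      simpa using h
    · simp [Expr.eval, g₂.var_top, hn]
    · intro x hx s₃ hs₃ hf₃ hx₃ ⟨i3, i4, i5, i6⟩
      have g₃ := (((g₂.setVar (by decide)).setVar (by decide)).setVar (by decide)).frame hf₃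
        (by decide) (by decide)
      have e9'' : s₃.var 9 = I * (n + 1) := by simp [hf₃.var 9 (by decide), e9']
      have e13 : s₃.var 13 = W := by
        simp [hf₃.var 13 (by decide), Expr.eval, e5', g₂.weight I hI, hWdef]
      have a12 : s₃.arr 12 = s₂.arr 12 := by simp [hf₃.arr 12 (by decide)]
      have hn1 := g₃.nodes I hI x (by omega)
      have hrow := mul_add_lt hI (show x < n + 1 by omega)
      have hle := hA' x (E + 1) le_rfl
      apply Run.of_le
      · apply run_ite
        · simp [Expr.Ok, Expr.eval, e9'', hx₃]; omega
        · intro hc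
          have hc : InNodes S (E + 1) k tl hd I x := by
            simpa [Expr.eval, BinOp.eval, e9'', hx₃, hn1] using hc
          have e12 : s₃.arr 12 x = A x (E + 1) := by rw [a12, i2 x hc]
          apply run_ite
          · simp [Expr.Ok, Expr.eval, e13, hx₃, e12]; omega
          · intro hc'
            have hc' : W + A x (E + 1) < s₃.var 10 := by
              simpa [Expr.eval, BinOp.eval, e13, hx₃, e12] using hc'
            apply run_seq
            apply run_set
            · simp [Expr.Ok, Expr.eval, e13, hx₃, e12]; omega
            apply run_set
            · simp [Expr.Ok]
            simp only [Expr.eval, BinOp.eval, e13, hx₃, e12, State.setVar_var, ↓reduceIte,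
              Nat.reduceEqDiff]
            refine ⟨by omega, hx, fun r hr hr' => ?_, fun _ => ⟨hc, le_rfl⟩⟩
            rcases Nat.lt_succ_iff_lt_or_eq.1 hr with hr | rfl
            · exact hc'.le.trans (i5 r hr hr')
            · exact le_rfl
          · intro hc'
            have hc' : s₃.var 10 ≤ W + A x (E + 1) := by
              simpa [Expr.eval, BinOp.eval, e13, hx₃, e12] using hc'
            apply run_skip
            refine ⟨i3, i4, fun r hr hr' => ?_, i6⟩
            rcases Nat.lt_succ_iff_lt_or_eq.1 hr with hr | rfl
            · exact i5 r hr hr'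
            · exact hc'
        · intro hc
          have hc : ¬ InNodes S (E + 1) k tl hd I x := by
            simpa [Expr.eval, BinOp.eval, e9'', hx₃, hn1] using hc
          apply run_skip
          refine ⟨i3, i4, fun r hr hr' => ?_, i6⟩
          rcases Nat.lt_succ_iff_lt_or_eq.1 hr with hr | rfl
          · exact i5 r hr hr'
          · exact absurd hr' hc
      · simp [Expr.time]
    intro s₃ hs₃ hf₃ ⟨i3, i4, i5, i6⟩
    have e5'' : s₃.var 5 = I := by simp [hf₃.var 5 (by decide), e5']
    have a10'' : s₃.arr 10 = s.arr 10 := by simp [hf₃.arr 10 (by decide), a10']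
    have a11'' : s₃.arr 11 = s.arr 11 := by simp [hf₃.arr 11 (by decide), a11']
    apply run_seq
    apply run_put
    · simp [Expr.Ok]
    · simp [Expr.Ok]
    apply run_put
    · simp [Expr.Ok]
    · simp [Expr.Ok]
    refine ⟨s₃.var 10, s₃.var 12, i3, i4, ⟨fun x hx => i5 x hx.1 hx, i6⟩, ?_, ?_⟩
    · simp [Expr.eval, e5'', a10'']
    · simp [Expr.eval, e5'', a11'']
  · simp [Expr.time]; ring_nf; omega

end

/-! ### Order of evaluation of the recurrence -/

section

variable {n : ℕ} {S : SimpleGraph (Fin n)} {B E k m : ℕ} {cnt tl hd : ℕ → ℕ} {s : State}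

theorem EdgeTable.card_nodesOf_childOf_lt (T : EdgeTable S E tl hd) (hS : S.IsTree) {I e : ℕ}
    (hI : I < (E + 1) ^ k) (he : e < E + 1) (h1 : InNodes S (E + 1) k tl hd I (tl e))
    (h2 : InNodes S (E + 1) k tl hd I (hd e))
    (hc : childOf S (E + 1) k tl hd I e < (E + 1) ^ k) :
    (nodesOf S (E + 1) k tl hd (childOf S (E + 1) k tl hd I e)).card <
      (nodesOf S (E + 1) k tl hd I).card := by
  obtain rfl | ⟨d, rfl⟩ := T.cases he
  · rw [T.tl_zero] at h1
    exact absurd h1.1 (lt_irrefl n)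
  · rw [T.tl_succ, inNodes_iff] at h1
    rw [T.hd_succ, inNodes_iff] at h2
    exact (T.subproblems hS k).card_nodes_child_lt hI (mem_dartsAt.2 ⟨rfl, h2⟩) h1 hc

/-- A child of `J` has strictly fewer nodes than `J`, hence fewer than `I`. So `I` is not among the
children, and writing its value does not disturb the solution of `J`. -/
theorem Solves.update {ch F : ℕ → ℕ} {I J v r : ℕ} (h : Solves S E k m cnt tl hd ch F J v r)
    (T : EdgeTable S E tl hd) (hS : S.IsTree)
    (hch : ∀ I < (E + 1) ^ k, ∀ e < E + 1,
      ch (I * (E + 1) + e) = childOf S (E + 1) k tl hd I e)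
    (hI : I < (E + 1) ^ k) (hJ : J < (E + 1) ^ k)
    (hIJ : (nodesOf S (E + 1) k tl hd J).card ≤ (nodesOf S (E + 1) k tl hd I).card) (v' : ℕ) :
    Solves S E k m cnt tl hd ch (Function.update F I v') J v r := by
  have key : ∀ x, InNodes S (E + 1) k tl hd J x →
      childSum S (E + 1) k tl hd (fun I e => ch (I * (E + 1) + e)) (Function.update F I v') J x
        (E + 1) =
      childSum S (E + 1) k tl hd (fun I e => ch (I * (E + 1) + e)) F J x (E + 1) := by
    intro x hx
    refine Finset.sum_congr rfl fun e he => ?_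
    split_ifs with h
    · obtain ⟨rfl, h2⟩ := h
      have he := Finset.mem_range.1 he
      simp only [hch J hJ e he]
      rw [Function.update_of_ne]
      rintro rfl
      exact (T.card_nodesOf_childOf_lt hS hJ he hx h2 hI).not_ge hIJ
    · rfl
  refine ⟨fun x hx => ?_, fun hv => ?_⟩
  · rw [key x hx]; exact h.le x hx
  · obtain ⟨h1, h2⟩ := h.root hv
    exact ⟨h1, by rwa [key _ h1]⟩

/-- Solve all subproblems by increasing number of nodes. -/
def dpProg : Cmd :=
  .put 10 (#4) (#3) ;;
  forLoop 16 (#0 +ₑ .lit 1) (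
    forLoop 5 (#4) (.ite (.get 8 (#5) =ₑ #16) solveProg .skip))

/-- The subproblems in the set `A` have been solved. -/
structure Solved (S : SimpleGraph (Fin n)) (E k m : ℕ) (cnt tl hd : ℕ → ℕ) (A : ℕ → Prop)
    (s : State) : Prop where
  solves : ∀ J < (E + 1) ^ k, A J →
    Solves S E k m cnt tl hd (s.arr 7) (s.arr 10) J (s.arr 10 J) (s.arr 11 J)
  le : ∀ i, s.arr 10 i ≤ 2 * n * m + 1
  lt : ∀ i, s.arr 11 i < n
  top : s.arr 10 ((E + 1) ^ k) = 2 * n * m + 1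

/-- Every subproblem is solved in exactly one of the `n + 1` outer rounds, so the expensive steps
sum to `(E + 1) ^ k` times the cost of one solution; the other rounds only test the size. -/
theorem run_dpProg (hn : 0 < n) (hB : Big B n E k m) (h : HasTables S E k m cnt tl hd s)
    (T : EdgeTable S E tl hd) (hS : S.IsTree) (hm : ∑ x ∈ Finset.range n, cnt x = m)
    (h10 : ∀ i, s.arr 10 i = 0) (h11 : ∀ i, s.arr 11 i = 0) :
    Run B dpProg s
      ((E + 1) ^ k * (n * 200 + (E + 1) * 100 + 200) + n * 40 + 60)
      (Solved S E k m cnt tl hd fun _ => True) := by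
  unfold dpProg
  have hn' := hB.succ_lt
  have hcard : ∀ J, (nodesOf S (E + 1) k tl hd J).card < n + 1 := fun J =>
    Nat.lt_succ_of_le ((Finset.card_le_univ _).trans_eq (Fintype.card_fin n))
  let w := n * 100 + (E + 1) * 100 + 100
  let u : ℕ → ℕ → ℕ := fun z I => if (nodesOf S (E + 1) k tl hd I).card = z then w else 0
  have htime : ∑ z ∈ Finset.range (n + 1), ∑ I ∈ Finset.range ((E + 1) ^ k), u z I =
      (E + 1) ^ k * w := by
    -- For fixed `I`, only the round `z` equal to its size contributes.
    rw [Finset.sum_comm]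
    simp [u, hcard]
  apply Run.of_le
  · apply run_seq
    apply run_put
    · simp [Expr.Ok]
    · simp [Expr.Ok]
    apply run_for (n + 1)
      (fun z => (∑ I ∈ Finset.range ((E + 1) ^ k), (6 + u z I + 8)) + 6)
      (fun z => Solved S E k m cnt tl hd fun J => (nodesOf S (E + 1) k tl hd J).card < z)
    · decide
    · intro s' hf
      simp [Expr.eval, BinOp.eval, hf.var 0 (by decide), Expr.Ok, h.var_n]; omega
    · intro i s' v h
      exact ⟨by simpa using h.solves, by simpa using h.le, by simpa using h.lt, by simpa using h.top⟩
    · refine ⟨by simp, fun i => ?_, ?_, ?_⟩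
      · simp only [Expr.eval, State.setArr_arr, ↓reduceIte, Function.update_apply, h.var_top, h10]
        split_ifs <;> omega
      · simpa [h11] using hn
      · simp [Expr.eval, h.var_top, h.var_P]
    · intro z hz s₁ hs₁ hf₁ hz₁ i1
      have g₁ := (h.setArr (by decide)).frame hf₁ (by decide) (by decide)
      apply Run.of_le
      · apply run_for ((E + 1) ^ k) (fun I => 6 + u z I)
          (fun I => Solved S E k m cnt tl hd fun J => (nodesOf S (E + 1) k tl hd J).card < z ∨
            (nodesOf S (E + 1) k tl hd J).card = z ∧ J < I)
        · decide
        · intro s' hf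
          simp [Expr.eval, hf.var 4 (by decide), Expr.Ok, g₁.var_P]
        · intro i s' v h
          exact ⟨by simpa using h.solves, by simpa using h.le, by simpa using h.lt,
            by simpa using h.top⟩
        · exact ⟨by simpa using i1.solves, i1.le, i1.lt, i1.top⟩
        · intro I hI s₂ hs₂ hf₂ hI₂ i2
          have g₂ := g₁.frame hf₂ (by decide) (by decide)
          have e16 : s₂.var 16 = z := by simp [hf₂.var 16 (by decide), hz₁]
          by_cases hIz : (nodesOf S (E + 1) k tl hd I).card = z
          · apply Run.of_le
            · apply run_ite_true
              · simp [Expr.Ok]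
              · simp [Expr.eval, BinOp.eval, hI₂, e16, g₂.size I hI, hIz]
              apply (run_solveProg hn hB g₂ T hm hI₂ hI i2.le).mono
              rintro s₃ hs₃ hf₃ ⟨v, r, hv, hr, hvr, a10, a11⟩
              have a7 : s₃.arr 7 = s₂.arr 7 := hf₃.arr 7 (by decide)
              refine ⟨fun J hJ hJz => ?_, fun i => ?_, fun i => ?_, ?_⟩
              · rw [a7, a10, a11]
                by_cases hJI : J = I
                · subst hJI
                  simpa using hvr.update T hS g₂.child hI hI le_rfl v
                · have hJz' : (nodesOf S (E + 1) k tl hd J).card < z ∨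
                      (nodesOf S (E + 1) k tl hd J).card = z ∧ J < I := by omega
                  simpa [hJI] using (i2.solves J hJ hJz').update T hS g₂.child hI hJ (by omega) v
              · rw [a10, Function.update_apply]
                split_ifs
                exacts [hv, i2.le i]
              · rw [a11, Function.update_apply]
                split_ifs
                exacts [hr, i2.lt i]
              · rw [a10, Function.update_of_ne hI.ne']
                exact i2.top
            · simp [Expr.time, u, hIz, w]
          · apply Run.of_le
            · apply run_ite_false
              · simp [Expr.Ok]
              · simp [Expr.eval, BinOp.eval, hI₂, e16, g₂.size I hI, hIz]
              apply run_skip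
              refine ⟨fun J hJ hJz => i2.solves J hJ ?_, i2.le, i2.lt, i2.top⟩
              rcases hJz with h | ⟨h, h'⟩
              · exact .inl h
              · refine .inr ⟨h, lt_of_le_of_ne (Nat.lt_succ_iff.1 h') ?_⟩
                rintro rfl
                exact hIz h
            · simp [Expr.time]
        · intro s₂ hs₂ hf₂ i2
          refine ⟨fun J hJ hJz => i2.solves J hJ ?_, i2.le, i2.lt, i2.top⟩
          rcases Nat.lt_succ_iff_lt_or_eq.1 hJz with h | h
          exacts [.inl h, .inr ⟨h, hJ⟩]
      · simp [Expr.time]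
    · intro s₁ hs₁ hf₁ i1
      exact ⟨fun J hJ _ => i1.solves J hJ (hcard J), i1.le, i1.lt, i1.top⟩
  · simp only [Finset.sum_add_distrib, htime, Expr.time]
    simp [w]
    ring_nf
    omega

end

/-! ### Output of the search tree -/

section

variable {n : ℕ} {S : SimpleGraph (Fin n)} {B E k m : ℕ} {cnt tl hd : ℕ → ℕ} {s : State}

theorem nextOf_le {ch : ℕ → ℕ → ℕ} {P r I x : ℕ} (hI : I ≤ P) (hch : ∀ e, ch I e ≤ P) (e : ℕ) :
    nextOf S tl hd ch r I x e ≤ P := by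
  induction e with
  | zero => exact hI
  | succ e ih =>
    rw [nextOf]
    split_ifs
    exacts [hch e, ih]

/-- Compute the parents of all nodes, by following their search paths. -/
def outProg : Cmd :=
  forLoop 16 (#0) (
    17 ::= .lit 0 ;;
    18 ::= .lit 0 ;;
    forLoop 5 (#0) (
      9 ::= .get 11 (#17) ;;
      .ite (#9 =ₑ #16) .skip (
        10 ::= #17 *ₑ #2 ;;
        11 ::= #17 ;;
        forLoop 6 (#2) (
          .ite (.get 3 (#6) =ₑ #9)
            (.ite (.get 5 (#6 *ₑ (#0 +ₑ .lit 1) +ₑ #16)) (11 ::= .get 7 (#10 +ₑ #6)) .skip)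
            .skip) ;;
        17 ::= #11 ;;
        18 ::= #9 +ₑ .lit 1)) ;;
    .put 2 (#16) (#18))

/-- The program simulates `stepOf` literally. Indices up to `(E + 1) ^ k` are allowed for the
current subproblem, so no validity has to be tracked; `Big` leaves space for this extra row. -/
theorem run_outProg (hB : Big B n E k m) (h : HasTables S E k m cnt tl hd s)
    (h11 : ∀ i, s.arr 11 i < n) :
    Run B outProg s (n * (n * ((E + 1) * 50 + 50) + 50) + 10) fun s' =>
      ∀ x < n, s'.arr 2 x = ((stepOf S (E + 1) tl hd (fun I e => s.arr 7 (I * (E + 1) + e))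
        (s.arr 11) x)^[n] (0, 0)).2 := by
  unfold outProg
  have hn := hB.succ_lt
  have hdarts := hB.darts
  have hsides := hB.sides
  let step : ℕ → ℕ × ℕ → ℕ × ℕ := fun x =>
    stepOf S (E + 1) tl hd (fun I e => s.arr 7 (I * (E + 1) + e)) (s.arr 11) x
  apply Run.of_le
  · apply run_for_const n (n * ((E + 1) * 50 + 50) + 40)
      (fun i s' => ∀ x < i, s'.arr 2 x = ((step x)^[n] (0, 0)).2)
    · decide
    · intro s' hf
      simp [Expr.eval, hf.var 0 (by decide), Expr.Ok, h.var_n]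
    · intro i s' v h
      simpa using h
    · simp
    · intro x hx s₁ hs₁ hf₁ hx₁ i1
      have g₁ := h.frame hf₁ (by decide) (by decide)
      have a7 : s₁.arr 7 = s.arr 7 := by simp [hf₁.arr 7 (by decide)]
      have a11 : s₁.arr 11 = s.arr 11 := by simp [hf₁.arr 11 (by decide)]
      apply Run.of_le
      · apply run_seq
        apply run_set
        · simp [Expr.Ok]; omega
        apply run_seq
        apply run_set
        · simp [Expr.Ok]; omega
        apply run_seq
        apply run_for_const n ((E + 1) * 50 + 40)
          (fun i s' => s'.var 17 ≤ (E + 1) ^ k ∧ (s'.var 17, s'.var 18) = (step x)^[i] (0, 0))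
        · decide
        · intro s' hf
          simp [Expr.eval, hf.var 0 (by decide), Expr.Ok, g₁.var_n]
        · intro i s' v h
          simpa using h
        · simp [Expr.eval]
        · intro i hi s₂ hs₂ hf₂ hi₂ ⟨i2, i3⟩
          have g₂ := ((g₁.setVar (by decide)).setVar (by decide)).frame hf₂ (by decide) (by decide)
          have a7' : s₂.arr 7 = s.arr 7 := by simp [hf₂.arr 7 (by decide), a7]
          have a11' : s₂.arr 11 = s.arr 11 := by simp [hf₂.arr 11 (by decide), a11]
          have e16 : s₂.var 16 = x := by simp [hf₂.var 16 (by decide), hx₁]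
          set I := s₂.var 17 with hIdef
          set r := s.arr 11 I with hr
          have hrn : r < n := h11 I
          have hrow : ∀ e < E + 1, I * (E + 1) + e < ((E + 1) ^ k + 1) * (E + 1) := fun e he =>
            mul_add_lt (Nat.lt_succ_of_le i2) he
          apply Run.of_le
          · apply run_seq
            apply run_set
            · simp [Expr.Ok]
            apply run_ite
            · simp [Expr.Ok]
            · intro hc
              have hc : r = x := by
                simpa [Expr.eval, BinOp.eval, e16, a11', ← hIdef, ← hr] using hc
              apply run_skip
              refine ⟨by simpa [← hIdef] using i2, ?_⟩
              rw [Function.iterate_succ_apply', ← i3]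
              simp [step, stepOf, ← hIdef, ← hr, hc]
            · intro hc
              have hc : r ≠ x := by
                simpa [Expr.eval, BinOp.eval, e16, a11', ← hIdef, ← hr] using hc
              apply run_seq
              apply run_set
              · have := hrow 0 (Nat.succ_pos E)
                simp [Expr.Ok, Expr.eval, g₂.var_K, ← hIdef]; omega
              apply run_seq
              apply run_set
              · simp [Expr.Ok]
              apply run_seq
              apply run_for_const (E + 1) 40 (fun e s' => s'.var 11 = nextOf S tl hd
                (fun I e => s.arr 7 (I * (E + 1) + e)) r I x e)
              · decide
              · intro s' hf
                simp [Expr.eval, hf.var 2 (by decide), Expr.Ok, g₂.var_K]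
              · intro i s' v h
                simpa using h
              · simp [Expr.eval, nextOf, ← hIdef]
              · intro e he s₃ hs₃ hf₃ he₃ i4
                have g₃ := (((g₂.setVar (by decide)).setVar (by decide)).setVar (by decide)).frame
                  hf₃ (by decide) (by decide)
                have a7'' : s₃.arr 7 = s.arr 7 := by simp [hf₃.arr 7 (by decide), a7']
                have e16' : s₃.var 16 = x := by simp [hf₃.var 16 (by decide), e16]
                have e9 : s₃.var 9 = r := by
                  simp [hf₃.var 9 (by decide), Expr.eval, a11', ← hIdef, ← hr]
                have e10 : s₃.var 10 = I * (E + 1) := by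
                  simp [hf₃.var 10 (by decide), Expr.eval, BinOp.eval, g₂.var_K, ← hIdef]
                have hrow' := mul_add_lt he (show x < n + 1 by omega)
                have hrow'' := mul_add_lt he (show 0 < n + 1 by omega)
                have hle := hrow e he
                have hsd := g₃.sides e he x (by omega)
                apply Run.of_le
                · apply run_ite
                  · simp [Expr.Ok]
                  · intro hc
                    have hc : tl e = r := by
                      simpa [Expr.eval, BinOp.eval, e9, he₃, g₃.tl_eq] using hc
                    apply run_ite
                    · simp [Expr.Ok, Expr.eval, BinOp.eval, he₃, g₃.var_n, e16']; omega
                    · intro hc'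
                      have hc' : Behind S tl hd e x := by
                        simpa [Expr.eval, BinOp.eval, e16', he₃, g₃.var_n, hsd] using hc'
                      apply run_set
                      · simp [Expr.Ok, Expr.eval, e10, he₃]; omega
                      rw [nextOf, if_pos ⟨hc, hc'⟩]
                      simp [Expr.eval, BinOp.eval, e10, he₃, a7'']
                    · intro hc'
                      have hc' : ¬ Behind S tl hd e x := by
                        simpa [Expr.eval, BinOp.eval, e16', he₃, g₃.var_n, hsd] using hc'
                      apply run_skip
                      rw [nextOf, if_neg fun h => hc' h.2, i4]
                  · intro hc
                    have hc : tl e ≠ r := by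
                      simpa [Expr.eval, BinOp.eval, e9, he₃, g₃.tl_eq] using hc
                    apply run_skip
                    rw [nextOf, if_neg fun h => hc h.1, i4]
                · simp [Expr.time]
              intro s₃ hs₃ hf₃ i4
              have e9 : s₃.var 9 = r := by
                simp [hf₃.var 9 (by decide), Expr.eval, a11', ← hIdef, ← hr]
              apply run_seq
              apply run_set
              · simp [Expr.Ok]
              apply run_set
              · simp [Expr.Ok, Expr.eval, e9]; omega
              refine ⟨?_, ?_⟩
              · simp only [Expr.eval, i4, State.setVar_var]
                exact nextOf_le i2 (fun e => h.child_le _) _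
              · rw [Function.iterate_succ_apply', ← i3]
                simp [step, stepOf, ← hr, hc, Expr.eval, BinOp.eval, i4, e9]
          · simp [Expr.time]; ring_nf; omega
        intro s₂ hs₂ hf₂ ⟨i2, i3⟩
        have e16 : s₂.var 16 = x := by simp [hf₂.var 16 (by decide), hx₁]
        have a2 : s₂.arr 2 = s₁.arr 2 := by simp [hf₂.arr 2 (by decide)]
        apply run_put
        · simp [Expr.Ok]
        · simp [Expr.Ok]
        intro y hy
        simp only [Expr.eval, e16, State.setArr_arr, ↓reduceIte, Function.update_apply]
        split_ifs with hyx
        · rw [hyx, ← i3]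
        · rw [a2, i1 y (by omega)]
      · simp [Expr.time]; ring_nf; omega
    · intro s₁ hs₁ hf₁ i1
      exact i1
  · simp [Expr.time]; ring_nf; omega

end

/-! ### The algorithm -/

/-- The program that runs after the edges have been listed. -/
def mainProg (k : ℕ) : Cmd :=
  sidesProg ;; initProg k ;; tablesProg k ;; dpProg ;; outProg

/-- A bound for the running time of `mainProg k`. -/
def mainTime (n E k : ℕ) : ℕ :=
  ((E + 1) * (n * ((E + 1) * 40 + 20) + 40) + 10) +
  ((n * 20 + k * 20 + 50) +
  (((E + 1) ^ k * (n * (k * 50 + 60) + (E + 1) * (k * 80 + 70) + 80) + 10) +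
  (((E + 1) ^ k * (n * 200 + (E + 1) * 100 + 200) + n * 40 + 60) +
  (n * (n * ((E + 1) * 50 + 50) + 50) + 10))))

/-- The dominant terms are `(E + 1) ^ k ≤ (2 * n) ^ k` subproblems at `O(n)` each. The cubic cost of
the half-spaces and of the output is absorbed because `k ≥ 2`. -/
theorem mainTime_le {n E : ℕ} (hn : 0 < n) (hE : E + 1 ≤ 2 * n) {k : ℕ} (hk : 2 ≤ k) :
    mainTime n E k ≤ (2 ^ k * (k * 210 + 1000) + k * 20 + 1000) * n ^ (k + 1) := by
  have hR : 1 ≤ n ^ k := Nat.one_le_pow _ _ hn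
  have hK : (E + 1) ^ k ≤ 2 ^ k * n ^ k := (Nat.pow_le_pow_left hE k).trans_eq (mul_pow _ _ _)
  have hQ : n ^ (k + 1) = n ^ k * n := pow_succ _ _
  have h3 : n * n * n ≤ n ^ (k + 1) := by
    calc n * n * n = n ^ 3 := by ring
      _ ≤ _ := Nat.pow_le_pow_right hn (by omega)
  have h2 : n * n ≤ n * n * n := Nat.le_mul_of_pos_right _ hn
  have h1 : n ≤ n * n := Nat.le_mul_of_pos_right _ hn
  have hRQ : n ^ k ≤ n ^ (k + 1) := Nat.pow_le_pow_right hn (by omega)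
  set Q := n ^ (k + 1) with hQdef
  have e1 : (E + 1) * (n * ((E + 1) * 40 + 20) + 40) ≤ 280 * Q :=
    calc (E + 1) * (n * ((E + 1) * 40 + 20) + 40)
        ≤ (2 * n) * (n * ((2 * n) * 40 + 20) + 40) := by gcongr
      _ = 160 * (n * n * n) + 40 * (n * n) + 80 * n := by ring
      _ ≤ _ := by omega
  have e2 : n * (n * ((E + 1) * 50 + 50) + 50) ≤ 200 * Q :=
    calc n * (n * ((E + 1) * 50 + 50) + 50)
        ≤ n * (n * ((2 * n) * 50 + 50) + 50) := by gcongr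
      _ = 100 * (n * n * n) + 50 * (n * n) + 50 * n := by ring
      _ ≤ _ := by omega
  have e3 : ∀ a b c, (E + 1) ^ k * (n * a + (E + 1) * b + c) ≤ 2 ^ k * (a + 2 * b + c) * Q :=
    fun a b c =>
    calc (E + 1) ^ k * (n * a + (E + 1) * b + c)
        ≤ (2 ^ k * n ^ k) * (n * a + (2 * n) * b + c * n) := by
          gcongr
          exact Nat.le_mul_of_pos_right _ hn
      _ = 2 ^ k * (a + 2 * b + c) * (n ^ k * n) := by ring
      _ = _ := by rw [hQ]
  have e4 := e3 (k * 50 + 60) (k * 80 + 70) 80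
  have e5 := e3 200 100 200
  have e6 : k * 20 ≤ k * 20 * Q := Nat.le_mul_of_pos_right _ (by omega)
  calc mainTime n E k ≤ (280 * Q + 10 * Q) + ((20 * Q + k * 20 * Q + 50 * Q) +
      ((2 ^ k * (k * 50 + 60 + 2 * (k * 80 + 70) + 80) * Q + 10 * Q) +
      ((2 ^ k * (200 + 2 * 100 + 200) * Q + 40 * Q + 60 * Q) + (200 * Q + 10 * Q)))) := by
        unfold mainTime
        omega
    _ = (2 ^ k * (k * 210 + 880) + k * 20 + 680) * Q := by ring
    _ ≤ _ := by gcongr <;> omega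

theorem run_mainProg {n : ℕ} {S : SimpleGraph (Fin n)} {B E m t : ℕ} {tl hd : ℕ → ℕ} {s : State}
    (hS : S.IsTree) (ht : 1 ≤ t) (X : List (Fin n)) {cnt : ℕ → ℕ}
    (hcnt : ∀ x : Fin n, cnt x = X.count x) (hm : X.length = m)
    (hB : Big B n E (2 * t) m) (T : EdgeTable S E tl hd) (h : HasEdges n E cnt tl hd s)
    (h0 : ∀ a, 4 < a → ∀ i, s.arr a i = 0) :
    Run B (mainProg (2 * t)) s (mainTime n E (2 * t)) fun s' => ∃ parent,
      IsOutput s' parent ∧ IsSearchTree S parent ∧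
        (cost parent X : ℝ) ≤ (1 + 1 / (t : ℝ)) * (opt S X : ℝ) := by
  have hn : 0 < n := by
    obtain ⟨v⟩ := hS.connected.nonempty
    exact (Nat.zero_le _).trans_lt v.2
  have hsum : ∑ x ∈ Finset.range n, cnt x = m := by
    rw [Finset.sum_range, ← hm]
    simp only [hcnt]
    simpa using Multiset.sum_count_eq_card (s := Finset.univ) (m := (X : Multiset (Fin n))) (by simp)
  unfold mainProg mainTime
  apply run_seq
  apply (run_sidesProg hn T h (h0 5 (by decide)) hB.sides).mono
  intro s₁ hs₁ hf₁ hsd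
  have g₁ := h.frame hf₁ (by decide) (by decide)
  have z₁ : ∀ a ∈ [6, 7, 10, 11], ∀ i, s₁.arr a i = 0 := by
    simp [hf₁.arr 6 (by decide), hf₁.arr 7 (by decide), hf₁.arr 10 (by decide),
      hf₁.arr 11 (by decide), h0]
  apply run_seq
  apply (run_initProg hn g₁ hsum hB).mono
  intro s₂ hs₂ hf₂ ⟨htop, hP⟩
  have g₂ : Ready S E (2 * t) m cnt tl hd s₂ := by
    refine ⟨g₁.frame hf₂ (of_decide_eq_true rfl) (of_decide_eq_true rfl), ?_, htop, hP⟩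
    rw [HasSides, hf₂.arr 5 (of_decide_eq_true rfl)]
    exact hsd
  have z₂ : ∀ a ∈ [6, 7, 10, 11], ∀ i, s₂.arr a i = 0 := fun a ha i => by
    rw [hf₂.arr a, z₁ a ha]
    simp only [List.mem_cons, List.not_mem_nil, or_false] at ha
    rcases ha with rfl | rfl | rfl | rfl <;> exact of_decide_eq_true rfl
  apply run_seq
  apply (run_tablesProg hB g₂ T hsum (z₂ 6 (by decide)) (z₂ 7 (by decide))).mono
  intro s₃ hs₃ hf₃ g₃
  apply run_seq
  apply (run_dpProg hn hB g₃ T hS hsum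
    (fun i => by rw [hf₃.arr 10 (of_decide_eq_true rfl), z₂ 10 (by decide)])
    (fun i => by rw [hf₃.arr 11 (of_decide_eq_true rfl), z₂ 11 (by decide)])).mono
  intro s₄ hs₄ hf₄ g₄
  have g₅ := g₃.frame hf₄ (by decide) (by decide)
  obtain ⟨parent, h1, h2⟩ := T.approx_of_tables hS ht X
    (ch := fun I e => s₄.arr 7 (I * (E + 1) + e)) (F := s₄.arr 10) (c := s₄.arr 11)
    g₅.child
    (fun I hI r hr => by
      have := (g₄.solves I hI trivial).le r hr
      simpa only [hcnt] using this)
    (fun I hI hlt => by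
      have := (g₄.solves I hI trivial).root (hm ▸ hlt)
      simpa only [hcnt] using this)
    (hm ▸ g₄.top) g₄.lt
  apply (run_outProg hB g₅ g₄.lt).mono
  intro s₅ hs₅ hf₅ h₅
  exact ⟨parent, fun x => (h₅ x x.2).trans (h1 x), h2⟩

/-- Each bound is a power of `M = n + m + 1`, using `2 ≤ M` and `E + 1 ≤ 2 * n ≤ M ^ 2`. The largest
exponents needed are `2 * k + 3` and `6`, so `2 * k + 10` is ample. -/
theorem big_pow {n E m k : ℕ} (hE : E + 1 ≤ 2 * n) (hn : 0 < n) :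
    Big ((n + m + 1) ^ (2 * k + 10)) n E k m := by
  set M := n + m + 1 with hM
  have hlt : ∀ {a j : ℕ}, a ≤ M ^ j → j < 2 * k + 10 → a < M ^ (2 * k + 10) := fun ha hj =>
    ha.trans_lt (Nat.pow_lt_pow_right (by omega) hj)
  have h2n : 2 * n ≤ M ^ 2 := by
    rw [pow_two]; exact Nat.mul_le_mul (by omega) (by omega)
  have hP : (E + 1) ^ k ≤ M ^ (2 * k) :=
    (Nat.pow_le_pow_left (hE.trans h2n) k).trans_eq (pow_mul _ _ _).symm
  have hP1 : (E + 1) ^ k + 1 ≤ M ^ (2 * k + 1) := by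
    rw [pow_succ]
    have := Nat.mul_le_mul_left (M ^ (2 * k)) (show 2 ≤ M by omega)
    have := Nat.one_le_pow (2 * k) M (by omega)
    omega
  have hn1 : n + 1 ≤ M ^ 1 := by rw [pow_one]; omega
  have h3 : E + 2 ≤ M ^ 3 := by
    rw [pow_succ]
    have := Nat.mul_le_mul_left (M ^ 2) (show 2 ≤ M by omega)
    have := Nat.one_le_pow 2 M (by omega)
    omega
  have h4 : 2 * n * m + 1 ≤ M ^ 2 := by
    rw [hM]; ring_nf; nlinarith [sq_nonneg (n : ℤ)]
  refine ⟨hlt (j := 2 * k + 2) ?_ (by omega), hlt (j := 2 * k + 3) ?_ (by omega),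
    hlt (j := 3) ?_ (by omega), hlt (j := 6) ?_ (by omega), hlt (j := k) ?_ (by omega)⟩
  · rw [pow_add M (2 * k + 1) 1]; exact Nat.mul_le_mul hP1 hn1
  · rw [pow_add M (2 * k + 1) 2]; exact Nat.mul_le_mul hP1 (hE.trans h2n)
  · rw [pow_add M 2 1]; exact Nat.mul_le_mul (hE.trans h2n) hn1
  · rw [pow_succ]
    have h5 : (E + 2) * (2 * n * m + 1) ≤ M ^ 3 * M ^ 2 := Nat.mul_le_mul h3 h4
    rw [← pow_add, show 3 + 2 = 5 from rfl] at h5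
    have := Nat.mul_le_mul_left (M ^ 5) (show 2 ≤ M by omega)
    have : m ≤ M ^ 5 := (show m ≤ M by omega).trans (Nat.le_self_pow (by decide) M)
    omega
  · exact (Nat.lt_pow_self (by omega)).le

end STT

/-- For every `t ≥ 1` there is a program that, for every tree `S` on `n` nodes and every search
sequence `X` of length `m`, given `S` and the search frequencies, computes in time
`O(n ^ (2 * t + 1))`, with words of `O(log (n + m))` bits, a search tree on `S` that serves `X`
with cost at most `(1 + 1 / t) * OPT(X)`. -/
theorem theorem1 (t : ℕ) (ht : 1 ≤ t) :
    ∃ (P : STT.Cmd) (C D : ℕ), ∀ (n : ℕ) (S : SimpleGraph (Fin n)) (X : List (Fin n)), S.IsTree →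
      ∃ (k : ℕ) (s : STT.State) (parent : Fin n → Option (Fin n)),
        STT.Exec ((n + X.length + 1) ^ D) P (STT.input S X) k s ∧
        k ≤ C * n ^ (2 * t + 1) ∧
        STT.IsOutput s parent ∧
        STT.IsSearchTree S parent ∧
        (STT.cost parent X : ℝ) ≤ (1 + 1 / (t : ℝ)) * (STT.opt S X : ℝ) := by
  classical
  -- The summand `80` pays for listing the edges, as `40 * (n * n) + 40 ≤ 80 * (n * n)`; the rest is
  -- the constant of `mainTime_le` for `k = 2 * t`, and the word exponent is that of `big_pow`.
  refine ⟨.seq STT.edgesProg (STT.mainProg (2 * t)),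
    80 + (2 ^ (2 * t) * (2 * t * 210 + 1000) + 2 * t * 20 + 1000), 2 * (2 * t) + 10,
    fun n S X hS => ?_⟩
  have hn : 0 < n := by
    obtain ⟨v⟩ := hS.connected.nonempty
    exact (Nat.zero_le _).trans_lt v.2
  set B := (n + X.length + 1) ^ (2 * (2 * t) + 10) with hB
  have hBle : (n + X.length + 1) ^ 3 ≤ B := Nat.pow_le_pow_right (by omega) (by omega)
  have hB3 : n * n + n + X.length + 1 < B := by
    refine lt_of_lt_of_le ?_ hBle
    have : 1 * 1 ≤ n * n := Nat.mul_le_mul hn hn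
    ring_nf
    nlinarith
  have hin : STT.Bounded B (STT.input S X) := by
    refine ⟨by omega, fun x => ?_, fun a i => ?_⟩
    · simp only [STT.input]
      split_ifs <;> omega
    · simp only [STT.input]
      split_ifs with _ _ _ h
      · omega
      · omega
      · have := List.count_le_length (a := (⟨i, h⟩ : Fin n)) (l := X)
        omega
      · omega
      · omega
  obtain ⟨k, s, hk, hkt, hs, hf, E, tl, hd, ⟨T⟩, h⟩ := STT.run_edgesProg (S := S) (B := B)
    (s := STT.input S X) rfl rfl (fun i => by
      simp only [STT.input, STT.IsEdgeCode, ↓reduceIte]; congr) rfl (by omega) hin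
  obtain ⟨l, s', hl, hlt, -, -, parent, hout, htree, hcost⟩ := STT.run_mainProg hS ht X
    (fun x => by simp [STT.input]) rfl (STT.big_pow (T.succ_le hS) hn) T h
    (fun a ha i => by
      rw [hf.arr a (by simp [STT.edgesProg, STT.forLoop, STT.Cmd.wa]; omega)]
      simp [STT.input, show a ≠ 0 by omega, show a ≠ 1 by omega]) hs
  refine ⟨k + l, s', parent, .seq _ _ _ _ _ _ _ hk hl, ?_, hout, htree, hcost⟩
  have h1 : 1 * 1 ≤ n * n := Nat.mul_le_mul hn hn
  have h2 : n * n ≤ n ^ (2 * t + 1) := by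
    rw [← pow_two]; exact Nat.pow_le_pow_right hn (by omega)
  have h3 := hlt.trans (STT.mainTime_le hn (T.succ_le hS) (by omega))
  rw [Nat.add_mul]
  omega
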